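/- Let $d\ge 2$, let $\Lambda\subset\mathbb{R}^d$ be a ($d$-dimensional) discrete lattice, and let $S$ be a symmetric, irreducible random walk on $\Lambda$ with bounded increments whose covariance matrix is the identity; write $p(x,y)$ for its transition probabilities and $S_0=0$. Let $B_r=\{x\in\Lambda:|x|<r\}$, where $|\cdot|$ is the Euclidean norm, and for $K\subset\Lambda$ let $\partial K=\{x\in\Lambda\setminus K: p(x,y)>0 \text{ for some } y\in K\}$ and $\sigma_K=\min\{j\ge 1:S_j\notin K\}$. For a natural number $l$ let $\Omega_l$ be the set of finite sequences $\omega=[0,\omega_1,\dots,\omega_k]$ of points of $\Lambda$, with $\omega_0=0$ and $p(\omega_{j-1},\omega_j)>0$ for $1\le j\le k$, such that $\omega_0,\dots,\omega_{k-1}\in B_l$ and $\omega_k\in\partial B_l$. For $K\supset B_l$ with $\mathbb{P}(\sigma_K<\infty)=1$ let $\widehat S^K$ be the chronological loop-erasure of $[S_0,\dots,S_{\sigma_K}]$, let $\widehat\sigma_l=\min\{j\ge1:\widehat S^K_j\notin B_l\}$, and for $\omega\in\Omega_l$ put $$\mu_{l,K}(\omega)=\mathbb{P}\big(\widehat S^K[0,\widehat\sigma_l]=\omega\big).$$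 Then there is a constant $C\in(0,\infty)$, depending only on the random walk $S$ (hence possibly on $d$), such that the following hold. 1. For every real $n\ge4$, every natural number $l$, all $K_1,K_2\subset\Lambda$ with $B_{nl}\subset K_1\cap K_2$ and $\mathbb{P}(\sigma_{K_1}<\infty)=\mathbb{P}(\sigma_{K_2}<\infty)=1$, and every $\omega\in\Omega_l$, $$\big(1-C\,e(n)\big)\,\mu_{l,K_2}(\omega)\le\mu_{l,K_1}(\omega)\le\big(1+C\,e(n)\big)\,\mu_{l,K_2}(\omega),$$ where $e(n)=1/\log n$ if $d=2$ and $e(n)=n^{2-d}$ if $d\ge3$. 2. For every natural number $l$, all $K_1,K_2\subset\Lambda$ with $B_{4l}\subset K_1\cap K_2$ and $\mathbb{P}(\sigma_{K_1}<\infty)=\mathbb{P}(\sigma_{K_2}<\infty)=1$, and every $\omega\in\Omega_l$, $$C^{-1}\mu_{l,K_2}(\omega)\le\mu_{l,K_1}(\omega)\le C\,\mu_{l,K_2}(\omega).$$ -/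

import Mathlib

open MeasureTheory ProbabilityTheory

/-- A symmetric, irreducible random walk with bounded increments on a discrete lattice of `ℝ^d`,
normalised so that the covariance matrix of its increments is the identity. -/
structure LatticeWalk (d : ℕ) where
  /-- the lattice `Λ ⊂ ℝ^d` -/
  lattice : Submodule ℤ (EuclideanSpace ℝ (Fin d))
  discrete : DiscreteTopology lattice
  isZLattice : IsZLattice ℝ lattice
  /-- the distribution of one increment -/
  p : PMF lattice
  /-- bounded increments: on a discrete lattice this is finiteness of the support -/
  finite_support : p.support.Finite
  symm : ∀ x, p (-x) = p x
  /-- irreducibility: the possible increments generate the lattice -/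
  irreducible : AddSubgroup.closure p.support = ⊤
  /-- the covariance matrix is the identity -/
  covariance : ∀ i j : Fin d,
    ∑' x : lattice, (p x).toReal *
      ((x : EuclideanSpace ℝ (Fin d)) i * (x : EuclideanSpace ℝ (Fin d)) j) =
        if i = j then 1 else 0

/-- Chronological loop-erasure of a finite path: keep the starting point `a`, discard everything up
to and including the last visit to `a`, and loop-erase what remains (`t.rtakeWhile (· ≠ a)` is the
part of `t` after the last occurrence of `a`, and is `t` itself if `a` does not occur in `t`). -/
def loopErase {α : Type*} [DecidableEq α] : List α → List α
  | [] => []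
  | a :: t => a :: loopErase (t.rtakeWhile (fun b => decide (b ≠ a)))
termination_by t => t.length
decreasing_by
  exact Nat.lt_succ_of_le (List.IsSuffix.length_le (List.rtakeWhile_suffix _ _))

/-- The initial segment `[η_0, …, η_k]` of a finite path `η`, where `k = min {j ≥ 1 : η_j ∉ A}`. -/
noncomputable def initialSegment {α : Type*} (A : Set α) (η : List α) : List α :=
  η.take (sInf {j : ℕ | 1 ≤ j ∧ ∃ y, η[j]? = some y ∧ y ∉ A} + 1)

namespace LatticeWalk

variable {d : ℕ} (W : LatticeWalk d)

/-- The law of the sequence `(X_1, X_2, …)` of independent increments with distribution `p`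
(the coordinate with index `i` is `X_{i+1}`). -/
noncomputable def incrementLaw : Measure (ℕ → W.lattice) :=
  Measure.infinitePi (fun _ : ℕ => W.p.toMeasure)

/-- The position `S_n = X_1 + ⋯ + X_n` of the random walk started at the origin. -/
def walk (X : ℕ → W.lattice) (n : ℕ) : W.lattice := ∑ i ∈ Finset.range n, X i

/-- The ball `B_r` in the lattice, for the Euclidean norm. -/
def ball (r : ℝ) : Set W.lattice := {x | ‖(x : EuclideanSpace ℝ (Fin d))‖ < r}

/-- The outer boundary of a set of lattice points. -/
def outerBoundary (K : Set W.lattice) : Set W.lattice :=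
  {x | x ∉ K ∧ ∃ y ∈ K, 0 < W.p (y - x)}

/-- The set `Ω_l` of paths `[0, ω_1, …, ω_k]` with `ω_0, …, ω_{k-1} ∈ B_l` and `ω_k ∈ ∂B_l`. -/
def pathsToBoundary (l : ℕ) : Set (List W.lattice) :=
  {ω | ω.head? = some 0 ∧ ω.IsChain (fun x y => 0 < W.p (y - x)) ∧
    (∀ x ∈ ω.dropLast, x ∈ W.ball l) ∧
    ∃ y, ω.getLast? = some y ∧ y ∈ W.outerBoundary (W.ball l)}

/-- The walk started at the origin leaves `K` almost surely: `P(σ_K < ∞) = 1`. -/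
def ExitsAlmostSurely (K : Set W.lattice) : Prop :=
  ∀ᵐ X ∂W.incrementLaw, ∃ j : ℕ, 1 ≤ j ∧ W.walk X j ∉ K

/-- The first exit time `σ_K = min {j ≥ 1 : S_j ∉ K}` (used for sets with `P(σ_K < ∞) = 1`). -/
noncomputable def exitTime (K : Set W.lattice) (X : ℕ → W.lattice) : ℕ :=
  sInf {j : ℕ | 1 ≤ j ∧ W.walk X j ∉ K}

open Classical in
/-- The loop-erased random walk: the loop-erasure of `[S_0, S_1, …, S_{σ_K}]`. -/
noncomputable def lerw (K : Set W.lattice) (X : ℕ → W.lattice) : List W.lattice :=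
  loopErase ((List.range (W.exitTime K X + 1)).map (W.walk X))

/-- `μ_{l,K}(ω)`: the probability that the loop-erased random walk in `K`, stopped at its first
exit from `B_l`, equals `ω`. -/
noncomputable def lerwLaw (l : ℕ) (K : Set W.lattice) (ω : List W.lattice) : ℝ :=
  W.incrementLaw.real {X | initialSegment (W.ball l) (W.lerw K X) = ω}

end LatticeWalk

/-!
Write `P` for the transition operator of the walk and, for a set `D` and a function `φ ≥ 0`, let
`potential D φ` be the sum over all finite walks killed on leaving `D` of their weights times the
value of `φ` at the end point. It is the smallest nonnegative solution of `v = φ + 1_D P v`, which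
yields the strong Markov property. For a point charge it is the Green's function `G_D`, and for `φ`
supported off `D` it is the expectation of `φ` at the exit point.

Decomposing the walk at the last visits to the points of a self-avoiding path `η ++ [y]` from the
origin shows that the law of the loop-erased walk in `K` at this path is the product of its
transition probabilities, of a product of Green's functions, which is the determinant of `G_K` on
`η`, and of the probability `h_K(y)` that the walk from `y` leaves `K` before visiting `η`
(`lerwLaw_eq_loopErasedSum`, `loopErasedSum_eq`, `det_greenMatrix`). Only the last two factors
depend on `K`; their product is `loopErasedWeight`. Paths that are not self-avoiding have
probability zero.

Let `B ⊆ K` be a ball containing `η`, and let `T(x, y)` be the probability that the walk from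
`x ∈ η` leaves `B`, then returns to `η` before leaving `K`, and does so at `y`. Then
`det (1 - T) det G_K = det G_B` on `η` (`det_returnMatrix_mul`), and the row sums of `1 - T` are the
probabilities `s(x)` of leaving `B` and then escaping from `K`. As functions of `x`, both `T(x, y)`
and `s(x)` are positive and harmonic in `B`.

* For `d = 2` and `B = B_{nl}`, harmonic functions are nearly constant on `B_{3l}`, up to a relative
  error `δ = O(n ^ (-α))` (`exists_oscillation`), so `det (1 - T)` is `s(0) (1 + O(δ))`, and
  `h_K = s(0) (h_B + O(δ))` near the boundary of `B_{2l}`. There `h_B` is at least of order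
  `1 / log n` (`exists_le_escape`). The factor `s(0)` cancels (`exists_weight_close_planar`).
* For `d ≥ 3` and `B = B_{nl}`, the walk returns to `B_l` from outside `B_{nl}` with probability
  `O(n ^ (2 - d))` (`exists_hit_le`); so the row sums of `T` are that small, and with the Harnack
  inequality this bounds the determinant (`exists_weight_close_transient`).
* If only `B_{4l} ⊆ K`, take `B = B_{2l}`: by the Harnack inequality `h_K` is comparable to a constant
  near the boundary of `B`, and `T(x, y)` to a function of `y` alone, and again the constant cancels
  (`exists_weight_comparable`).

For small `l` there are finitely many paths, and what is needed is a positive lower bound not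
depending on `K` (`exists_le_lerwLaw`).

The analytic input is the Harnack inequality for the walk (`exists_harnack`). It follows from bounds
on the Green's functions of balls, obtained by comparison with the fundamental solution of the
Laplace equation at `|x|² ± A`: for large `A` this shift makes it superharmonic everywhere,
respectively subharmonic away from the origin (`exists_barrier`).
-/

/-! ### Potential theory of a kernel -/

section Potential

open scoped ENNReal

variable {α : Type*} (k : α → α → ℝ≥0∞)

/-- One step of the kernel `k`, acting on functions. -/
noncomputable def kernelStep (f : α → ℝ≥0∞) (x : α) : ℝ≥0∞ := ∑' y, k x y * f y

/-- The weight of the path `x :: t`, killed on leaving `D` before its last point, times the value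
of `φ` at its last point. -/
noncomputable def pathWeight (D : Set α) (φ : α → ℝ≥0∞) : α → List α → ℝ≥0∞
  | x, [] => φ x
  | x, y :: t => D.indicator 1 x * (k x y * pathWeight D φ y t)

/-- The potential of the charge `φ` for the kernel killed on leaving `D`: the sum over all paths
from `x`. If `φ` vanishes on `D`, this is the expected value of `φ` at the exit point from `D`;
if `φ` is the indicator of a point of `D`, it is the Green's function of `D`. -/
noncomputable def potential (D : Set α) (φ : α → ℝ≥0∞) (x : α) : ℝ≥0∞ :=
  ∑' t : List α, pathWeight k D φ x t

/-- The charge of a unit point mass at `y`. -/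
noncomputable def pointCharge (y : α) : α → ℝ≥0∞ := ({y} : Set α).indicator 1

/-- The Green's function of the kernel killed on leaving `D`. For `y ∉ D` it is the probability that
the walk leaves `D` at `y`. -/
noncomputable def green (D : Set α) (x y : α) : ℝ≥0∞ := potential k D (pointCharge y) x

@[simp] lemma pointCharge_self (y : α) : pointCharge y y = 1 := by simp [pointCharge]

lemma pointCharge_of_ne {x y : α} (h : x ≠ y) : pointCharge y x = 0 := by simp [pointCharge, h]

lemma ENNReal.tsum_list (f : List α → ℝ≥0∞) :
    ∑' t, f t = f [] + ∑' y, ∑' t, f (y :: t) := by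
  let e : Unit ⊕ (α × List α) ≃ List α :=
    { toFun := fun s => s.elim (fun _ => []) (fun q => q.1 :: q.2)
      invFun := fun t => match t with
        | [] => Sum.inl ()
        | y :: t => Sum.inr (y, t)
      left_inv := by rintro (_ | ⟨y, t⟩) <;> rfl
      right_inv := by rintro (_ | ⟨y, t⟩) <;> rfl }
  rw [← e.tsum_eq f, Summable.tsum_sum (f := fun s => f (e s)) ENNReal.summable ENNReal.summable,
    ← ENNReal.tsum_prod (f := fun y t => f (y :: t))]
  simp [e]

lemma kernelStep_mono {f g : α → ℝ≥0∞} (h : ∀ x, f x ≤ g x) (x : α) :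
    kernelStep k f x ≤ kernelStep k g x :=
  ENNReal.tsum_le_tsum fun y => mul_le_mul_right (h y) _

lemma kernelStep_add (f g : α → ℝ≥0∞) (x : α) :
    kernelStep k (fun y => f y + g y) x = kernelStep k f x + kernelStep k g x := by
  simp only [kernelStep, mul_add, ENNReal.tsum_add]

lemma kernelStep_const_mul (c : ℝ≥0∞) (f : α → ℝ≥0∞) (x : α) :
    kernelStep k (fun y => c * f y) x = c * kernelStep k f x := by
  simp only [kernelStep, ← ENNReal.tsum_mul_left]
  exact tsum_congr fun y => by ring

lemma kernelStep_const (hk : ∀ x, ∑' y, k x y = 1) (c : ℝ≥0∞) (x : α) :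
    kernelStep k (fun _ => c) x = c := by
  simp only [kernelStep, ENNReal.tsum_mul_right, hk, one_mul]

lemma potential_eq (D : Set α) (φ : α → ℝ≥0∞) (x : α) :
    potential k D φ x = φ x + D.indicator (kernelStep k (potential k D φ)) x := by
  rw [potential, ENNReal.tsum_list]
  congr 1
  simp only [pathWeight, ENNReal.tsum_mul_left]
  by_cases hx : x ∈ D <;> simp [hx, kernelStep, potential]

lemma potential_of_notMem {D : Set α} {φ : α → ℝ≥0∞} {x : α} (hx : x ∉ D) :
    potential k D φ x = φ x := by
  rw [potential_eq]; simp [hx]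

lemma potential_of_mem {D : Set α} {φ : α → ℝ≥0∞} {x : α} (hx : x ∈ D) :
    potential k D φ x = φ x + kernelStep k (potential k D φ) x := by
  conv_lhs => rw [potential_eq]
  simp [hx]

lemma le_potential (D : Set α) (φ : α → ℝ≥0∞) (x : α) : φ x ≤ potential k D φ x := by
  rw [potential_eq]; exact le_self_add

open Classical in
/-- The potential is the smallest nonnegative solution of its fixed point equation. -/
lemma potential_le {D : Set α} {φ v : α → ℝ≥0∞}
    (h : ∀ x, φ x + D.indicator (kernelStep k v) x ≤ v x) (x : α) : potential k D φ x ≤ v x := by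
  have key : ∀ n : ℕ, ∀ x, ∑' t : List α, (if t.length < n then pathWeight k D φ x t else 0)
      ≤ v x := by
    intro n
    induction n with
    | zero => intro x; simp
    | succ n ih =>
      intro x
      rw [ENNReal.tsum_list]
      refine le_trans ?_ (h x)
      simp only [List.length_nil, List.length_cons, Nat.succ_pos, if_true, pathWeight]
      gcongr
      by_cases hx : x ∈ D
      · simp only [hx, Set.indicator_of_mem, Pi.one_apply, one_mul, kernelStep]
        refine ENNReal.tsum_le_tsum fun y => ?_
        refine le_trans (le_of_eq ?_) (mul_le_mul_right (ih y) _)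
        rw [← ENNReal.tsum_mul_left]
        refine tsum_congr fun t => ?_
        by_cases ht : t.length < n <;> simp [ht]
      · simp [hx]
  rw [potential, ENNReal.tsum_eq_iSup_sum]
  refine iSup_le fun s => ?_
  refine le_trans ?_ (key (s.sup List.length + 1) x)
  refine le_trans (le_of_eq (Finset.sum_congr rfl fun t ht => ?_)) (ENNReal.sum_le_tsum s)
  rw [if_pos (Nat.lt_succ_of_le (Finset.le_sup (f := List.length) ht))]

/-- Only the values of the charges on a set `N` that the walk does not leave before leaving `D`
matter. -/
lemma potential_mono_of_mem {D N : Set α} {φ ψ : α → ℝ≥0∞}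
    (hN : ∀ y ∈ D, y ∈ N → ∀ z, k y z ≠ 0 → z ∈ N) (h : ∀ y ∈ N, φ y ≤ ψ y) {x : α} (hx : x ∈ N) :
    potential k D φ x ≤ potential k D ψ x := by
  refine ENNReal.tsum_le_tsum fun t => ?_
  induction t generalizing x with
  | nil => exact h x hx
  | cons y t ih =>
    simp only [pathWeight]
    by_cases hxD : x ∈ D
    · by_cases hk : k x y = 0
      · simp [hk]
      · gcongr
        exact ih (hN x hxD hx y hk)
    · simp [hxD]

lemma potential_mono {D : Set α} {φ ψ : α → ℝ≥0∞} (h : ∀ y, φ y ≤ ψ y) (x : α) :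
    potential k D φ x ≤ potential k D ψ x :=
  potential_mono_of_mem k (N := Set.univ) (fun _ _ _ _ _ => trivial) (fun y _ => h y) trivial

lemma potential_mono_set {D D' : Set α} (h : D ⊆ D') (φ : α → ℝ≥0∞) (x : α) :
    potential k D φ x ≤ potential k D' φ x := by
  refine potential_le k (fun y => ?_) x
  rw [potential_eq k D']
  gcongr

lemma pathWeight_add (D : Set α) (φ ψ : α → ℝ≥0∞) (x : α) (t : List α) :
    pathWeight k D (fun y => φ y + ψ y) x t = pathWeight k D φ x t + pathWeight k D ψ x t := by
  induction t generalizing x with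
  | nil => rfl
  | cons y t ih => simp only [pathWeight, ih]; ring

lemma potential_add (D : Set α) (φ ψ : α → ℝ≥0∞) (x : α) :
    potential k D (fun y => φ y + ψ y) x = potential k D φ x + potential k D ψ x := by
  simp only [potential, pathWeight_add, ENNReal.tsum_add]

lemma pathWeight_const_mul (D : Set α) (c : ℝ≥0∞) (φ : α → ℝ≥0∞) (x : α) (t : List α) :
    pathWeight k D (fun y => c * φ y) x t = c * pathWeight k D φ x t := by
  induction t generalizing x with
  | nil => rfl
  | cons y t ih => simp only [pathWeight, ih]; ring

lemma potential_const_mul (D : Set α) (c : ℝ≥0∞) (φ : α → ℝ≥0∞) (x : α) :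
    potential k D (fun y => c * φ y) x = c * potential k D φ x := by
  simp only [potential, pathWeight_const_mul, ENNReal.tsum_mul_left]

lemma pathWeight_tsum {ι : Type*} (D : Set α) (φ : ι → α → ℝ≥0∞) (x : α) (t : List α) :
    pathWeight k D (fun y => ∑' i, φ i y) x t = ∑' i, pathWeight k D (φ i) x t := by
  induction t generalizing x with
  | nil => rfl
  | cons y t ih => simp only [pathWeight, ih, ENNReal.tsum_mul_left]

lemma potential_tsum {ι : Type*} (D : Set α) (φ : ι → α → ℝ≥0∞) (x : α) :
    potential k D (fun y => ∑' i, φ i y) x = ∑' i, potential k D (φ i) x := by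
  simp only [potential, pathWeight_tsum]
  exact ENNReal.tsum_comm

lemma potential_sum {ι : Type*} [Fintype ι] (D : Set α) (φ : ι → α → ℝ≥0∞) (x : α) :
    potential k D (fun y => ∑ i, φ i y) x = ∑ i, potential k D (φ i) x := by
  simp only [← tsum_fintype (L := .unconditional _)]
  exact potential_tsum k D φ x

/-- The strong Markov property at the exit time from a smaller set. -/
lemma potential_markov {D D' : Set α} (h : D' ⊆ D) (φ : α → ℝ≥0∞) (x : α) :
    potential k D φ x =
      potential k D' (fun y => D'.indicator φ y + D'ᶜ.indicator (potential k D φ) y) x := by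
  apply le_antisymm
  · have hle : ∀ y, potential k D' (fun y => D'.indicator φ y + D'ᶜ.indicator (potential k D φ) y) y
        ≤ potential k D φ y := by
      refine potential_le k fun y => ?_
      by_cases hy : y ∈ D'
      · simp only [hy, Set.indicator_of_mem, Set.mem_compl_iff, not_true, not_false_eq_true,
          Set.indicator_of_notMem, add_zero]
        exact (potential_of_mem k (h hy)).ge
      · simp [hy]
    refine potential_le k (fun y => ?_) x
    by_cases hy : y ∈ D'
    · rw [potential_of_mem k hy]
      simp [hy, h hy]
    · rw [potential_of_notMem k hy]
      simp only [hy, not_false_eq_true, Set.indicator_of_notMem, zero_add, Set.mem_compl_iff,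
        Set.indicator_of_mem]
      conv_rhs => rw [potential_eq]
      gcongr
      exact kernelStep_mono k hle y
  · refine potential_le k (fun y => ?_) x
    by_cases hy : y ∈ D'
    · simp only [hy, Set.indicator_of_mem, Set.mem_compl_iff, not_true, not_false_eq_true,
        Set.indicator_of_notMem, add_zero]
      exact (potential_of_mem k (h hy)).ge
    · simp [hy]

/-- The strong Markov property for a charge living outside the smaller set. -/
lemma potential_markov_of_zero {D D' : Set α} (h : D' ⊆ D) {φ : α → ℝ≥0∞} (hφ : ∀ y ∈ D', φ y = 0)
    (x : α) :
    potential k D φ x = potential k D' (D'ᶜ.indicator (potential k D φ)) x := by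
  rw [potential_markov k h]
  congr 1
  funext y
  by_cases hy : y ∈ D' <;> simp [hy, hφ]

lemma potential_eq_add_potential_step (D : Set α) (φ : α → ℝ≥0∞) (x : α) :
    potential k D φ x = φ x + potential k D (D.indicator (kernelStep k φ)) x := by
  apply le_antisymm
  · refine potential_le k (v := fun x => φ x + potential k D (D.indicator (kernelStep k φ)) x)
      (fun y => ?_) x
    gcongr
    by_cases hy : y ∈ D
    · conv_rhs => rw [potential_of_mem k hy]
      simp [hy, kernelStep_add]
    · simp [hy]
  · rw [potential_eq k D φ]
    gcongr
    refine potential_le k (v := D.indicator (kernelStep k (potential k D φ))) (fun y => ?_) x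
    by_cases hy : y ∈ D
    · simp only [hy, Set.indicator_of_mem]
      rw [← kernelStep_add]
      refine kernelStep_mono k (fun z => ?_) y
      exact (potential_eq k D φ z).ge
    · simp [hy]

/-- Every potential is a superposition of Green's functions. -/
lemma potential_eq_tsum_green (D : Set α) (φ : α → ℝ≥0∞) (x : α) :
    potential k D φ x = ∑' w, φ w * green k D x w := by
  have : φ = fun y => ∑' w, φ w * pointCharge w y := by
    funext y
    rw [tsum_eq_single y]
    · simp
    · intro w hw; rw [pointCharge_of_ne hw.symm, mul_zero]
  conv_lhs => rw [this, potential_tsum]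
  simp only [potential_const_mul, green]

lemma kernelStep_pointCharge (x z : α) : kernelStep k (pointCharge x) z = k z x := by
  rw [kernelStep, tsum_eq_single x]
  · simp
  · intro w hw; rw [pointCharge_of_ne hw, mul_zero]

/-- One half of `green_symm`: restricted to `D`, the function `x ↦ G_D(y, x)` solves the equation of
which `x ↦ G_D(x, y)` is the smallest solution. -/
lemma green_le_symm (hk : ∀ x y, k x y = k y x) {D : Set α} {x y : α} (hx : x ∈ D) (hy : y ∈ D) :
    green k D x y ≤ green k D y x := by
  have := potential_le k (D := D) (φ := pointCharge y)
    (v := D.indicator (fun x => green k D y x)) (fun z => ?_) x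
  · simpa [hx, green] using this
  by_cases hz : z ∈ D
  · simp only [hz, Set.indicator_of_mem]
    conv_rhs => rw [green, potential_eq_add_potential_step, potential_eq_tsum_green]
    refine add_le_add (le_of_eq ?_) (le_of_eq (tsum_congr fun w => ?_))
    · by_cases h : z = y
      · subst h; rfl
      · rw [pointCharge_of_ne h, pointCharge_of_ne (Ne.symm h)]
    · by_cases hw : w ∈ D
      · simp [hw, kernelStep_pointCharge, hk z w]
      · simp [hw]
  · have : z ≠ y := fun h => hz (h ▸ hy)
    simp [hz, pointCharge_of_ne this]

lemma green_symm (hk : ∀ x y, k x y = k y x) {D : Set α} {x y : α} (hx : x ∈ D) (hy : y ∈ D) :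
    green k D x y = green k D y x :=
  le_antisymm (green_le_symm k hk hx hy) (green_le_symm k hk hy hx)

lemma green_of_notMem {D : Set α} {x y : α} (hx : x ∉ D) (hy : y ∈ D) : green k D x y = 0 := by
  rw [green, potential_of_notMem k hx, pointCharge_of_ne]
  rintro rfl; exact hx hy

lemma one_le_green (D : Set α) (x : α) : 1 ≤ green k D x x := by
  simpa [green] using le_potential k D (pointCharge x) x

lemma potential_le_const (hk : ∀ x, ∑' y, k x y = 1) {D : Set α} {φ : α → ℝ≥0∞} {c : ℝ≥0∞}
    (h0 : ∀ x ∈ D, φ x = 0) (h : ∀ x, φ x ≤ c) (x : α) : potential k D φ x ≤ c := by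
  refine potential_le k (v := fun _ => c) (fun y => ?_) x
  by_cases hy : y ∈ D
  · simp [hy, h0, kernelStep_const k hk]
  · simpa [hy] using h y

/-- The Green's function with its pole removed from the domain. -/
lemma green_eq_add {D : Set α} {a y : α} (ha : a ∈ D) (hya : y ≠ a) (x : α) :
    green k D x y = green k (D \ {a}) x y + green k (D \ {a}) x a * green k D a y := by
  have h := potential_markov k (D := D) (D' := D \ {a}) Set.sdiff_subset (pointCharge y) x
  rw [green, h]
  have : (fun z => (D \ {a}).indicator (pointCharge y) z +
      (D \ {a})ᶜ.indicator (potential k D (pointCharge y)) z) =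
      fun z => pointCharge y z + green k D a y * pointCharge a z := by
    funext z
    by_cases hz : z ∈ D \ {a}
    · have hza : z ≠ a := fun h => hz.2 h
      simp [hz, pointCharge_of_ne hza]
    · rw [Set.indicator_of_notMem hz, Set.indicator_of_mem (by exact hz), zero_add]
      by_cases hza : z = a
      · subst hza; simp [pointCharge_of_ne hya.symm, green]
      · have hzD : z ∉ D := fun h => hz ⟨h, hza⟩
        rw [pointCharge_of_ne hza, mul_zero, add_zero, potential_of_notMem k hzD]
  rw [this, potential_add, potential_const_mul, mul_comm]
  rfl

/-- The Green's function is the hitting probability of the pole times its value at the pole. -/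
lemma green_eq_hit_mul {D : Set α} {a : α} (ha : a ∈ D) (x : α) :
    green k D x a = green k (D \ {a}) x a * green k D a a := by
  have h := potential_markov_of_zero k (D := D) (D' := D \ {a}) Set.sdiff_subset
    (φ := pointCharge a) (fun y hy => pointCharge_of_ne hy.2) x
  rw [green, h]
  have : (D \ {a})ᶜ.indicator (potential k D (pointCharge a)) =
      fun z => green k D a a * pointCharge a z := by
    funext z
    by_cases hza : z = a
    · subst hza; simp [green]
    · by_cases hz : z ∈ D
      · simp [hz, hza, pointCharge_of_ne hza]
      · have : z ∈ (D \ {a})ᶜ := fun h => hz h.1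
        rw [Set.indicator_of_mem this, potential_of_notMem k hz, pointCharge_of_ne hza, mul_zero]
  rw [this, potential_const_mul, mul_comm]
  rfl

/-- If `a ∉ D`, then `green k D x a` is a hitting probability. -/
lemma green_hit_le_one (hk : ∀ x, ∑' y, k x y = 1) (D : Set α) (x : α) {a : α} (ha : a ∉ D) :
    green k D x a ≤ 1 := by
  refine potential_le_const k hk (fun y hy => pointCharge_of_ne ?_) (fun y => ?_) x
  · rintro rfl; exact ha hy
  by_cases h : y = a
  · subst h; simp
  · simp [pointCharge_of_ne h]

lemma green_le_green_self (hk : ∀ x, ∑' y, k x y = 1) {D : Set α} (x : α) {a : α} (ha : a ∈ D) :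
    green k D x a ≤ green k D a a := by
  rw [green_eq_hit_mul k ha]
  exact mul_le_of_le_one_left zero_le (green_hit_le_one k hk _ _ (by simp))

end Potential

/-! ### Path sums of loop-erased walks -/

section LoopErasure

open scoped ENNReal

variable {α : Type*}

lemma mem_of_mem_loopErase [DecidableEq α] {l : List α} {x : α} (h : x ∈ loopErase l) : x ∈ l := by
  induction hn : l.length using Nat.strong_induction_on generalizing l with
  | _ n ih =>
    cases l with
    | nil => simp [loopErase] at h
    | cons a t =>
      have hs := List.rtakeWhile_suffix (fun b => decide (b ≠ a)) t
      rw [loopErase, List.mem_cons] at h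
      rcases h with h | h
      · simp [h]
      · refine List.mem_cons_of_mem _ (hs.subset (ih _ ?_ h rfl))
        subst hn
        exact Nat.lt_succ_of_le hs.length_le

lemma nodup_loopErase [DecidableEq α] (l : List α) : (loopErase l).Nodup := by
  induction hn : l.length using Nat.strong_induction_on generalizing l with
  | _ n ih =>
    cases l with
    | nil => simp [loopErase]
    | cons a t =>
      have hs := List.rtakeWhile_suffix (fun b => decide (b ≠ a)) t
      rw [loopErase, List.nodup_cons]
      refine ⟨fun h => ?_, ih _ ?_ _ rfl⟩
      · have := List.mem_rtakeWhile_imp (mem_of_mem_loopErase h)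
        simp at this
      · subst hn
        exact Nat.lt_succ_of_le hs.length_le

lemma cons_prefix_loopErase_cons [DecidableEq α] (a : α) (ω t : List α) :
    (a :: ω) <+: loopErase (a :: t) ↔
      ω <+: loopErase (t.rtakeWhile (fun b => decide (b ≠ a))) := by
  rw [loopErase, List.cons_prefix_cons]
  exact and_iff_right rfl

variable (k : α → α → ℝ≥0∞)

/-- The product of the transition weights along the path `a :: t`. -/
noncomputable def pathProb : α → List α → ℝ≥0∞
  | _, [] => 1
  | a, b :: t => k a b * pathProb b t

/-- The product of the Green's functions `G_{D \ {η_0, …, η_{j-1}}}(η_j, η_j)` along `η`. -/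
noncomputable def greenProd : Set α → List α → ℝ≥0∞
  | _, [] => 1
  | D, a :: η => green k D a a * greenProd (D \ {a}) η

/-- The total weight of the walks from `x`, killed on leaving `D` and charged with `φ` at the end,
whose loop-erasure starts with `ω`. -/
noncomputable def loopErasedSum [DecidableEq α] (D : Set α) (φ : α → ℝ≥0∞) (ω : List α) (x : α) :
    ℝ≥0∞ :=
  ∑' t : List α, if ω <+: loopErase (x :: t) then pathWeight k D φ x t else 0

lemma rtakeWhile_append_of_getLast [DecidableEq α] {a : α} {t₁ t₂ : List α}
    (h₁ : (a :: t₁).getLast (by simp) = a) (h₂ : a ∉ t₂) :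
    (t₁ ++ t₂).rtakeWhile (fun b => decide (b ≠ a)) = t₂ := by
  rw [List.rtakeWhile, List.reverse_append, List.takeWhile_append_of_pos]
  · have : t₁.reverse.takeWhile (fun b => decide (b ≠ a)) = [] := by
      induction t₁ using List.reverseRecOn with
      | nil => rfl
      | append_singleton t c _ =>
        have : c = a := by
          rw [← h₁]; simp
        simp [this]
    rw [this, List.append_nil, List.reverse_reverse]
  · intro b hb
    have : b ∈ t₂ := by simpa using hb
    simp only [ne_eq, decide_eq_true_eq]
    rintro rfl; exact h₂ this

lemma pathWeight_append (D : Set α) (φ : α → ℝ≥0∞) (x a : α) (t₁ t₂ : List α)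
    (h : (x :: t₁).getLast (by simp) = a) :
    pathWeight k D φ x (t₁ ++ t₂) = pathWeight k D (pointCharge a) x t₁ * pathWeight k D φ a t₂ := by
  induction t₁ generalizing x with
  | nil =>
    have : x = a := by simpa using h
    subst this; simp [pathWeight]
  | cons y t ih =>
    simp only [List.cons_append, pathWeight]
    rw [ih y (by simpa using h)]; ring

lemma pathWeight_pointCharge_eq_zero (D : Set α) (x a : α) (t : List α)
    (h : (x :: t).getLast (by simp) ≠ a) : pathWeight k D (pointCharge a) x t = 0 := by
  induction t generalizing x with
  | nil => exact pointCharge_of_ne (by simpa using h)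
  | cons y t ih =>
    simp only [pathWeight]
    rw [ih y (by simpa using h)]; simp

lemma pathWeight_diff_of_notMem (D : Set α) (φ : α → ℝ≥0∞) {a x : α} {t : List α}
    (h : a ∉ x :: t) : pathWeight k (D \ {a}) φ x t = pathWeight k D φ x t := by
  induction t generalizing x with
  | nil => rfl
  | cons y t ih =>
    have hx : x ≠ a := by rintro rfl; simp at h
    simp only [pathWeight]
    rw [ih (fun h' => h (List.mem_cons_of_mem _ h'))]
    by_cases hxD : x ∈ D <;> simp [hxD, hx]

lemma pathWeight_eq_zero_of_mem {D : Set α} {φ : α → ℝ≥0∞} {a x : α} {t : List α} (hD : a ∉ D)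
    (hφ : φ a = 0) (h : a ∈ x :: t) : pathWeight k D φ x t = 0 := by
  induction t generalizing x with
  | nil =>
    have : a = x := by simpa using h
    subst this; exact hφ
  | cons y t ih =>
    simp only [pathWeight]
    rcases List.mem_cons.1 h with rfl | h
    · simp [hD]
    · simp [ih h]

lemma loopErasedSum_singleton [DecidableEq α] (D : Set α) (φ : α → ℝ≥0∞) (x : α) :
    loopErasedSum k D φ [x] x = potential k D φ x := by
  refine tsum_congr fun t => if_pos ?_
  rw [loopErase]
  simp

/-- The decomposition of a walk at its last visit to its starting point: the part before it
contributes the Green's function, and the part after it avoids the starting point, so that its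
loop-erasure is the rest of the loop-erasure of the walk. -/
lemma loopErasedSum_cons [DecidableEq α] {D : Set α} {φ : α → ℝ≥0∞} {a : α} (ha : a ∈ D)
    (hφ : φ a = 0) (b : α) (ω : List α) :
    loopErasedSum k D φ (a :: b :: ω) a =
      green k D a a * (k a b * loopErasedSum k (D \ {a}) φ (b :: ω) b) := by
  -- the weight of the part `t` of the walk after the last visit to `a`
  let H : List α → ℝ≥0∞ := fun t =>
    if a ∉ t ∧ (b :: ω) <+: loopErase t then pathWeight k D φ a t else 0
  have h1 : loopErasedSum k D φ (a :: b :: ω) a =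
      ∑' q : List α × List α, pathWeight k D (pointCharge a) a q.1 * H q.2 := by
    have hprop : ∀ q : Function.support (fun q : List α × List α =>
        pathWeight k D (pointCharge a) a q.1 * H q.2),
        (a :: q.1.1).getLast (by simp) = a ∧ a ∉ q.1.2 ∧ (b :: ω) <+: loopErase q.1.2 := by
      rintro ⟨⟨t₁, t₂⟩, hq⟩
      rw [Function.mem_support] at hq
      refine ⟨?_, ?_⟩
      · by_contra h
        exact hq (by simp [pathWeight_pointCharge_eq_zero k D a a t₁ h])
      · by_contra h
        exact hq (by simp [H, h])
    refine tsum_eq_tsum_of_ne_zero_bij (fun q => q.1.1 ++ q.1.2) ?_ ?_ ?_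
    · rintro ⟨⟨t₁, t₂⟩, hq⟩ ⟨⟨s₁, s₂⟩, hs⟩ h
      obtain ⟨h1, h2, -⟩ := hprop ⟨_, hq⟩
      obtain ⟨h3, h4, -⟩ := hprop ⟨_, hs⟩
      simp only at h h1 h2 h3 h4
      have e2 : t₂ = s₂ := by
        rw [← rtakeWhile_append_of_getLast h1 h2, h, rtakeWhile_append_of_getLast h3 h4]
      subst e2
      have e1 := List.append_cancel_right h
      subst e1; rfl
    · intro t ht
      set p : α → Bool := fun b => decide (b ≠ a)
      have hdec : t.rdropWhile p ++ t.rtakeWhile p = t := List.rdropWhile_append_rtakeWhile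
      have hlast : (a :: t.rdropWhile p).getLast (by simp) = a := by
        by_cases hnil : t.rdropWhile p = []
        · simp [hnil]
        · rw [List.getLast_cons hnil]
          have := List.rdropWhile_last_not p t hnil
          simpa [p] using this
      have hnot : a ∉ t.rtakeWhile p := fun h => by
        have := List.mem_rtakeWhile_imp h
        simp [p] at this
      have hcond : (b :: ω) <+: loopErase (t.rtakeWhile p) := by
        by_contra h
        exact ht (if_neg fun h' => h ((cons_prefix_loopErase_cons a (b :: ω) t).1 h'))
      rw [Function.mem_support, if_pos ((cons_prefix_loopErase_cons a (b :: ω) t).2 hcond)] at ht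
      refine ⟨⟨(t.rdropWhile p, t.rtakeWhile p), ?_⟩, hdec⟩
      rw [Function.mem_support]
      simp only [H]
      rw [if_pos ⟨hnot, hcond⟩, ← pathWeight_append k D φ a a _ _ hlast, hdec]
      exact ht
    · intro q
      obtain ⟨h1, h2, h3⟩ := hprop q
      have hpre : (a :: b :: ω) <+: loopErase (a :: (q.1.1 ++ q.1.2)) := by
        rwa [cons_prefix_loopErase_cons, rtakeWhile_append_of_getLast h1 h2]
      rw [if_pos hpre, pathWeight_append k D φ a a _ _ h1]
      simp only [H]
      rw [if_pos ⟨h2, h3⟩]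
  have h2 : ∑' t, H t = k a b * loopErasedSum k (D \ {a}) φ (b :: ω) b := by
    rw [ENNReal.tsum_list, tsum_eq_single b]
    · have : H [] = 0 := by simp [H, pathWeight, hφ]
      rw [this, zero_add, loopErasedSum, ← ENNReal.tsum_mul_left]
      refine tsum_congr fun t => ?_
      by_cases h : (b :: ω) <+: loopErase (b :: t)
      · rw [if_pos h]
        by_cases hat : a ∈ b :: t
        · rw [pathWeight_eq_zero_of_mem k (by simp) hφ hat]
          simp only [H]; rw [if_neg (fun h' => h'.1 hat)]; simp
        · simp only [H]; rw [if_pos ⟨hat, h⟩, pathWeight_diff_of_notMem k D φ hat]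
          simp [pathWeight, ha]
      · simp [H, h]
    · intro c hc
      refine ENNReal.tsum_eq_zero.2 fun t => if_neg fun h => hc ?_
      have := h.2
      rw [loopErase, List.cons_prefix_cons] at this
      exact this.1.symm
  rw [h1, ENNReal.tsum_prod (f := fun x y => pathWeight k D (pointCharge a) a x * H y)]
  simp only [ENNReal.tsum_mul_left, ENNReal.tsum_mul_right, h2]
  rfl

/-- The weight of the walks whose loop-erasure starts with a given self-avoiding path: the weight of
the path, times the Green's functions describing the erased loops, times the probability to escape
from the end of the path without returning to it. -/
lemma loopErasedSum_eq [DecidableEq α] {D : Set α} {φ : α → ℝ≥0∞} (hφ : ∀ x ∈ D, φ x = 0) (a y : α)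
    (η : List α) (hη : (a :: η).Nodup) (hD : ∀ x ∈ a :: η, x ∈ D) :
    loopErasedSum k D φ ((a :: η) ++ [y]) a =
      pathProb k a (η ++ [y]) * greenProd k D (a :: η) *
        potential k (D \ {x | x ∈ a :: η}) φ y := by
  induction η generalizing a D with
  | nil =>
    have ha : a ∈ D := hD a (by simp)
    rw [List.singleton_append, loopErasedSum_cons k ha (hφ a ha), loopErasedSum_singleton]
    have : {x : α | x ∈ [a]} = {a} := by ext; simp
    simp only [List.nil_append, pathProb, greenProd, this]; ring
  | cons b η ih =>
    have ha : a ∈ D := hD a (by simp)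
    have hnd := List.nodup_cons.1 hη
    rw [List.cons_append, List.cons_append, loopErasedSum_cons k ha (hφ a ha), ← List.cons_append,
      ih (D := D \ {a}) (fun x hx => hφ x hx.1) b hnd.2
        (fun x hx => ⟨hD x (List.mem_cons_of_mem _ hx), by rintro rfl; exact hnd.1 hx⟩)]
    have : (D \ {a}) \ {x | x ∈ b :: η} = D \ {x | x ∈ a :: b :: η} := by
      ext x; simp; tauto
    rw [this]
    simp only [List.cons_append, pathProb, greenProd]; ring

end LoopErasure

/-! ### The law of the loop-erased walk as a path sum -/

section PathLaw

open scoped ENNReal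

namespace LatticeWalk

variable {d : ℕ} (W : LatticeWalk d)

/-- The transition probabilities `p(x, y)` of the walk. -/
noncomputable def kernel (x y : W.lattice) : ℝ≥0∞ := W.p (y - x)

lemma kernel_symm (x y : W.lattice) : W.kernel x y = W.kernel y x := by
  rw [kernel, kernel, ← W.symm, neg_sub]

lemma tsum_kernel (x : W.lattice) : ∑' y, W.kernel x y = 1 := by
  rw [← W.p.tsum_coe, ← (Equiv.subRight x).tsum_eq W.p]
  rfl

lemma countable_lattice : Countable W.lattice := by
  have := W.discrete
  have := W.isZLattice
  infer_instance

lemma prod_range_kernel (x : W.lattice) (t : List W.lattice) :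
    ∏ i ∈ Finset.range t.length, W.kernel ((x :: t).getD i 0) ((x :: t).getD (i + 1) 0) =
      pathProb W.kernel x t := by
  induction t generalizing x with
  | nil => simp [pathProb]
  | cons y t ih =>
    rw [List.length_cons, Finset.prod_range_succ', pathProb, ← ih y, mul_comm]
    rfl

/-- The event that the walk follows the path `0 :: t`. -/
def followEvent (t : List W.lattice) : Set (ℕ → W.lattice) :=
  {X | ∀ i ≤ t.length, W.walk X i = (0 :: t).getD i 0}

lemma followEvent_eq (t : List W.lattice) :
    W.followEvent t = Set.pi (Finset.range t.length : Set ℕ)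
      (fun i => {(0 :: t).getD (i + 1) 0 - (0 :: t).getD i 0}) := by
  ext X
  simp only [followEvent, Set.mem_ofPred_eq, Set.mem_pi, Finset.coe_range, Set.mem_Iio,
    Set.mem_singleton_iff]
  constructor
  · intro h i hi
    rw [← h i hi.le, ← h (i + 1) hi, walk, walk, Finset.sum_range_succ, add_sub_cancel_left]
  · intro h i hi
    induction i with
    | zero => simp [walk]
    | succ i ih =>
      have h1 := ih (by omega)
      rw [walk] at h1 ⊢
      rw [Finset.sum_range_succ, h1, h i (by omega)]
      abel

lemma measurableSet_followEvent (t : List W.lattice) : MeasurableSet (W.followEvent t) := by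
  rw [followEvent_eq]
  exact MeasurableSet.pi (Finset.countable_toSet _) fun i _ => measurableSet_singleton _

lemma incrementLaw_followEvent (t : List W.lattice) :
    W.incrementLaw (W.followEvent t) = pathProb W.kernel 0 t := by
  rw [followEvent_eq, incrementLaw, Measure.infinitePi_pi]
  · rw [← prod_range_kernel]
    refine Finset.prod_congr rfl fun i _ => ?_
    rw [PMF.toMeasure_apply_singleton _ _ (measurableSet_singleton _)]
    rfl
  · exact fun i _ => measurableSet_singleton _

open Classical in
lemma pathWeight_exit (K : Set W.lattice) (x : W.lattice) (t : List W.lattice) :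
    pathWeight W.kernel K (Kᶜ.indicator 1) x t =
      if (∀ i < t.length, (x :: t).getD i 0 ∈ K) ∧ (x :: t).getD t.length 0 ∉ K then
        pathProb W.kernel x t else 0 := by
  induction t generalizing x with
  | nil => simp [pathWeight, pathProb, Set.indicator]
  | cons y t ih =>
    rw [pathWeight, ih y, pathProb]
    have : ((∀ i < (y :: t).length, (x :: y :: t).getD i 0 ∈ K) ∧
        (x :: y :: t).getD (y :: t).length 0 ∉ K) ↔
        x ∈ K ∧ ((∀ i < t.length, (y :: t).getD i 0 ∈ K) ∧ (y :: t).getD t.length 0 ∉ K) := by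
      rw [← and_assoc]
      refine and_congr ⟨fun h => ⟨h 0 (by simp), fun i hi => h (i + 1) (by simpa using hi)⟩, ?_⟩
        Iff.rfl
      rintro ⟨h0, h⟩ (_ | i) hi
      · exact h0
      · exact h i (by simpa using hi)
    simp only [this]
    by_cases hx : x ∈ K
    · simp only [hx, Set.indicator_of_mem, Pi.one_apply, one_mul, true_and, mul_ite, mul_zero]
    · simp [hx]

lemma exitTime_eq_of_follow {K : Set W.lattice} (h0 : (0 : W.lattice) ∈ K) {t : List W.lattice}
    (h1 : ∀ i < t.length, ((0 : W.lattice) :: t).getD i 0 ∈ K)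
    (h2 : ((0 : W.lattice) :: t).getD t.length 0 ∉ K)
    {X : ℕ → W.lattice} (hX : X ∈ W.followEvent t) :
    1 ≤ t.length ∧ W.walk X t.length ∉ K ∧ W.exitTime K X = t.length := by
  have hlen : 1 ≤ t.length := by
    rcases t with _ | ⟨y, t⟩
    · exact absurd h0 h2
    · simp
  have hlast : W.walk X t.length ∉ K := by rw [hX _ le_rfl]; exact h2
  refine ⟨hlen, hlast, IsLeast.csInf_eq ⟨⟨hlen, hlast⟩, fun j hj => ?_⟩⟩
  by_contra hlt
  push Not at hlt
  exact hj.2 (by rw [hX j hlt.le]; exact h1 j hlt)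

lemma map_walk_eq_of_follow {t : List W.lattice} {X : ℕ → W.lattice}
    (hX : X ∈ W.followEvent t) :
    (List.range (t.length + 1)).map (W.walk X) = 0 :: t := by
  refine List.ext_getElem (by simp) fun i hi hi' => ?_
  have := hX i (by simpa [Nat.lt_succ_iff] using hi)
  rw [List.getElem_map, List.getElem_range, this, List.getD_eq_getElem _ _ hi']

open Classical in
/-- The probability that the path of the walk up to its exit from `K` has a given property. -/
lemma incrementLaw_exitPath (K : Set W.lattice) (h0 : (0 : W.lattice) ∈ K)
    (Q : List W.lattice → Prop) :
    W.incrementLaw {X | (∃ j : ℕ, 1 ≤ j ∧ W.walk X j ∉ K) ∧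
        Q ((List.range (W.exitTime K X + 1)).map (W.walk X))} =
      ∑' t : List W.lattice,
        if Q (0 :: t) then pathWeight W.kernel K (Kᶜ.indicator 1) 0 t else 0 := by
  have := W.countable_lattice
  -- the event is the disjoint union of the events `A t` that the path up to the exit is `0 :: t`
  let A : List W.lattice → Set (ℕ → W.lattice) := fun t =>
    {X | X ∈ W.followEvent t ∧ Q (0 :: t) ∧ (∀ i < t.length, ((0 : W.lattice) :: t).getD i 0 ∈ K) ∧
      ((0 : W.lattice) :: t).getD t.length 0 ∉ K}
  have hU : {X | (∃ j : ℕ, 1 ≤ j ∧ W.walk X j ∉ K) ∧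
        Q ((List.range (W.exitTime K X + 1)).map (W.walk X))} = ⋃ t, A t := by
    ext X
    simp only [Set.mem_ofPred_eq, Set.mem_iUnion, A]
    constructor
    · rintro ⟨hex, hQ⟩
      have hmem : W.exitTime K X ∈ {j : ℕ | 1 ≤ j ∧ W.walk X j ∉ K} := Nat.sInf_mem hex
      set m := W.exitTime K X with hm
      set t := (List.range m).map (fun i => W.walk X (i + 1)) with ht
      have hlen : t.length = m := by simp [t]
      have hget : ∀ i ≤ m, W.walk X i = ((0 : W.lattice) :: t).getD i 0 := by
        rintro (_ | i) hi
        · simp [walk]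
        · have : i < t.length := by omega
          rw [List.getD_cons_succ, List.getD_eq_getElem _ _ this]
          simp [t]
      have hf : X ∈ W.followEvent t := fun i hi => hget i (hlen ▸ hi)
      have hmap := W.map_walk_eq_of_follow hf
      rw [hlen] at hmap
      refine ⟨t, hf, by rwa [← hmap], fun i hi => ?_, ?_⟩
      · rw [← hget i (by omega)]
        rcases Nat.eq_zero_or_pos i with rfl | hpos
        · simpa [walk] using h0
        · by_contra hni
          have := Nat.sInf_le (s := {j : ℕ | 1 ≤ j ∧ W.walk X j ∉ K}) ⟨hpos, hni⟩
          have : m ≤ i := this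
          omega
      · rw [hlen, ← hget m le_rfl]
        exact hmem.2
    · rintro ⟨t, hf, hQ, h1, h2⟩
      obtain ⟨h3, h4, h5⟩ := W.exitTime_eq_of_follow h0 h1 h2 hf
      refine ⟨⟨_, h3, h4⟩, ?_⟩
      rw [h5, W.map_walk_eq_of_follow hf]
      exact hQ
  have hdisj : Pairwise (Function.onFun Disjoint A) := by
    intro t s hts
    rw [Function.onFun, Set.disjoint_left]
    rintro X ⟨hf, -, h1, h2⟩ ⟨hf', -, h1', h2'⟩
    apply hts
    have e := (W.exitTime_eq_of_follow h0 h1 h2 hf).2.2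
    have e' := (W.exitTime_eq_of_follow h0 h1' h2' hf').2.2
    have hm := W.map_walk_eq_of_follow hf
    rw [← e, e', W.map_walk_eq_of_follow hf'] at hm
    exact ((List.cons.injEq _ _ _ _).mp hm).2.symm
  have hAeq : ∀ t, A t = if Q (0 :: t) ∧ (∀ i < t.length, ((0 : W.lattice) :: t).getD i 0 ∈ K) ∧
      ((0 : W.lattice) :: t).getD t.length 0 ∉ K then W.followEvent t else ∅ := by
    intro t
    split_ifs with h
    · ext X; exact ⟨fun hX => hX.1, fun hX => ⟨hX, h⟩⟩
    · ext X; exact ⟨fun hX => absurd hX.2 h, fun hX => hX.elim⟩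
  rw [hU, measure_iUnion hdisj]
  · refine tsum_congr fun t => ?_
    rw [hAeq, pathWeight_exit]
    by_cases hQ : Q (0 :: t)
    · simp only [hQ, true_and, if_true]
      split_ifs
      · exact W.incrementLaw_followEvent t
      · simp
    · simp [hQ]
  · intro t
    rw [hAeq]
    split_ifs
    · exact W.measurableSet_followEvent t
    · exact MeasurableSet.empty

instance : IsProbabilityMeasure W.incrementLaw := by
  unfold incrementLaw; infer_instance

/-- Almost sure exit from `K`, in terms of exit probabilities. -/
lemma exit_probability_eq_one {K : Set W.lattice} (h0 : (0 : W.lattice) ∈ K)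
    (hK : W.ExitsAlmostSurely K) : potential W.kernel K (Kᶜ.indicator 1) 0 = 1 := by
  have h := W.incrementLaw_exitPath K h0 (fun _ => True)
  simp only [and_true, if_true] at h
  rw [potential, ← h]
  rw [← measure_univ (μ := W.incrementLaw)]
  refine measure_congr ?_
  filter_upwards [hK] with X hX
  exact propext (iff_of_true hX trivial)

/-- A path that leaves `A` exactly at its last point is the initial segment of `η` up to the first
exit from `A` if and only if it is a prefix of `η`. -/
lemma initialSegment_eq_iff {α : Type*} {A : Set α} {ω η : List α} (hlen : 2 ≤ ω.length)
    (hin : ∀ x ∈ ω.dropLast, x ∈ A) (hout : ∃ y, ω.getLast? = some y ∧ y ∉ A) :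
    initialSegment A η = ω ↔ ω <+: η := by
  constructor
  · rintro rfl
    exact List.take_prefix _ _
  · intro h
    obtain ⟨y, hy, hyA⟩ := hout
    have hk : sInf {j : ℕ | 1 ≤ j ∧ ∃ y, η[j]? = some y ∧ y ∉ A} = ω.length - 1 := by
      refine IsLeast.csInf_eq ⟨⟨by omega, y, ?_, hyA⟩, ?_⟩
      · rw [← hy, List.getLast?_eq_getElem?]
        obtain ⟨s, rfl⟩ := h
        rw [List.getElem?_append_left (by omega)]
      · rintro j ⟨-, z, hz, hzA⟩
        by_contra hj
        push Not at hj
        apply hzA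
        apply hin
        obtain ⟨s, rfl⟩ := h
        rw [List.getElem?_append_left (by omega)] at hz
        obtain ⟨hlt, rfl⟩ := List.getElem?_eq_some_iff.1 hz
        rw [← List.getElem_dropLast (i := j) (by simpa using hj)]
        exact List.getElem_mem _
    rw [initialSegment, hk, Nat.sub_add_cancel (by omega)]
    exact (List.prefix_iff_eq_take.1 h).symm

/-- The law of the initial segment of the loop-erased walk as a path sum. -/
lemma lerwLaw_eq_loopErasedSum [DecidableEq W.lattice] {l : ℕ} {K : Set W.lattice}
    (h0 : (0 : W.lattice) ∈ K) (hK : W.ExitsAlmostSurely K) {ω : List W.lattice}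
    (hlen : 2 ≤ ω.length) (hin : ∀ x ∈ ω.dropLast, x ∈ W.ball l)
    (hout : ∃ y, ω.getLast? = some y ∧ y ∉ W.ball l) :
    W.lerwLaw l K ω = (loopErasedSum W.kernel K (Kᶜ.indicator 1) ω 0).toReal := by
  have h := W.incrementLaw_exitPath K h0
    (fun γ => ω <+: loopErase γ)
  have hlerw : ∀ X, W.lerw K X =
      loopErase ((List.range (W.exitTime K X + 1)).map (W.walk X)) := fun X => by
    unfold lerw; congr!
  rw [lerwLaw, Measure.real]
  congr 1
  trans W.incrementLaw {X | (∃ j : ℕ, 1 ≤ j ∧ W.walk X j ∉ K) ∧ ω <+: W.lerw K X}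
  · apply measure_congr
    filter_upwards [hK] with X hX
    apply propext
    change initialSegment (W.ball l) (W.lerw K X) = ω ↔ _ ∧ _
    rw [initialSegment_eq_iff hlen hin hout]
    exact (and_iff_right hX).symm
  · simp only [hlerw]
    refine h.trans ?_
    rw [loopErasedSum]
    refine tsum_congr fun t => ?_
    congr!

end LatticeWalk

end PathLaw

/-! ### Determinants of perturbations of the identity -/

section Determinants

variable {n : ℕ}

/-- The minimum principle for a matrix with row sums less than one. -/
lemma nonneg_of_eq_add_sum {E : Matrix (Fin n) (Fin n) ℝ} {θ : ℝ} (hθ : θ < 1)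
    (hE : ∀ i j, 0 ≤ E i j) (hrow : ∀ i, ∑ j, E i j ≤ θ) {g c : Fin n → ℝ}
    (hg : ∀ i, g i = c i + ∑ j, E i j * g j) (hc : ∀ i, 0 ≤ c i) (i : Fin n) : 0 ≤ g i := by
  obtain ⟨m, -, hm⟩ := Finset.exists_min_image Finset.univ g ⟨i, Finset.mem_univ i⟩
  refine le_trans ?_ (hm i (Finset.mem_univ i))
  by_contra hneg
  push Not at hneg
  have h1 : ∑ j, E m j * g m ≤ ∑ j, E m j * g j :=
    Finset.sum_le_sum fun j hj => mul_le_mul_of_nonneg_left (hm j hj) (hE m j)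
  rw [← Finset.sum_mul] at h1
  have h2 := hg m
  have h3 := hc m
  nlinarith [hrow m]

lemma le_div_of_eq_add_sum {E : Matrix (Fin n) (Fin n) ℝ} {θ m : ℝ} (hθ : θ < 1)
    (hm : 0 ≤ m) (hE : ∀ i j, 0 ≤ E i j) (hrow : ∀ i, ∑ j, E i j ≤ θ) {g c : Fin n → ℝ}
    (hg : ∀ i, g i = c i + ∑ j, E i j * g j) (hc : ∀ i, c i ≤ m) (i : Fin n) :
    g i ≤ m / (1 - θ) := by
  have hpos : 0 < 1 - θ := by linarith
  have := nonneg_of_eq_add_sum (g := fun i => m / (1 - θ) - g i)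
    (c := fun i => m / (1 - θ) - c i - (∑ j, E i j) * (m / (1 - θ))) hθ hE hrow (fun i => ?_)
    (fun i => ?_) i
  · linarith
  · simp only [mul_sub, Finset.sum_sub_distrib, ← Finset.sum_mul]
    rw [hg i]; ring
  · have h0 : 0 ≤ m / (1 - θ) := div_nonneg hm hpos.le
    have h1 : (∑ j, E i j) * (m / (1 - θ)) ≤ θ * (m / (1 - θ)) :=
      mul_le_mul_of_nonneg_right (hrow i) h0
    have h2 : (1 - θ) * (m / (1 - θ)) = m := by field_simp
    linarith [hc i]

lemma det_one_sub_ne_zero {E : Matrix (Fin n) (Fin n) ℝ} {θ : ℝ} (hθ : θ < 1)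
    (hE : ∀ i j, 0 ≤ E i j) (hrow : ∀ i, ∑ j, E i j ≤ θ) : (1 - E).det ≠ 0 := by
  intro h
  obtain ⟨v, hv, hv0⟩ := Matrix.exists_mulVec_eq_zero_iff.2 h
  have hg : ∀ i, v i = 0 + ∑ j, E i j * v j := fun i => by
    have := congrFun hv0 i
    rw [Matrix.sub_mulVec, Matrix.one_mulVec, Pi.sub_apply, Pi.zero_apply] at this
    rw [zero_add]
    exact sub_eq_zero.1 this
  refine hv (funext fun i => le_antisymm ?_ ?_)
  · simpa using le_div_of_eq_add_sum hθ le_rfl hE hrow hg (fun _ => le_rfl) i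
  · exact nonneg_of_eq_add_sum hθ hE hrow hg (fun _ => le_rfl) i

/-- If `E` is a nonnegative matrix with row sums at most `θ < 1` and columns bounded by `b`, then
`det (1 - E)` is a product of reciprocals of Green's functions `1 + E_jj + …`, one for each state,
and these lie between `1` and `1 + b_j / (1 - θ)`. -/
lemma det_one_sub_mem_Icc {E : Matrix (Fin n) (Fin n) ℝ} {θ : ℝ} {b : Fin n → ℝ} (hθ : θ < 1)
    (hE : ∀ i j, 0 ≤ E i j) (hrow : ∀ i, ∑ j, E i j ≤ θ) (hb : ∀ i j, E i j ≤ b j) :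
    Real.exp (-(∑ j, b j) / (1 - θ)) ≤ (1 - E).det ∧ (1 - E).det ≤ 1 := by
  have hpos : 0 < 1 - θ := by linarith
  induction n with
  | zero => simp
  | succ n ih =>
    set A := 1 - E with hA
    have hdet : A.det ≠ 0 := det_one_sub_ne_zero hθ hE hrow
    have hsub : A.submatrix Fin.succ Fin.succ = 1 - E.submatrix Fin.succ Fin.succ := by
      ext i j
      simp [hA, Matrix.one_apply]
    have hb0 : ∀ j, 0 ≤ b j := fun j => (hE 0 j).trans (hb 0 j)
    obtain ⟨h1, h2⟩ := ih (E := E.submatrix Fin.succ Fin.succ) (b := fun j => b j.succ)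
      (fun i j => hE _ _) (fun i => by
        refine le_trans ?_ (hrow i.succ)
        rw [Fin.sum_univ_succ (fun j => E i.succ j)]
        simpa using hE i.succ 0) (fun i j => hb _ _)
    rw [← hsub] at h1 h2
    set D := (A.submatrix Fin.succ Fin.succ).det with hD
    -- the first column of `(1 - E)⁻¹`; its first entry is the ratio of the two determinants
    let g : Fin (n + 1) → ℝ := fun i => A.adjugate i 0 / A.det
    have hg0 : g 0 = D / A.det := by
      simp [g, Matrix.adjugate_fin_succ_eq_det_submatrix, hD, Fin.succAbove_zero]
    have hg : ∀ i, g i = (if i = 0 then 1 else 0) + ∑ j, E i j * g j := fun i => by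
      have := congrFun (congrFun (Matrix.mul_adjugate A) i) 0
      rw [Matrix.mul_apply, Matrix.smul_apply, Matrix.one_apply] at this
      have h3 : ∑ j, A i j * g j = if i = 0 then 1 else 0 := by
        simp only [g, mul_div_assoc']
        rw [← Finset.sum_div, this]
        split_ifs <;> simp [hdet]
      rw [← h3]
      simp [hA, sub_mul, Finset.sum_sub_distrib, Matrix.one_apply]
    have hgn := nonneg_of_eq_add_sum hθ hE hrow hg (fun i => by split_ifs <;> norm_num)
    have hg1 : 1 ≤ g 0 := by
      rw [hg 0, if_pos rfl]
      have : 0 ≤ ∑ j, E 0 j * g j := Finset.sum_nonneg fun j _ => mul_nonneg (hE 0 j) (hgn j)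
      linarith
    have hg2 : g 0 ≤ 1 + b 0 / (1 - θ) := by
      have := le_div_of_eq_add_sum (g := fun i => g i - if i = 0 then 1 else 0)
        (c := fun i => E i 0) hθ (hb0 0) hE hrow (fun i => ?_) (fun i => hb i 0) 0
      · simp only [if_true] at this
        linarith
      · simp only [mul_sub, Finset.sum_sub_distrib, mul_ite, mul_one, mul_zero,
          Finset.sum_ite_eq', Finset.mem_univ, if_true]
        linarith [hg i]
    have hDpos : 0 < D := lt_of_lt_of_le (Real.exp_pos _) h1
    have hgpos : 0 < g 0 := by linarith
    have hAD : A.det = D / g 0 := by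
      rw [hg0]; field_simp
    rw [hAD]
    constructor
    · rw [le_div_iff₀ hgpos]
      refine le_trans ?_ h1
      have : g 0 ≤ Real.exp (b 0 / (1 - θ)) := by
        linarith [Real.add_one_le_exp (b 0 / (1 - θ))]
      calc _ ≤ Real.exp (-(∑ j, b j) / (1 - θ)) * Real.exp (b 0 / (1 - θ)) := by gcongr
        _ = _ := by
          rw [← Real.exp_add, Fin.sum_univ_succ]
          congr 1
          field_simp
          ring
    · rw [div_le_one hgpos]; linarith

/-- If all rows of a substochastic matrix `T` agree up to the factor `C`, then `det (1 - T)` agrees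
with the defects `1 - ∑ j, T i j` up to a factor depending only on `C`: such a matrix is a
perturbation of a matrix of rank one, for which there is equality. -/
lemma det_one_sub_mem_Icc_of_rows {T : Matrix (Fin n) (Fin n) ℝ} {C lo hi : ℝ} (hn : 0 < n)
    (hC : 1 ≤ C) (hT : ∀ i j, 0 ≤ T i j) (hTC : ∀ i i' j, T i j ≤ C * T i' j) (hlo0 : 0 ≤ lo)
    (hlo : ∀ i, lo ≤ 1 - ∑ j, T i j) (hhi : ∀ i, 1 - ∑ j, T i j ≤ hi) :
    Real.exp (-(C * (C - 1))) * lo ≤ (1 - T).det ∧ (1 - T).det ≤ C * hi := by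
  have hC0 : 0 < C := by linarith
  have hne : (Finset.univ : Finset (Fin n)).Nonempty := ⟨⟨0, hn⟩, Finset.mem_univ _⟩
  let i₀ : Fin n := ⟨0, hn⟩
  -- `T = E + 1 τ`, where `τ` is the row of column minima and `E` has row sums at most `1 - 1 / C`
  let τ : Fin n → ℝ := fun j => Finset.univ.inf' hne (fun i => T i j)
  have hτT : ∀ i j, τ j ≤ T i j := fun i j => Finset.inf'_le (f := fun i => T i j)
    (Finset.mem_univ i)
  have hτ0 : ∀ j, 0 ≤ τ j := fun j => Finset.le_inf' _ _ fun i _ => hT i j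
  have hTτ : ∀ i j, T i j ≤ C * τ j := fun i j => by
    obtain ⟨i', -, h'⟩ := Finset.exists_mem_eq_inf' hne (fun i => T i j)
    change T i j ≤ C * Finset.univ.inf' hne (fun i => T i j)
    rw [h']; exact hTC i i' j
  have hsum : ∀ i, ∑ j, T i j ≤ 1 := fun i => by linarith [hlo i]
  have hhi0 : 0 ≤ hi := hlo0.trans ((hlo i₀).trans (hhi i₀))
  set t := ∑ j, τ j with ht
  have ht0 : 0 ≤ t := Finset.sum_nonneg fun j _ => hτ0 j
  have ht1 : t ≤ 1 := (Finset.sum_le_sum fun j _ => hτT i₀ j).trans (hsum i₀)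
  let E : Matrix (Fin n) (Fin n) ℝ := Matrix.of fun i j => T i j - τ j
  have hE : ∀ i j, 0 ≤ E i j := fun i j => sub_nonneg.2 (hτT i j)
  have hrow : ∀ i, ∑ j, E i j ≤ 1 - 1 / C := fun i => by
    have h1 : ∀ j, E i j ≤ (1 - 1 / C) * T i j := fun j => by
      have : 1 / C * T i j ≤ τ j := by
        rw [one_div, inv_mul_le_iff₀ hC0]; exact hTτ i j
      simp only [E, Matrix.of_apply]; linarith
    have h2 : 0 ≤ 1 - 1 / C := by
      rw [sub_nonneg, div_le_one hC0]; exact hC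
    calc _ ≤ ∑ j, (1 - 1 / C) * T i j := Finset.sum_le_sum fun j _ => h1 j
      _ = (1 - 1 / C) * ∑ j, T i j := by rw [Finset.mul_sum]
      _ ≤ _ := mul_le_of_le_one_right h2 (hsum i)
  have hθ : 1 - 1 / C < 1 := by
    have : 0 < 1 / C := by positivity
    linarith
  have hb : ∀ i j, E i j ≤ (C - 1) * τ j := fun i j => by
    simp only [E, Matrix.of_apply]; linarith [hTτ i j]
  obtain ⟨hd1, hd2⟩ := det_one_sub_mem_Icc hθ hE hrow hb
  have hexp : Real.exp (-(C * (C - 1))) ≤ (1 - E).det := by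
    refine le_trans (Real.exp_le_exp.2 ?_) hd1
    rw [← Finset.mul_sum, ← ht]
    have : -((C - 1) * t) / (1 - (1 - 1 / C)) = -(C * (C - 1) * t) := by
      field_simp; ring
    rw [this, neg_le_neg_iff]
    exact mul_le_of_le_one_right (mul_nonneg hC0.le (by linarith)) ht1
  have hdpos : 0 < (1 - E).det := lt_of_lt_of_le (Real.exp_pos _) hexp
  have hunit : IsUnit (1 - E).det := isUnit_iff_ne_zero.2 hdpos.ne'
  have hdec : 1 - T = (1 - E) + Matrix.replicateCol Unit (fun _ : Fin n => (1 : ℝ)) *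
      Matrix.replicateRow Unit (fun j => - τ j) := by
    ext i j
    simp [E, Matrix.mul_apply]
    ring
  set w : Fin n → ℝ := (1 - E)⁻¹.mulVec (fun _ => 1) with hw
  have hwE : (1 - E).mulVec w = fun _ => 1 := by
    rw [hw, Matrix.mulVec_mulVec, Matrix.mul_nonsing_inv _ hunit, Matrix.one_mulVec]
  have hw' : ∀ i, w i = 1 + ∑ j, E i j * w j := fun i => by
    have := congrFun hwE i
    rw [Matrix.sub_mulVec, Matrix.one_mulVec, Pi.sub_apply] at this
    have h2 : (E.mulVec w) i = ∑ j, E i j * w j := rfl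
    linarith
  have hdet : (1 - T).det = (1 - E).det * (1 - ∑ j, τ j * w j) := by
    rw [hdec, Matrix.det_add_replicateCol_mul_replicateRow hunit]
    congr 1
    rw [Matrix.det_unique, Matrix.mul_assoc, Matrix.add_apply, Matrix.one_apply_eq,
      Matrix.mul_apply]
    simp only [Matrix.replicateRow_apply, neg_mul, Finset.sum_neg_distrib, ← sub_eq_add_neg]
    rfl
  rw [hdet]
  have key : lo ≤ 1 - ∑ j, τ j * w j ∧ 1 - ∑ j, τ j * w j ≤ C * hi := by
    rcases ht0.eq_or_lt with h0 | h0
    · have hτz : ∀ j, τ j = 0 := fun j =>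
        (Finset.sum_eq_zero_iff_of_nonneg fun j _ => hτ0 j).1 h0.symm j (Finset.mem_univ j)
      have hTz : ∀ i j, T i j = 0 := fun i j =>
        le_antisymm (by simpa [hτz j] using hTτ i j) (hT i j)
      have h1 := hlo i₀
      have h2 := hhi i₀
      simp only [hTz, Finset.sum_const_zero, sub_zero] at h1 h2
      simp only [hτz, zero_mul, Finset.sum_const_zero, sub_zero]
      exact ⟨h1, by nlinarith⟩
    · -- `g = (1 - E)⁻¹ s`, where `s = (1 - T) 1` is the vector of defects
      let g : Fin n → ℝ := fun i => 1 - t * w i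
      have hg : ∀ i, g i = (1 - ∑ j, T i j) + ∑ j, E i j * g j := fun i => by
        have e1 : ∑ j, E i j * g j = ∑ j, E i j - t * ∑ j, E i j * w j := by
          rw [Finset.mul_sum, ← Finset.sum_sub_distrib]
          exact Finset.sum_congr rfl fun j _ => by simp only [g]; ring
        have e2 : ∑ j, E i j = ∑ j, T i j - t := by
          simp only [E, Matrix.of_apply, Finset.sum_sub_distrib, ht]
        rw [e1, e2]
        simp only [g]
        rw [hw' i]; ring
      have hs0 : ∀ i, 0 ≤ 1 - ∑ j, T i j := fun i => hlo0.trans (hlo i)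
      have hg0 := nonneg_of_eq_add_sum hθ hE hrow hg hs0
      have hglo : ∀ i, lo ≤ g i := fun i => by
        rw [hg i]
        have : 0 ≤ ∑ j, E i j * g j := Finset.sum_nonneg fun j _ => mul_nonneg (hE i j) (hg0 j)
        linarith [hlo i]
      have hghi : ∀ i, g i ≤ C * hi := fun i => by
        have := le_div_of_eq_add_sum hθ hhi0 hE hrow hg hhi i
        have e : hi / (1 - (1 - 1 / C)) = C * hi := by field_simp; ring
        rwa [e] at this
      have hτg : ∑ j, τ j * g j = t * (1 - ∑ j, τ j * w j) := by
        simp only [g, mul_sub, mul_one, Finset.sum_sub_distrib, ← ht]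
        rw [Finset.mul_sum]
        congr 1
        exact Finset.sum_congr rfl fun j _ => by ring
      constructor
      · refine le_of_mul_le_mul_left ?_ h0
        rw [← hτg, ht, Finset.sum_mul]
        exact Finset.sum_le_sum fun j _ => mul_le_mul_of_nonneg_left (hglo j) (hτ0 j)
      · refine le_of_mul_le_mul_left ?_ h0
        rw [← hτg, ht, Finset.sum_mul]
        exact Finset.sum_le_sum fun j _ => mul_le_mul_of_nonneg_left (hghi j) (hτ0 j)
  constructor
  · exact mul_le_mul hexp key.1 hlo0 hdpos.le
  · calc _ ≤ 1 * (1 - ∑ j, τ j * w j) :=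
          mul_le_mul_of_nonneg_right hd2 (hlo0.trans key.1)
      _ ≤ _ := by rw [one_mul]; exact key.2

end Determinants

/-! ### Comparison of Green's determinants in two domains -/

section Comparison

open scoped ENNReal

variable {α : Type*} (k : α → α → ℝ≥0∞)

/-- The probability to leave `K` before visiting `E`. -/
noncomputable def escapeProb (K E : Set α) (x : α) : ℝ≥0∞ :=
  potential k (K \ E) (Kᶜ.indicator 1) x

/-- The probability that, after leaving `B`, the walk visits `E` before leaving `K`, and that the
first point of `E` visited is `y`. -/
noncomputable def returnProb (B K E : Set α) (x y : α) : ℝ≥0∞ :=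
  potential k B (Bᶜ.indicator fun z => green k (K \ E) z y) x

/-- The Green's function of `D` restricted to the points of `η`. -/
noncomputable def greenMatrix (D : Set α) (η : List α) : Matrix (Fin η.length) (Fin η.length) ℝ :=
  Matrix.of fun i j => (green k D (η.get i) (η.get j)).toReal

/-- The matrix of return probabilities to the points of `η` after leaving `B`. -/
noncomputable def returnMatrix (B K : Set α) (η : List α) :
    Matrix (Fin η.length) (Fin η.length) ℝ :=
  Matrix.of fun i j => (returnProb k B K {x | x ∈ η} (η.get i) (η.get j)).toReal

variable {k}

lemma exit_le_one (hk : ∀ x, ∑' y, k x y = 1) (K : Set α) (x : α) :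
    potential k K (Kᶜ.indicator 1) x ≤ 1 :=
  potential_le_const k hk (fun y hy => by simp [hy])
    (fun y => Set.indicator_le_self' (fun _ _ => zero_le) y) x

lemma escapeProb_le_one (hk : ∀ x, ∑' y, k x y = 1) (K E : Set α) (x : α) :
    escapeProb k K E x ≤ 1 :=
  potential_le_const k hk (fun y hy => by simp [hy.1])
    (fun y => Set.indicator_le_self' (fun _ _ => zero_le) y) x

/-- Almost sure exit from `K` is inherited by the points that the walk can reach inside `K`. -/
lemma exit_eq_one_of_step (hk : ∀ x, ∑' y, k x y = 1) {K : Set α} {x y : α} (hx : x ∈ K)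
    (hxK : potential k K (Kᶜ.indicator 1) x = 1) (hxy : k x y ≠ 0) :
    potential k K (Kᶜ.indicator 1) y = 1 := by
  by_contra hne
  have hlt : potential k K (Kᶜ.indicator 1) y < 1 := lt_of_le_of_ne (exit_le_one hk K y) hne
  have hkfin : k x y ≠ ∞ := ne_top_of_le_ne_top ENNReal.one_ne_top
    ((hk x) ▸ ENNReal.le_tsum (f := k x) y)
  have : kernelStep k (potential k K (Kᶜ.indicator 1)) x < ∑' y, k x y := by
    refine ENNReal.tsum_lt_tsum (i := y) ?_ (fun z => mul_le_of_le_one_right zero_le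
      (exit_le_one hk K z)) ?_
    · refine ne_top_of_le_ne_top ENNReal.one_ne_top (le_trans ?_ (exit_le_one hk K x))
      rw [potential_of_mem k hx]
      exact le_add_self
    · calc k x y * potential k K (Kᶜ.indicator 1) y < k x y * 1 :=
            (ENNReal.mul_lt_mul_iff_right hxy hkfin).2 hlt
        _ = k x y := mul_one _
  rw [potential_of_mem k hx, hk] at *
  simp [hx] at hxK
  exact this.ne hxK

/-- If the walk can leave `K` from `a`, then the expected number of visits to `a` is finite. -/
lemma green_self_ne_top (hk : ∀ x, ∑' y, k x y = 1) {K : Set α} {a : α} (ha : a ∈ K)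
    (h : potential k K (Kᶜ.indicator 1) a ≠ 0) : green k K a a ≠ ∞ := by
  -- `ρ` and `q` are the probabilities of returning to `a` and of leaving `K` before that
  set D := K \ {a} with hD
  set ρ := kernelStep k (fun z => green k D z a) a with hρ
  set q := kernelStep k (potential k D (Kᶜ.indicator 1)) a with hq
  have hq0 : q ≠ 0 := by
    intro h0
    apply h
    have haD : a ∉ D := by simp [hD]
    have := potential_le k (D := K) (φ := Kᶜ.indicator 1)
      (v := potential k D (Kᶜ.indicator 1)) (fun x => ?_) a
    · rw [potential_of_notMem k haD] at this
      simpa [ha] using this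
    · by_cases hxK : x ∈ K
      · rw [Set.indicator_of_mem hxK]
        by_cases hxa : x = a
        · subst hxa
          rw [← hq, h0, potential_of_notMem k haD, add_zero]
        · exact (potential_of_mem k (show x ∈ D from ⟨hxK, hxa⟩)).ge
      · rw [Set.indicator_of_notMem hxK, add_zero]
        exact le_potential _ _ _ _
  have hsum : ρ + q ≤ 1 := by
    rw [hρ, hq, ← kernelStep_add, ← kernelStep_const k hk 1 a]
    refine kernelStep_mono k (fun x => ?_) a
    rw [green, ← potential_add]
    refine potential_le_const k hk (fun y hy => ?_) (fun y => ?_) x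
    · rw [pointCharge_of_ne hy.2, Set.indicator_of_notMem (by simpa using hy.1), add_zero]
    · by_cases hya : y = a
      · subst hya; simp [ha]
      · rw [pointCharge_of_ne hya, zero_add]
        exact Set.indicator_le_self' (fun _ _ => zero_le) y
  have hρ1 : ρ < 1 := by
    by_contra hge
    push Not at hge
    have : (1 : ℝ≥0∞) + q ≤ 1 + 0 := by
      rw [add_zero]; exact le_trans (by gcongr) hsum
    exact hq0 (le_zero_iff.1 ((ENNReal.add_le_add_iff_left ENNReal.one_ne_top).1 this))
  have hρtop : ρ ≠ ∞ := hρ1.ne_top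
  have hle := potential_le k (D := K) (φ := pointCharge a)
    (v := fun x => (1 - ρ)⁻¹ * green k D x a) (fun x => ?_) a
  · refine ne_top_of_le_ne_top ?_ hle
    have haa : green k D a a = 1 := by
      rw [green, potential_of_notMem k (by simp [hD]), pointCharge_self]
    rw [haa, mul_one]
    exact ENNReal.inv_ne_top.2 (tsub_pos_of_lt hρ1).ne'
  · by_cases hxa : x = a
    · subst hxa
      rw [pointCharge_self, Set.indicator_of_mem ha, kernelStep_const_mul, ← hρ]
      have haa : green k D x x = 1 := by
        rw [green, potential_of_notMem k (by simp [hD]), pointCharge_self]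
      rw [haa, mul_one]
      have h1 : (1 - ρ)⁻¹ * (1 - ρ) = 1 :=
        ENNReal.inv_mul_cancel (tsub_pos_of_lt hρ1).ne' (by simp)
      calc 1 + (1 - ρ)⁻¹ * ρ = (1 - ρ)⁻¹ * ((1 - ρ) + ρ) := by rw [mul_add, h1]
        _ ≤ _ := by rw [tsub_add_cancel_of_le hρ1.le, mul_one]
    · rw [pointCharge_of_ne hxa, zero_add]
      by_cases hxK : x ∈ K
      · rw [Set.indicator_of_mem hxK, kernelStep_const_mul]
        gcongr
        conv_rhs => rw [green, potential_of_mem k (show x ∈ D from ⟨hxK, hxa⟩)]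
        exact le_add_self
      · simp [hxK]

lemma green_ne_top (hk : ∀ x, ∑' y, k x y = 1) {K : Set α} {a : α} (x : α) (ha : a ∈ K)
    (h : green k K a a ≠ ∞) : green k K x a ≠ ∞ :=
  ne_top_of_le_ne_top h (green_le_green_self k hk x ha)

/-- The product of Green's functions in successively smaller domains is a determinant, by
elimination of the first row. -/
lemma det_greenMatrix (hk : ∀ x, ∑' y, k x y = 1) {D : Set α} {η : List α} (hη : η.Nodup)
    (hD : ∀ x ∈ η, x ∈ D) (hfin : ∀ x ∈ η, green k D x x ≠ ∞) :
    (greenMatrix k D η).det = (greenProd k D η).toReal := by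
  induction η generalizing D with
  | nil => simp [greenProd]
  | cons a η ih =>
    have hnd := List.nodup_cons.1 hη
    have haD : a ∈ D := hD a (by simp)
    have hafin := hfin a (by simp)
    have hD' : ∀ x ∈ η, x ∈ D \ {a} := fun x hx =>
      ⟨hD x (List.mem_cons_of_mem _ hx), by rintro rfl; exact hnd.1 hx⟩
    have hfin' : ∀ x ∈ η, green k (D \ {a}) x x ≠ ∞ := fun x hx =>
      ne_top_of_le_ne_top (hfin x (List.mem_cons_of_mem _ hx))
        (potential_mono_set k Set.sdiff_subset _ _)
    have hG0 : (green k D a a).toReal ≠ 0 :=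
      (ENNReal.toReal_pos (one_pos.trans_le (one_le_green k D a)).ne' hafin).ne'
    let A := greenMatrix k D (a :: η)
    let c : Fin (η.length + 1) → ℝ := Fin.cons 0 fun i => (green k (D \ {a}) (η.get i) a).toReal
    let B : Matrix (Fin (η.length + 1)) (Fin (η.length + 1)) ℝ :=
      Matrix.of fun i j => A i j - c i * A 0 j
    have hAB : A.det = B.det :=
      Matrix.det_eq_of_forall_row_eq_smul_add_const c 0 (by simp [c]) fun i j => by
        simp [B, c]
    have hB0 : ∀ i : Fin η.length, B i.succ 0 = 0 := fun i => by
      have := green_eq_hit_mul k haD (η.get i)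
      simp only [B, c, A, greenMatrix, Matrix.of_apply, Fin.cons_succ]
      change (green k D (η.get i) a).toReal - _ * (green k D a a).toReal = 0
      rw [this, ENNReal.toReal_mul, sub_self]
    have hBs : B.submatrix Fin.succ Fin.succ = greenMatrix k (D \ {a}) η := by
      ext i j
      have hj : η.get j ∈ η := List.get_mem _ _
      have h1 := green_eq_add k haD (y := η.get j) (fun h => hnd.1 (h ▸ hj)) (η.get i)
      simp only [B, c, A, greenMatrix, Matrix.of_apply, Fin.cons_succ, Matrix.submatrix_apply]
      change (green k D (η.get i) (η.get j)).toReal - _ * (green k D a (η.get j)).toReal = _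
      have hjfin : green k D a (η.get j) ≠ ∞ :=
        green_ne_top hk _ (hD' _ hj).1 (hfin _ (List.mem_cons_of_mem _ hj))
      have hij : green k (D \ {a}) (η.get i) (η.get j) ≠ ∞ :=
        green_ne_top hk _ (hD' _ hj) (hfin' _ hj)
      have hia : green k (D \ {a}) (η.get i) a ≠ ∞ :=
        ne_top_of_le_ne_top ENNReal.one_ne_top (green_hit_le_one k hk _ _ (by simp))
      rw [h1, ENNReal.toReal_add hij (ENNReal.mul_ne_top hia hjfin), ENNReal.toReal_mul]
      ring
    have hB00 : B 0 0 = (green k D a a).toReal := by simp [B, c, A, greenMatrix]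
    change A.det = _
    rw [hAB, Matrix.det_succ_column_zero, Fin.sum_univ_succ]
    have hz : ∑ i : Fin η.length, (-1 : ℝ) ^ ((i.succ : Fin (η.length + 1)) : ℕ) * B i.succ 0 *
        (B.submatrix (i.succ.succAbove) Fin.succ).det = 0 :=
      Finset.sum_eq_zero fun i _ => by rw [hB0]; ring
    rw [hz, add_zero, Fin.succAbove_zero, hBs, hB00, ih hnd.2 hD' hfin', greenProd,
      ENNReal.toReal_mul]
    simp

lemma indicator_eq_sum_pointCharge {η : List α} (hη : η.Nodup) (f : α → ℝ≥0∞) (z : α) :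
    ({x | x ∈ η} : Set α).indicator f z = ∑ i : Fin η.length, f (η.get i) * pointCharge (η.get i) z
    := by
  by_cases hz : z ∈ η
  · obtain ⟨i, rfl⟩ := List.get_of_mem hz
    rw [Set.indicator_of_mem (by exact hz), Fintype.sum_eq_single i]
    · simp
    · intro j hj
      rw [pointCharge_of_ne, mul_zero]
      intro h
      exact hj ((List.nodup_iff_injective_get.1 hη h).symm)
  · rw [Set.indicator_of_notMem (by exact hz)]
    symm
    refine Finset.sum_eq_zero fun i _ => ?_
    rw [pointCharge_of_ne, mul_zero]
    rintro rfl
    exact hz (List.get_mem _ _)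

lemma potential_indicator_sum (B : Set α) {ι : Type*} [Fintype ι] (c : ι → ℝ≥0∞)
    (f : ι → α → ℝ≥0∞) (x : α) :
    potential k B (Bᶜ.indicator fun z => ∑ i, c i * f i z) x =
      ∑ i, c i * potential k B (Bᶜ.indicator (f i)) x := by
  simp only [← potential_const_mul, ← potential_sum]
  congr 1
  funext z
  by_cases hz : z ∈ B <;> simp [hz]

/-- The decomposition of `G_K` at the exit from `B` and the subsequent return to `η`. -/
lemma green_eq_green_add_return {B K : Set α} (hBK : B ⊆ K) {η : List α} (hη : η.Nodup)
    (hB : ∀ x ∈ η, x ∈ B) {y : α} (hy : y ∈ η) (x : α) :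
    green k K x y = green k B x y +
      ∑ i : Fin η.length, green k K (η.get i) y * returnProb k B K {x | x ∈ η} x (η.get i) := by
  have hG : ∀ z, green k K z y = ∑ i : Fin η.length,
      green k K (η.get i) y * green k (K \ {x | x ∈ η}) z (η.get i) := fun z => by
    have h := potential_markov_of_zero k (D := K) (D' := K \ {x | x ∈ η}) Set.sdiff_subset
      (φ := pointCharge y) (fun w hw => pointCharge_of_ne (by rintro rfl; exact hw.2 hy)) z
    have h2 : (K \ {x | x ∈ η})ᶜ.indicator (potential k K (pointCharge y)) =
        fun w => ∑ i : Fin η.length, green k K (η.get i) y * pointCharge (η.get i) w := by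
      funext w
      rw [← indicator_eq_sum_pointCharge hη (fun w => green k K w y)]
      by_cases hw : w ∈ η
      · rw [Set.indicator_of_mem (by exact fun h => h.2 hw), Set.indicator_of_mem (by exact hw)]
        rfl
      · rw [Set.indicator_of_notMem (s := {x | x ∈ η}) (by exact hw)]
        by_cases hwK : w ∈ K
        · exact Set.indicator_of_notMem
            (Set.notMem_compl_iff.2 (show w ∈ K \ {x | x ∈ η} from ⟨hwK, hw⟩)) _
        · rw [Set.indicator_of_mem (by exact fun h => hwK h.1)]
          exact green_of_notMem k hwK (hBK (hB y hy))
    rw [green, h, h2, potential_sum]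
    simp only [potential_const_mul, green]
  have h := potential_markov k hBK (pointCharge y) x
  rw [green, h, potential_add]
  congr 1
  · rw [green]
    congr 1
    funext z
    by_cases hz : z ∈ B
    · rw [Set.indicator_of_mem hz]
    · rw [Set.indicator_of_notMem hz, pointCharge_of_ne]
      rintro rfl; exact hz (hB z hy)
  · have : potential k K (pointCharge y) = fun z => ∑ i : Fin η.length,
      green k K (η.get i) y * green k (K \ {x | x ∈ η}) z (η.get i) := funext hG
    rw [this, potential_indicator_sum]
    rfl

/-- From a point of `B`, the walk either escapes from `K` after leaving `B`, or returns. -/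
lemma escape_add_return_eq_one {B K : Set α} (hBK : B ⊆ K) {η : List α} (hη : η.Nodup)
    (hB : ∀ x ∈ η, x ∈ B) (he : ∀ x ∈ η, potential k K (Kᶜ.indicator 1) x = 1) {x : α}
    (hx : potential k K (Kᶜ.indicator 1) x = 1) :
    potential k B (Bᶜ.indicator (escapeProb k K {x | x ∈ η})) x +
      ∑ i : Fin η.length, returnProb k B K {x | x ∈ η} x (η.get i) = 1 := by
  have hG : ∀ z, potential k K (Kᶜ.indicator 1) z = escapeProb k K {x | x ∈ η} z +
      ∑ i : Fin η.length, 1 * green k (K \ {x | x ∈ η}) z (η.get i) := fun z => by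
    rw [potential_markov_of_zero k (D := K) (D' := K \ {x | x ∈ η}) Set.sdiff_subset
      (φ := Kᶜ.indicator 1) (fun w hw => by simp [hw.1]) z]
    have h2 : (K \ {x | x ∈ η})ᶜ.indicator (potential k K (Kᶜ.indicator 1)) =
        fun w => Kᶜ.indicator 1 w + ∑ i : Fin η.length, 1 * pointCharge (η.get i) w := by
      funext w
      have h3 := indicator_eq_sum_pointCharge hη (fun _ => 1) w
      rw [← h3]
      by_cases hw : w ∈ η
      · rw [Set.indicator_of_mem (by exact fun h => h.2 hw), he w hw,
          Set.indicator_of_mem (s := {x | x ∈ η}) (by exact hw),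
          Set.indicator_of_notMem (Set.notMem_compl_iff.2 (hBK (hB w hw))), zero_add]
      · rw [Set.indicator_of_notMem (s := {x | x ∈ η}) (by exact hw), add_zero]
        by_cases hwK : w ∈ K
        · rw [Set.indicator_of_notMem (by exact fun h => h ⟨hwK, hw⟩),
            Set.indicator_of_notMem (by exact fun h => h hwK)]
        · rw [Set.indicator_of_mem (by exact fun h => hwK h.1), potential_of_notMem k hwK]
    rw [h2, potential_add, potential_sum]
    simp only [potential_const_mul, green, escapeProb]
  have h := potential_markov_of_zero k hBK (φ := Kᶜ.indicator 1) (fun w hw => by simp [hBK hw]) x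
  rw [hx, funext hG] at h
  rw [h]
  have h4 : (Bᶜ.indicator fun x_1 => escapeProb k K {x | x ∈ η} x_1 +
      ∑ i : Fin η.length, 1 * green k (K \ {x | x ∈ η}) x_1 (η.get i)) =
      fun z => Bᶜ.indicator (escapeProb k K {x | x ∈ η}) z +
        Bᶜ.indicator (fun z => ∑ i : Fin η.length, 1 * green k (K \ {x | x ∈ η}) z (η.get i)) z := by
    funext z
    by_cases hz : z ∈ B <;> simp [hz]
  rw [h4, potential_add, potential_indicator_sum]
  simp only [one_mul, returnProb]

/-- Escaping from `K` amounts to leaving a smaller domain and then escaping from `K`. -/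
lemma escapeProb_markov {B K E : Set α} (hBK : B ⊆ K) (x : α) (hEK : E ⊆ K) :
    escapeProb k K E x = potential k (B \ E) (Bᶜ.indicator (escapeProb k K E)) x := by
  rw [escapeProb, potential_markov_of_zero k (D' := B \ E) (Set.sdiff_subset_sdiff_left hBK)
    (fun w hw => by simp [hBK hw.1]) x]
  congr 1
  funext z
  by_cases hz : z ∈ B
  · rw [Set.indicator_of_notMem (s := Bᶜ) (by exact fun h => h hz)]
    by_cases hzE : z ∈ E
    · rw [Set.indicator_of_mem (by exact fun h => h.2 hzE), potential_of_notMem k (fun h => h.2 hzE),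
        Set.indicator_of_notMem (by exact fun h => h (hEK hzE))]
    · rw [Set.indicator_of_notMem (by exact fun h => h ⟨hz, hzE⟩)]
  · rw [Set.indicator_of_mem (s := Bᶜ) (by exact hz),
      Set.indicator_of_mem (s := (B \ E)ᶜ) (by exact fun h => hz h.1)]
    rfl

lemma returnProb_le_one (hk : ∀ x, ∑' y, k x y = 1) (B K : Set α) {E : Set α} (x : α) {y : α}
    (hy : y ∈ E) : returnProb k B K E x y ≤ 1 := by
  refine potential_le_const k hk (fun z hz => by simp [hz]) (fun z => ?_) x
  refine (Set.indicator_le_self' (fun _ _ => zero_le) z).trans ?_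
  exact green_hit_le_one k hk _ _ (fun h => h.2 hy)

/-- Passing from `B` to a larger domain `K` divides the Green's determinant by `det (1 - T)`,
where `T` is the matrix of return probabilities after leaving `B`. -/
lemma det_returnMatrix_mul (hk : ∀ x, ∑' y, k x y = 1) {B K : Set α} (hBK : B ⊆ K) {η : List α}
    (hη : η.Nodup) (hB : ∀ x ∈ η, x ∈ B) (hfin : ∀ x ∈ η, green k K x x ≠ ∞) :
    (1 - returnMatrix k B K η).det * (greenProd k K η).toReal = (greenProd k B η).toReal := by
  have hfinB : ∀ x ∈ η, green k B x x ≠ ∞ := fun x hx =>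
    ne_top_of_le_ne_top (hfin x hx) (potential_mono_set k hBK _ _)
  rw [← det_greenMatrix hk hη (fun x hx => hBK (hB x hx)) hfin,
    ← det_greenMatrix hk hη hB hfinB, ← Matrix.det_mul]
  congr 1
  rw [sub_mul, one_mul, sub_eq_iff_eq_add]
  ext i j
  have hi : η.get i ∈ η := List.get_mem _ _
  have hj : η.get j ∈ η := List.get_mem _ _
  have h := green_eq_green_add_return (k := k) hBK hη hB hj (η.get i)
  have hterm : ∀ l : Fin η.length, green k K (η.get l) (η.get j) *
      returnProb k B K {x | x ∈ η} (η.get i) (η.get l) ≠ ∞ := fun l =>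
    ENNReal.mul_ne_top (green_ne_top hk _ (hBK (hB _ hj)) (hfin _ hj))
      (ne_top_of_le_ne_top ENNReal.one_ne_top
        (returnProb_le_one hk B K _ (List.get_mem η l)))
  rw [Matrix.add_apply, Matrix.mul_apply]
  simp only [greenMatrix, returnMatrix, Matrix.of_apply]
  rw [h, ENNReal.toReal_add (green_ne_top hk _ (hB _ hj) (hfinB _ hj))
    (ENNReal.sum_ne_top.2 fun l _ => hterm l), ENNReal.toReal_sum fun l _ => hterm l]
  congr 1
  exact Finset.sum_congr rfl fun l _ => by rw [ENNReal.toReal_mul, mul_comm]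

lemma one_le_greenProd (D : Set α) (η : List α) : 1 ≤ greenProd k D η := by
  induction η generalizing D with
  | nil => exact le_rfl
  | cons a η ih => exact one_le_mul (one_le_green k D a) (ih _)

lemma greenProd_ne_top {D : Set α} {η : List α} (hη : η.Nodup)
    (hfin : ∀ x ∈ η, green k D x x ≠ ∞) : greenProd k D η ≠ ∞ := by
  induction η generalizing D with
  | nil => exact ENNReal.one_ne_top
  | cons a η ih =>
    refine ENNReal.mul_ne_top (hfin a (by simp)) (ih (List.nodup_cons.1 hη).2 fun x hx => ?_)
    exact ne_top_of_le_ne_top (hfin x (List.mem_cons_of_mem _ hx))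
      (potential_mono_set k Set.sdiff_subset _ _)

end Comparison

/-! ### Taylor expansion of the fundamental solution -/

section FundamentalSolution

lemma abs_le_of_deriv_le {F F' : ℝ → ℝ} {C : ℝ} {n : ℕ}
    (hF : ∀ t, |t| ≤ 1 / 2 → HasDerivAt F (F' t) t) (h0 : F 0 = 0)
    (hF' : ∀ t, |t| ≤ 1 / 2 → |F' t| ≤ C * |t| ^ n) {t : ℝ} (ht : |t| ≤ 1 / 2) :
    |F t| ≤ C * |t| ^ (n + 1) := by
  have hC : 0 ≤ C := by
    have := (abs_nonneg _).trans (hF' (1 / 2) (by norm_num [abs_of_pos]))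
    by_contra hneg
    push Not at hneg
    have : C * |(1 / 2 : ℝ)| ^ n < 0 := mul_neg_of_neg_of_pos hneg (by positivity)
    linarith
  have hs : ∀ s ∈ Set.uIcc 0 t, |s| ≤ |t| := fun s hs => by
    have := Set.abs_sub_left_of_mem_uIcc hs
    simpa using this
  have := (convex_uIcc (0 : ℝ) t).norm_image_sub_le_of_norm_hasDerivWithin_le (f := F) (f' := F')
    (C := C * |t| ^ n) (fun s hs' => (hF s ((hs s hs').trans ht)).hasDerivWithinAt)
    (fun s hs' => by
      rw [Real.norm_eq_abs]
      refine (hF' s ((hs s hs').trans ht)).trans ?_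
      have := hs s hs'
      gcongr) Set.left_mem_uIcc Set.right_mem_uIcc
  rw [h0, sub_zero, sub_zero, Real.norm_eq_abs, Real.norm_eq_abs] at this
  rw [pow_succ, ← mul_assoc]
  exact this

lemma hasDerivAt_one_add_rpow (s : ℝ) {t : ℝ} (ht : |t| ≤ 1 / 2) :
    HasDerivAt (fun t : ℝ => (1 + t) ^ s) (s * (1 + t) ^ (s - 1)) t := by
  have hpos : 0 < 1 + t := by linarith [(abs_le.1 ht).1]
  have := ((hasDerivAt_id t).const_add (1 : ℝ)).rpow_const (p := s) (Or.inl hpos.ne')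
  simpa using this

lemma exists_taylor_one (s : ℝ) :
    ∃ C : ℝ, ∀ t : ℝ, |t| ≤ 1 / 2 → |(1 + t) ^ s - 1| ≤ C * |t| ^ 1 := by
  obtain ⟨M, hM⟩ : ∃ M : ℝ, ∀ t : ℝ, |t| ≤ 1 / 2 → |s * (1 + t) ^ (s - 1)| ≤ M := by
    have hc : ContinuousOn (fun t : ℝ => s * (1 + t) ^ (s - 1)) (Set.Icc (-(1 / 2)) (1 / 2)) := by
      intro t ht
      have := hasDerivAt_one_add_rpow (s - 1) (abs_le.2 ⟨ht.1, ht.2⟩)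
      exact (this.continuousAt.const_mul s).continuousWithinAt
    obtain ⟨M, hM⟩ := isCompact_Icc.exists_bound_of_continuousOn hc
    exact ⟨M, fun t ht => hM t ⟨(abs_le.1 ht).1, (abs_le.1 ht).2⟩⟩
  refine ⟨M, fun t ht => abs_le_of_deriv_le (F := fun t => (1 + t) ^ s - 1) (n := 0)
    (fun t ht => (hasDerivAt_one_add_rpow s ht).sub_const 1) (by simp) (fun t ht => ?_) ht⟩
  simpa using hM t ht

lemma exists_taylor_two (s : ℝ) :
    ∃ C : ℝ, ∀ t : ℝ, |t| ≤ 1 / 2 → |(1 + t) ^ s - 1 - s * t| ≤ C * |t| ^ 2 := by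
  obtain ⟨C, hC⟩ := exists_taylor_one (s - 1)
  refine ⟨|s| * C, fun t ht => abs_le_of_deriv_le (F := fun t => (1 + t) ^ s - 1 - s * t) (n := 1)
    (F' := fun t => s * ((1 + t) ^ (s - 1) - 1)) (fun t ht => ?_) (by simp) (fun t ht => ?_) ht⟩
  · exact (((hasDerivAt_one_add_rpow s ht).sub_const 1).sub
      ((hasDerivAt_id t).const_mul s)).congr_deriv (by ring)
  · rw [abs_mul, mul_assoc]
    exact mul_le_mul_of_nonneg_left (hC t ht) (abs_nonneg _)

lemma exists_taylor_three (s : ℝ) :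
    ∃ C : ℝ, ∀ t : ℝ, |t| ≤ 1 / 2 →
      |(1 + t) ^ s - 1 - s * t - s * (s - 1) / 2 * t ^ 2| ≤ C * |t| ^ 3 := by
  obtain ⟨C, hC⟩ := exists_taylor_two (s - 1)
  refine ⟨|s| * C, fun t ht => abs_le_of_deriv_le (n := 2)
    (F := fun t => (1 + t) ^ s - 1 - s * t - s * (s - 1) / 2 * t ^ 2)
    (F' := fun t => s * ((1 + t) ^ (s - 1) - 1 - (s - 1) * t))
    (fun t ht => ?_) (by simp) (fun t ht => ?_) ht⟩
  · refine ((((hasDerivAt_one_add_rpow s ht).sub_const 1).sub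
      ((hasDerivAt_id t).const_mul s)).sub
      (((hasDerivAt_id t).pow 2).const_mul (s * (s - 1) / 2))).congr_deriv ?_
    simp only [id]
    push_cast
    ring
  · rw [abs_mul, mul_assoc]
    exact mul_le_mul_of_nonneg_left (hC t ht) (abs_nonneg _)

/-- The fundamental solution of the Laplace equation in dimension `d`, as a function of the square
of the distance, normalised to have derivative `-u ^ (-d / 2)`. -/
noncomputable def fundSol (d : ℕ) (u : ℝ) : ℝ :=
  if d = 2 then -Real.log u else u ^ (1 - (d : ℝ) / 2) / ((d : ℝ) / 2 - 1)

lemma hasDerivAt_fundSol (d : ℕ) {u : ℝ} (hu : 0 < u) :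
    HasDerivAt (fundSol d) (-u ^ (-((d : ℝ) / 2))) u := by
  by_cases h : d = 2
  · subst h
    have : fundSol 2 = fun u => -Real.log u := by funext u; simp [fundSol]
    rw [this]
    refine (Real.hasDerivAt_log hu.ne').neg.congr_deriv ?_
    norm_num [Real.rpow_neg_one]
  · have hb : (d : ℝ) / 2 - 1 ≠ 0 := by
      intro h'
      apply h
      have : (d : ℝ) = 2 := by linarith
      exact_mod_cast this
    have : fundSol d = fun u => u ^ (1 - (d : ℝ) / 2) / ((d : ℝ) / 2 - 1) := by
      funext u; simp [fundSol, h]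
    rw [this]
    refine (((hasDerivAt_id u).rpow_const (p := 1 - (d : ℝ) / 2) (Or.inl hu.ne')).div_const
      ((d : ℝ) / 2 - 1)).congr_deriv ?_
    have e : 1 - (d : ℝ) / 2 - 1 = -((d : ℝ) / 2) := by ring
    simp only [id, e]
    rw [div_eq_iff hb]
    ring

/-- Mean value bounds for the fundamental solution, which do not distinguish dimension two. -/
lemma fundSol_sub_bounds (d : ℕ) {u u' : ℝ} (hu : 0 < u) (h : u ≤ u') :
    (u' - u) * u' ^ (-((d : ℝ) / 2)) ≤ fundSol d u - fundSol d u' ∧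
      fundSol d u - fundSol d u' ≤ (u' - u) * u ^ (-((d : ℝ) / 2)) := by
  rcases h.eq_or_lt with rfl | hlt
  · simp
  · obtain ⟨c, ⟨hc1, hc2⟩, hc⟩ := exists_hasDerivAt_eq_slope (fundSol d)
      (fun u => -u ^ (-((d : ℝ) / 2))) hlt
      (fun x hx => (hasDerivAt_fundSol d (hu.trans_le hx.1)).continuousAt.continuousWithinAt)
      (fun x hx => hasDerivAt_fundSol d (hu.trans hx.1))
    have hsub : 0 < u' - u := sub_pos.2 hlt
    have e : fundSol d u - fundSol d u' = (u' - u) * c ^ (-((d : ℝ) / 2)) := by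
      rw [eq_div_iff hsub.ne'] at hc; linarith
    have hd : -((d : ℝ) / 2) ≤ 0 := by simp; positivity
    rw [e]
    constructor
    · exact mul_le_mul_of_nonneg_left (Real.rpow_le_rpow_of_nonpos (hu.trans hc1) hc2.le hd) hsub.le
    · exact mul_le_mul_of_nonneg_left (Real.rpow_le_rpow_of_nonpos hu hc1.le hd) hsub.le

lemma fundSol_antitone (d : ℕ) {u u' : ℝ} (hu : 0 < u) (h : u ≤ u') :
    fundSol d u' ≤ fundSol d u := by
  have h1 := (fundSol_sub_bounds d hu h).1
  have h2 : 0 ≤ (u' - u) * u' ^ (-((d : ℝ) / 2)) :=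
    mul_nonneg (sub_nonneg.2 h) (Real.rpow_nonneg (hu.le.trans h) _)
  linarith

/-- The third order Taylor expansion of the fundamental solution, uniformly in scale. -/
lemma exists_taylor_fundSol (d : ℕ) :
    ∃ C : ℝ, 0 ≤ C ∧ ∀ u t : ℝ, 0 < u → |t| ≤ 1 / 2 →
      |fundSol d (u * (1 + t)) - fundSol d u + u ^ (1 - (d : ℝ) / 2) *
        (t - (d : ℝ) / 4 * t ^ 2 + (d : ℝ) / 2 * ((d : ℝ) / 2 + 1) / 6 * t ^ 3)| ≤
        u ^ (1 - (d : ℝ) / 2) * (C * t ^ 4) := by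
  obtain ⟨C, hC⟩ := exists_taylor_three (-((d : ℝ) / 2))
  have hC0 : 0 ≤ C := by
    have := (abs_nonneg _).trans (hC (1 / 2) (by norm_num [abs_of_pos]))
    by_contra hneg
    push Not at hneg
    have : C * |(1 / 2 : ℝ)| ^ 3 < 0 := mul_neg_of_neg_of_pos hneg (by positivity)
    linarith
  refine ⟨C, hC0, fun u t hu ht => ?_⟩
  have hup : 0 < u ^ (1 - (d : ℝ) / 2) := Real.rpow_pos_of_pos hu _
  have := abs_le_of_deriv_le (n := 3) (C := u ^ (1 - (d : ℝ) / 2) * C)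
    (F := fun t => fundSol d (u * (1 + t)) - fundSol d u + u ^ (1 - (d : ℝ) / 2) *
        (t - (d : ℝ) / 4 * t ^ 2 + (d : ℝ) / 2 * ((d : ℝ) / 2 + 1) / 6 * t ^ 3))
    (F' := fun t => -u ^ (1 - (d : ℝ) / 2) * ((1 + t) ^ (-((d : ℝ) / 2)) - 1 -
      -((d : ℝ) / 2) * t - -((d : ℝ) / 2) * (-((d : ℝ) / 2) - 1) / 2 * t ^ 2))
    (fun t ht => ?_) (by simp) (fun t ht => ?_) ht
  · refine this.trans (le_of_eq ?_)
    have : |t| ^ (3 + 1) = t ^ 4 := by rw [show 3 + 1 = 2 * 2 from rfl, pow_mul, sq_abs]; ring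
    rw [this]; ring
  · have hpos : 0 < 1 + t := by linarith [(abs_le.1 ht).1]
    have h1 := (hasDerivAt_fundSol d (mul_pos hu hpos)).comp t
      (((hasDerivAt_id t).const_add (1 : ℝ)).const_mul u)
    have h2 := ((((hasDerivAt_id t)).sub (((hasDerivAt_id t).pow 2).const_mul ((d : ℝ) / 4))).add
      (((hasDerivAt_id t).pow 3).const_mul ((d : ℝ) / 2 * ((d : ℝ) / 2 + 1) / 6))).const_mul
      (u ^ (1 - (d : ℝ) / 2))
    refine ((h1.sub_const (fundSol d u)).add h2).congr_deriv ?_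
    have e : (u * (1 + t)) ^ (-((d : ℝ) / 2)) * u =
        u ^ (1 - (d : ℝ) / 2) * (1 + t) ^ (-((d : ℝ) / 2)) := by
      rw [Real.mul_rpow hu.le hpos.le, sub_eq_add_neg, Real.rpow_add hu, Real.rpow_one]
      ring
    simp only [mul_one]
    rw [neg_mul (_ ^ _) u, e]
    simp only [id]
    push_cast
    ring
  · rw [abs_mul, abs_neg, abs_of_pos hup, mul_assoc]
    exact mul_le_mul_of_nonneg_left (hC t ht) hup.le

end FundamentalSolution

/-! ### The generator of the walk acting on radial functions -/

section Generator

open scoped ENNReal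

namespace LatticeWalk

variable {d : ℕ} (W : LatticeWalk d)

/-- The finite set of possible increments. -/
noncomputable def increments : Finset W.lattice := W.finite_support.toFinset

/-- The expectation of a function of one increment. -/
noncomputable def mean (f : W.lattice → ℝ) : ℝ := ∑ v ∈ W.increments, (W.p v).toReal * f v

/-- The transition operator acting on real functions. -/
noncomputable def realStep (f : W.lattice → ℝ) (x : W.lattice) : ℝ := W.mean fun v => f (x + v)

lemma mem_increments {v : W.lattice} : v ∈ W.increments ↔ W.p v ≠ 0 := by
  simp [increments, PMF.mem_support_iff]

lemma neg_mem_increments {v : W.lattice} (hv : v ∈ W.increments) : -v ∈ W.increments := by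
  rw [mem_increments, W.symm, ← mem_increments]; exact hv

lemma p_toReal_pos {v : W.lattice} (hv : v ∈ W.increments) : 0 < (W.p v).toReal :=
  ENNReal.toReal_pos (W.mem_increments.1 hv) (W.p.apply_ne_top v)

lemma sum_p_toReal : ∑ v ∈ W.increments, (W.p v).toReal = 1 := by
  rw [← ENNReal.toReal_sum fun v _ => W.p.apply_ne_top v]
  have : ∑ v ∈ W.increments, W.p v = ∑' v, W.p v := by
    rw [tsum_eq_sum]
    intro v hv
    by_contra h
    exact hv (W.mem_increments.2 h)
  rw [this, W.p.tsum_coe, ENNReal.toReal_one]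

lemma mean_const (c : ℝ) : W.mean (fun _ => c) = c := by
  rw [mean, ← Finset.sum_mul, sum_p_toReal, one_mul]

lemma mean_add (f g : W.lattice → ℝ) : W.mean (fun v => f v + g v) = W.mean f + W.mean g := by
  simp only [mean, mul_add, Finset.sum_add_distrib]

lemma mean_sub (f g : W.lattice → ℝ) : W.mean (fun v => f v - g v) = W.mean f - W.mean g := by
  simp only [mean, mul_sub, Finset.sum_sub_distrib]

lemma mean_const_mul (c : ℝ) (f : W.lattice → ℝ) : W.mean (fun v => c * f v) = c * W.mean f := by
  simp only [mean, Finset.mul_sum]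
  exact Finset.sum_congr rfl fun v _ => by ring

lemma mean_mono {f g : W.lattice → ℝ} (h : ∀ v ∈ W.increments, f v ≤ g v) :
    W.mean f ≤ W.mean g :=
  Finset.sum_le_sum fun v hv => mul_le_mul_of_nonneg_left (h v hv) ENNReal.toReal_nonneg

lemma mean_congr {f g : W.lattice → ℝ} (h : ∀ v ∈ W.increments, f v = g v) :
    W.mean f = W.mean g :=
  Finset.sum_congr rfl fun v hv => by rw [h v hv]

lemma mean_neg_arg (f : W.lattice → ℝ) : W.mean (fun v => f (-v)) = W.mean f := by
  refine Finset.sum_nbij' (fun v => -v) (fun v => -v) (fun v hv => W.neg_mem_increments hv)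
    (fun v hv => W.neg_mem_increments hv) (fun v _ => neg_neg v) (fun v _ => neg_neg v)
    (fun v _ => by rw [W.symm])

lemma mean_eq_of_symm {f g : W.lattice → ℝ} (h : ∀ v, f v + f (-v) = 2 * g v) :
    W.mean f = W.mean g := by
  have h1 := W.mean_add f (fun v => f (-v))
  rw [mean_neg_arg] at h1
  have h2 : W.mean (fun v => f v + f (-v)) = 2 * W.mean g := by
    rw [← mean_const_mul]; exact W.mean_congr fun v _ => h v
  linarith

lemma mean_coord_mul (i j : Fin d) :
    W.mean (fun v => (v : EuclideanSpace ℝ (Fin d)) i * (v : EuclideanSpace ℝ (Fin d)) j) =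
      if i = j then 1 else 0 := by
  rw [← W.covariance i j, tsum_eq_sum (s := W.increments)]
  · rfl
  · intro v hv
    have : W.p v = 0 := by
      by_contra h
      exact hv (W.mem_increments.2 h)
    simp [this]

lemma mean_inner_sq (x : EuclideanSpace ℝ (Fin d)) :
    W.mean (fun v => inner ℝ x (v : EuclideanSpace ℝ (Fin d)) ^ 2) = ‖x‖ ^ 2 := by
  have h1 : ∀ v : W.lattice, inner ℝ x (v : EuclideanSpace ℝ (Fin d)) ^ 2 =
      ∑ i, ∑ j, (x i * x j) *
        ((v : EuclideanSpace ℝ (Fin d)) i * (v : EuclideanSpace ℝ (Fin d)) j) := fun v => by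
    rw [PiLp.inner_apply, sq, Finset.sum_mul_sum]
    refine Finset.sum_congr rfl fun i _ => Finset.sum_congr rfl fun j _ => ?_
    simp only [RCLike.inner_apply, conj_trivial]; ring
  have h2 : W.mean (fun v => inner ℝ x (v : EuclideanSpace ℝ (Fin d)) ^ 2) =
      ∑ i, ∑ j, (x i * x j) * W.mean (fun v => (v : EuclideanSpace ℝ (Fin d)) i *
        (v : EuclideanSpace ℝ (Fin d)) j) := by
    simp only [h1, mean, Finset.mul_sum]
    rw [Finset.sum_comm]
    refine Finset.sum_congr rfl fun i _ => ?_
    rw [Finset.sum_comm]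
    refine Finset.sum_congr rfl fun j _ => Finset.sum_congr rfl fun v _ => by ring
  rw [h2]
  simp only [mean_coord_mul, mul_ite, mul_one, mul_zero, Finset.sum_ite_eq, Finset.mem_univ,
    if_true]
  rw [EuclideanSpace.norm_sq_eq]
  exact Finset.sum_congr rfl fun i _ => by rw [Real.norm_eq_abs, sq_abs, sq]

lemma mean_norm_sq : W.mean (fun v => ‖v‖ ^ 2) = d := by
  have h1 : ∀ v : W.lattice, ‖v‖ ^ 2 = ∑ i, (v : EuclideanSpace ℝ (Fin d)) i *
      (v : EuclideanSpace ℝ (Fin d)) i := fun v => by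
    rw [← Submodule.norm_coe, EuclideanSpace.norm_sq_eq]
    exact Finset.sum_congr rfl fun i _ => by rw [Real.norm_eq_abs, sq_abs, sq]
  have h2 : W.mean (fun v => ‖v‖ ^ 2) = ∑ i, W.mean (fun v =>
      (v : EuclideanSpace ℝ (Fin d)) i * (v : EuclideanSpace ℝ (Fin d)) i) := by
    rw [W.mean_congr fun v _ => h1 v]
    simp only [mean, Finset.mul_sum]
    rw [Finset.sum_comm]
  rw [h2]
  simp [mean_coord_mul]

lemma exists_step_bound : ∃ R : ℝ, 1 ≤ R ∧ ∀ v ∈ W.increments, ‖v‖ ≤ R := by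
  refine ⟨1 + ∑ v ∈ W.increments, ‖v‖, ?_, fun v hv => ?_⟩
  · have : 0 ≤ ∑ v ∈ W.increments, ‖v‖ := Finset.sum_nonneg fun v _ => norm_nonneg v
    linarith
  · have := Finset.single_le_sum (f := fun v : W.lattice => ‖v‖) (fun v _ => norm_nonneg v) hv
    linarith

/-- A bound on the length of the increments. -/
noncomputable def stepBound : ℝ := W.exists_step_bound.choose

lemma one_le_stepBound : 1 ≤ W.stepBound := W.exists_step_bound.choose_spec.1

lemma norm_le_stepBound {v : W.lattice} (hv : v ∈ W.increments) : ‖v‖ ≤ W.stepBound :=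
  W.exists_step_bound.choose_spec.2 v hv

lemma norm_add_sq' (x v : W.lattice) : ‖x + v‖ ^ 2 = ‖x‖ ^ 2 +
    2 * inner ℝ (x : EuclideanSpace ℝ (Fin d)) (v : EuclideanSpace ℝ (Fin d)) + ‖v‖ ^ 2 := by
  have := norm_add_sq_real (x : EuclideanSpace ℝ (Fin d)) (v : EuclideanSpace ℝ (Fin d))
  simpa using this

lemma abs_inner_le (x v : W.lattice) :
    |inner ℝ (x : EuclideanSpace ℝ (Fin d)) (v : EuclideanSpace ℝ (Fin d))| ≤ ‖x‖ * ‖v‖ := by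
  simpa using abs_real_inner_le_norm (x : EuclideanSpace ℝ (Fin d)) (v : EuclideanSpace ℝ (Fin d))

/-- The fundamental solution with its singularity smoothed (`0 < A`) or enlarged (`A < 0`). -/
noncomputable def barrier (A : ℝ) (x : W.lattice) : ℝ := fundSol d (‖x‖ ^ 2 + A)

/-- The generator of the walk applied to a shifted fundamental solution: the leading term vanishes
because the fundamental solution is harmonic, the odd terms vanish by symmetry, and for large `|A|`
the remaining error is dominated by the effect of the shift. -/
lemma exists_laplacian_barrier :
    ∃ C u₀ : ℝ, 0 ≤ C ∧ 1 ≤ u₀ ∧ ∀ (A : ℝ) (x : W.lattice), u₀ ≤ ‖x‖ ^ 2 + A →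
      ‖x‖ ^ 2 ≤ 2 * (‖x‖ ^ 2 + A) →
      |W.realStep (W.barrier A) x - W.barrier A x +
        d * A * (‖x‖ ^ 2 + A) ^ (-1 - (d : ℝ) / 2)| ≤ C * (‖x‖ ^ 2 + A) ^ (-1 - (d : ℝ) / 2) := by
  obtain ⟨C, hC0, hC⟩ := exists_taylor_fundSol d
  set R := W.stepBound with hR
  have hR1 : 1 ≤ R := W.one_le_stepBound
  have hR0 : 0 < R := by linarith
  set c₃ : ℝ := (d : ℝ) / 2 * ((d : ℝ) / 2 + 1) / 6 with hc₃
  have hc₃0 : 0 ≤ c₃ := by positivity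
  refine ⟨d / 4 * R ^ 4 + c₃ * (25 * R ^ 4) + C * (256 * R ^ 4), 64 * R ^ 2, by positivity,
    by nlinarith, fun A x hu hxu => ?_⟩
  set u := ‖x‖ ^ 2 + A with hudef
  have hu0 : 0 < u := lt_of_lt_of_le (by positivity) hu
  let q : W.lattice → ℝ := fun v =>
    inner ℝ (x : EuclideanSpace ℝ (Fin d)) (v : EuclideanSpace ℝ (Fin d))
  let t : W.lattice → ℝ := fun v => (2 * q v + ‖v‖ ^ 2) / u
  have hsq : Real.sqrt u ^ 2 = u := Real.sq_sqrt hu0.le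
  have hs0 : 0 < Real.sqrt u := Real.sqrt_pos.2 hu0
  have hs8 : 8 * R ≤ Real.sqrt u := Real.le_sqrt_of_sq_le (by nlinarith)
  have hx32 : ‖x‖ ≤ 3 / 2 * Real.sqrt u := by
    refine abs_le_of_sq_le_sq' ?_ (by positivity) |>.2
    nlinarith
  have hv : ∀ v ∈ W.increments, ‖v‖ ≤ R := fun v hv => W.norm_le_stepBound hv
  have hqb : ∀ v ∈ W.increments, |q v| ≤ 3 / 2 * Real.sqrt u * R := fun v hv' =>
    (W.abs_inner_le x v).trans (mul_le_mul hx32 (hv v hv') (norm_nonneg _) (by positivity))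
  have htb : ∀ v ∈ W.increments, |t v| ≤ 4 * R / Real.sqrt u := fun v hv' => by
    have h1 := hqb v hv'
    have h2 : ‖v‖ ^ 2 ≤ R ^ 2 := by gcongr; exact hv v hv'
    have h3 : |2 * q v + ‖v‖ ^ 2| ≤ 4 * R * Real.sqrt u := by
      calc |2 * q v + ‖v‖ ^ 2| ≤ |2 * q v| + |‖v‖ ^ 2| := abs_add_le _ _
        _ = 2 * |q v| + ‖v‖ ^ 2 := by rw [abs_mul, abs_of_pos two_pos, abs_of_nonneg (sq_nonneg ‖v‖)]
        _ ≤ 4 * R * Real.sqrt u := by nlinarith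
    simp only [t]
    rw [abs_div, abs_of_pos hu0, div_le_div_iff₀ hu0 hs0]
    calc |2 * q v + ‖v‖ ^ 2| * Real.sqrt u ≤ 4 * R * Real.sqrt u * Real.sqrt u := by gcongr
      _ = 4 * R * u := by rw [mul_assoc, ← sq, hsq]
  have htb2 : ∀ v ∈ W.increments, |t v| ≤ 1 / 2 := fun v hv' => by
    refine (htb v hv').trans ?_
    rw [div_le_iff₀ hs0]; linarith
  -- the moments of `t`
  have m1 : W.mean t = d / u := by
    rw [W.mean_eq_of_symm (g := fun v => u⁻¹ * ‖v‖ ^ 2), mean_const_mul, mean_norm_sq]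
    · rw [div_eq_inv_mul]
    · intro v
      simp only [t, q, NegMemClass.coe_neg, inner_neg_right, norm_neg]
      field_simp; ring
  have m2 : ∃ m : ℝ, 0 ≤ m ∧ m ≤ R ^ 4 ∧ W.mean (fun v => t v ^ 2) = (4 * ‖x‖ ^ 2 + m) / u ^ 2 := by
    refine ⟨W.mean fun v => ‖v‖ ^ 4, ?_, ?_, ?_⟩
    · rw [← W.mean_const 0]; exact W.mean_mono fun v _ => by positivity
    · rw [← W.mean_const (R ^ 4)]
      exact W.mean_mono fun v hv' => by gcongr; exact hv v hv'
    · have e := W.mean_inner_sq (x : EuclideanSpace ℝ (Fin d))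
      rw [Submodule.norm_coe] at e
      rw [W.mean_eq_of_symm (g := fun v => (u ^ 2)⁻¹ * (4 * q v ^ 2 + ‖v‖ ^ 4)), mean_const_mul,
        mean_add, mean_const_mul, e]
      · rw [div_eq_inv_mul]
      · intro v
        simp only [t, q, NegMemClass.coe_neg, inner_neg_right, norm_neg]
        field_simp; ring
  have m3 : |W.mean (fun v => t v ^ 3)| ≤ 25 * R ^ 4 / u ^ 2 := by
    rw [W.mean_eq_of_symm (g := fun v => (u ^ 3)⁻¹ * (12 * q v ^ 2 * ‖v‖ ^ 2 + ‖v‖ ^ 6))]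
    · have hg0 : 0 ≤ W.mean fun v => (u ^ 3)⁻¹ * (12 * q v ^ 2 * ‖v‖ ^ 2 + ‖v‖ ^ 6) := by
        rw [← W.mean_const 0]; exact W.mean_mono fun v _ => by positivity
      rw [abs_of_nonneg hg0]
      have e := W.mean_inner_sq (x : EuclideanSpace ℝ (Fin d))
      rw [Submodule.norm_coe] at e
      have h1 : W.mean (fun v => (u ^ 3)⁻¹ * (12 * q v ^ 2 * ‖v‖ ^ 2 + ‖v‖ ^ 6)) ≤
          W.mean (fun v => (u ^ 3)⁻¹ * (12 * R ^ 2 * q v ^ 2 + R ^ 6)) := by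
        refine W.mean_mono fun v hv' => ?_
        have h2 : ‖v‖ ^ 2 ≤ R ^ 2 := by gcongr; exact hv v hv'
        have h6 : ‖v‖ ^ 6 ≤ R ^ 6 := by gcongr; exact hv v hv'
        have : 12 * q v ^ 2 * ‖v‖ ^ 2 ≤ 12 * R ^ 2 * q v ^ 2 := by
          nlinarith [sq_nonneg (q v)]
        gcongr
      refine h1.trans ?_
      rw [mean_const_mul, mean_add, mean_const_mul, mean_const, e]
      rw [inv_mul_le_iff₀ (by positivity)]
      have h3 : u ^ 3 * (25 * R ^ 4 / u ^ 2) = 25 * R ^ 4 * u := by field_simp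
      rw [h3]
      have hR2 : R ^ 2 ≤ R ^ 4 := pow_le_pow_right₀ hR1 (by norm_num)
      have h4 : 12 * R ^ 2 * ‖x‖ ^ 2 ≤ 24 * R ^ 4 * u := by
        calc 12 * R ^ 2 * ‖x‖ ^ 2 ≤ 12 * R ^ 4 * (2 * u) := by gcongr
          _ = _ := by ring
      have h5 : R ^ 6 ≤ R ^ 4 * u := by
        calc R ^ 6 = R ^ 4 * R ^ 2 := by ring
          _ ≤ R ^ 4 * u := by gcongr; nlinarith
      linarith
    · intro v
      simp only [t, q, NegMemClass.coe_neg, inner_neg_right, norm_neg]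
      field_simp; ring
  have hpw : u ^ (1 - (d : ℝ) / 2) = u ^ (-1 - (d : ℝ) / 2) * u ^ 2 := by
    rw [← Real.rpow_natCast u 2, ← Real.rpow_add hu0]; congr 1; push_cast; ring
  have hP : 0 < u ^ (-1 - (d : ℝ) / 2) := Real.rpow_pos_of_pos hu0 _
  set P := u ^ (-1 - (d : ℝ) / 2) with hPdef
  have hpt : ∀ v ∈ W.increments, |W.barrier A (x + v) - W.barrier A x + P * u ^ 2 *
      (t v - (d : ℝ) / 4 * t v ^ 2 + c₃ * t v ^ 3)| ≤ P * (C * (256 * R ^ 4)) := fun v hv' => by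
    have e : ‖x + v‖ ^ 2 + A = u * (1 + t v) := by
      rw [norm_add_sq']
      simp only [t, q]
      field_simp
      rw [hudef]; ring
    have := hC u (t v) hu0 (htb2 v hv')
    rw [← e, hpw] at this
    refine this.trans ?_
    rw [mul_assoc]
    refine mul_le_mul_of_nonneg_left ?_ hP.le
    have h4 : t v ^ 4 ≤ (4 * R / Real.sqrt u) ^ 4 := by
      rw [← (by decide : Even 4).pow_abs]
      gcongr
      exact htb v hv'
    have h5 : (4 * R / Real.sqrt u) ^ 4 = 256 * R ^ 4 / u ^ 2 := by
      rw [div_pow, show Real.sqrt u ^ 4 = (Real.sqrt u ^ 2) ^ 2 by ring, hsq]; ring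
    rw [h5] at h4
    calc u ^ 2 * (C * t v ^ 4) ≤ u ^ 2 * (C * (256 * R ^ 4 / u ^ 2)) := by gcongr
      _ = C * (256 * R ^ 4) := by field_simp
  have hmean : W.mean (fun v => W.barrier A (x + v) - W.barrier A x + P * u ^ 2 *
      (t v - (d : ℝ) / 4 * t v ^ 2 + c₃ * t v ^ 3)) = W.realStep (W.barrier A) x - W.barrier A x +
      P * u ^ 2 * (W.mean t - (d : ℝ) / 4 * W.mean (fun v => t v ^ 2) +
        c₃ * W.mean (fun v => t v ^ 3)) := by
    rw [mean_add, mean_sub, mean_const, mean_const_mul, mean_add, mean_sub, mean_const_mul,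
      mean_const_mul]
    rfl
  have hup := W.mean_mono fun v hv' => (abs_le.1 (hpt v hv')).2
  have hlow := W.mean_mono fun v hv' => (abs_le.1 (hpt v hv')).1
  rw [hmean, mean_const] at hup hlow
  obtain ⟨m, hm0, hmR, hm⟩ := m2
  rw [m1, hm] at hup hlow
  obtain ⟨m3a, m3b⟩ := abs_le.1 m3
  set M3 := W.mean (fun v => t v ^ 3) with hM3
  have k3 : |P * u ^ 2 * (c₃ * M3)| ≤ P * (c₃ * (25 * R ^ 4)) := by
    rw [abs_mul, abs_of_pos (by positivity), abs_mul, abs_of_nonneg hc₃0, mul_assoc]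
    refine mul_le_mul_of_nonneg_left ?_ hP.le
    calc u ^ 2 * (c₃ * |M3|) ≤ u ^ 2 * (c₃ * (25 * R ^ 4 / u ^ 2)) := by gcongr
      _ = c₃ * (25 * R ^ 4) := by field_simp
  obtain ⟨k3a, k3b⟩ := abs_le.1 k3
  have expand : P * u ^ 2 * (d / u - (d : ℝ) / 4 * ((4 * ‖x‖ ^ 2 + m) / u ^ 2) + c₃ * M3) =
      d * A * P - d / 4 * m * P + P * u ^ 2 * (c₃ * M3) := by
    have : ‖x‖ ^ 2 = u - A := by rw [hudef]; ring
    rw [this]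
    field_simp
    ring
  rw [expand] at hup hlow
  have k4 : d / 4 * m * P ≤ d / 4 * R ^ 4 * P := by gcongr
  have k5 : 0 ≤ d / 4 * m * P := by positivity
  have k7 : (d / 4 * R ^ 4 + c₃ * (25 * R ^ 4) + C * (256 * R ^ 4)) * P =
      d / 4 * R ^ 4 * P + P * (c₃ * (25 * R ^ 4)) + P * (C * (256 * R ^ 4)) := by ring
  rw [k7, abs_le]
  constructor
  · linarith
  · linarith

end LatticeWalk

end Generator

/-! ### The maximum principle and local comparison of superharmonic functions -/

section MaximumPrinciple

open scoped ENNReal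

namespace LatticeWalk

variable {d : ℕ} (W : LatticeWalk d)

lemma mem_ball {r : ℝ} {x : W.lattice} : x ∈ W.ball r ↔ ‖x‖ < r := Iff.rfl

lemma finite_setOf_norm_le (r : ℝ) : {x : W.lattice | ‖x‖ ≤ r}.Finite := by
  have := W.discrete
  have H : IsClosed (X := EuclideanSpace ℝ (Fin d)) W.lattice :=
    @AddSubgroup.isClosed_of_discrete _ _ _ _ _ W.lattice.toAddSubgroup
      (inferInstanceAs (DiscreteTopology W.lattice))
  refine ((Metric.finite_isBounded_inter_isClosed DiscreteTopology.isDiscrete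
    (Metric.isBounded_closedBall (x := (0 : EuclideanSpace ℝ (Fin d))) (r := r)) H).preimage_embedding
    (.subtype _)).subset ?_
  intro x hx
  simpa using hx

lemma finite_ball (r : ℝ) : (W.ball r).Finite :=
  (W.finite_setOf_norm_le r).subset fun x hx => (show ‖x‖ ≤ r from (W.mem_ball.1 hx).le)

lemma kernel_add (x v : W.lattice) : W.kernel x (x + v) = W.p v := by
  rw [kernel, add_sub_cancel_left]

lemma kernel_ne_zero_iff {x y : W.lattice} : W.kernel x y ≠ 0 ↔ y - x ∈ W.increments := by
  rw [mem_increments, kernel]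

lemma norm_sub_le_stepBound {x y : W.lattice} (h : W.kernel x y ≠ 0) : ‖y - x‖ ≤ W.stepBound :=
  W.norm_le_stepBound (W.kernel_ne_zero_iff.1 h)

lemma kernelStep_eq_sum (f : W.lattice → ℝ≥0∞) (x : W.lattice) :
    kernelStep W.kernel f x = ∑ v ∈ W.increments, W.p v * f (x + v) := by
  rw [kernelStep, ← (Equiv.addLeft x).tsum_eq, tsum_eq_sum (s := W.increments)]
  · simp [kernel_add]
  · intro v hv
    have : W.p v = 0 := by
      by_contra h
      exact hv (W.mem_increments.2 h)
    simp [kernel_add, this]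

lemma toReal_kernelStep {f : W.lattice → ℝ≥0∞} {x : W.lattice}
    (hf : ∀ v ∈ W.increments, f (x + v) ≠ ∞) :
    (kernelStep W.kernel f x).toReal = W.realStep (fun y => (f y).toReal) x := by
  rw [kernelStep_eq_sum, ENNReal.toReal_sum]
  · simp only [realStep, mean, ENNReal.toReal_mul]
  · exact fun v hv => ENNReal.mul_ne_top (W.p.apply_ne_top v) (hf v hv)

lemma kernelStep_ofReal {f : W.lattice → ℝ} {x : W.lattice}
    (hf : ∀ v ∈ W.increments, 0 ≤ f (x + v)) :
    kernelStep W.kernel (fun y => ENNReal.ofReal (f y)) x = ENNReal.ofReal (W.realStep f x) := by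
  rw [kernelStep_eq_sum, realStep, mean, ENNReal.ofReal_sum_of_nonneg]
  · refine Finset.sum_congr rfl fun v hv => ?_
    rw [ENNReal.ofReal_mul ENNReal.toReal_nonneg, ENNReal.ofReal_toReal (W.p.apply_ne_top v)]
  · exact fun v hv => mul_nonneg ENNReal.toReal_nonneg (hf v hv)

lemma exists_increment_ne_zero (hd : 0 < d) : ∃ v ∈ W.increments, v ≠ 0 := by
  by_contra h
  push Not at h
  have h1 := W.mean_norm_sq
  rw [W.mean_congr (g := fun _ => 0) fun v hv => by simp [h v hv], mean_const] at h1
  have : (0 : ℝ) < d := by exact_mod_cast hd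
  linarith

/-- The maximum principle: a subharmonic function on a finite set is nonpositive if it is
nonpositive on the outer boundary. -/
lemma subharmonic_le_zero (hd : 0 < d) {D : Set W.lattice} (hD : D.Finite) {g : W.lattice → ℝ}
    (hsub : ∀ x ∈ D, g x ≤ W.realStep g x)
    (hbd : ∀ x ∈ D, ∀ v ∈ W.increments, x + v ∉ D → g (x + v) ≤ 0) {x : W.lattice} (hx : x ∈ D) :
    g x ≤ 0 := by
  obtain ⟨m, hmD, hm⟩ := hD.toFinset.exists_max_image g ⟨x, hD.mem_toFinset.2 hx⟩
  simp only [Set.Finite.mem_toFinset] at hmD hm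
  refine (hm x hx).trans ?_
  by_contra hpos
  push Not at hpos
  -- among the points where the maximum is attained, consider one of maximal norm
  obtain ⟨y, hy, hynorm⟩ := (hD.toFinset.filter fun y => g y = g m).exists_max_image
    (fun y => ‖y‖) ⟨m, by simp [hmD]⟩
  simp only [Finset.mem_filter, Set.Finite.mem_toFinset] at hy hynorm
  have hle : ∀ v ∈ W.increments, g (y + v) ≤ g m := fun v hv => by
    by_cases h : y + v ∈ D
    · exact hm _ h
    · exact (hbd y hy.1 v hv h).trans hpos.le
  have heq : ∀ v ∈ W.increments, g (y + v) = g m := by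
    have h1 : W.mean (fun v => g m - g (y + v)) ≤ 0 := by
      rw [mean_sub, mean_const]
      have := hsub y hy.1
      rw [hy.2] at this
      exact sub_nonpos.2 this
    have h2 : ∀ v ∈ W.increments, 0 ≤ (W.p v).toReal * (g m - g (y + v)) := fun v hv =>
      mul_nonneg ENNReal.toReal_nonneg (sub_nonneg.2 (hle v hv))
    have h3 := (Finset.sum_eq_zero_iff_of_nonneg h2).1 (le_antisymm h1 (Finset.sum_nonneg h2))
    intro v hv
    have := (mul_eq_zero.1 (h3 v hv)).resolve_left (W.p_toReal_pos hv).ne'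
    linarith
  have hmemD : ∀ v ∈ W.increments, y + v ∈ D := fun v hv => by
    by_contra h
    have := hbd y hy.1 v hv h
    rw [heq v hv] at this
    linarith
  obtain ⟨v, hv, hv0⟩ := W.exists_increment_ne_zero hd
  have hnv := W.neg_mem_increments hv
  have h1 := hynorm _ ⟨hmemD v hv, heq v hv⟩
  have h2 := hynorm _ ⟨hmemD _ hnv, heq _ hnv⟩
  have h3 := W.norm_add_sq' y v
  have h4 := W.norm_add_sq' y (-v)
  simp only [NegMemClass.coe_neg, inner_neg_right, norm_neg] at h4
  have hvpos : 0 < ‖v‖ := norm_pos_iff.2 hv0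
  have h5 : ‖y + v‖ ^ 2 ≤ ‖y‖ ^ 2 := by gcongr
  have h6 : ‖y + -v‖ ^ 2 ≤ ‖y‖ ^ 2 := by gcongr
  nlinarith

lemma realStep_sub (f g : W.lattice → ℝ) (x : W.lattice) :
    W.realStep (fun y => f y - g y) x = W.realStep f x - W.realStep g x :=
  W.mean_sub _ _

lemma realStep_const (c : ℝ) (x : W.lattice) : W.realStep (fun _ => c) x = c := W.mean_const c

lemma realStep_const_mul (c : ℝ) (f : W.lattice → ℝ) (x : W.lattice) :
    W.realStep (fun y => c * f y) x = c * W.realStep f x := W.mean_const_mul c _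

/-- The walk leaves finite sets almost surely. -/
lemma exit_eq_one_of_finite (hd : 0 < d) {D : Set W.lattice} (hD : D.Finite) (x : W.lattice) :
    potential W.kernel D (Dᶜ.indicator 1) x = 1 := by
  have hle := exit_le_one W.tsum_kernel D
  by_cases hx : x ∈ D
  · refine le_antisymm (hle x) ?_
    have hfin : ∀ y, potential W.kernel D (Dᶜ.indicator 1) y ≠ ∞ := fun y =>
      ne_top_of_le_ne_top ENNReal.one_ne_top (hle y)
    have := W.subharmonic_le_zero hd hD
      (g := fun y => 1 - (potential W.kernel D (Dᶜ.indicator 1) y).toReal) (fun y hy => ?_)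
      (fun y _ v _ hyv => ?_) hx
    · rw [← ENNReal.toReal_le_toReal ENNReal.one_ne_top (hfin x), ENNReal.toReal_one]
      linarith
    · rw [realStep_sub, realStep_const, ← toReal_kernelStep W fun v _ => hfin _,
        potential_of_mem _ hy]
      simp [hy]
    · rw [potential_of_notMem _ hyv]
      simp [hyv]
  · rw [potential_of_notMem _ hx]
    simp [hx]

lemma green_ne_top_of_finite (hd : 0 < d) {D : Set W.lattice} (hD : D.Finite) (x : W.lattice)
    {y : W.lattice} (hy : y ∈ D) : green W.kernel D x y ≠ ∞ :=
  green_ne_top W.tsum_kernel x hy (green_self_ne_top W.tsum_kernel hy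
    (by rw [W.exit_eq_one_of_finite hd hD]; exact one_ne_zero))

/-- Nonnegative functions superharmonic near `z` satisfy a one-sided Harnack inequality there, with
constants not depending on `z`. -/
lemma exists_local_comparison (r : ℝ) :
    ∃ (ρ : ℝ) (c : ℝ≥0∞), c ≠ 0 ∧ ∀ (z : W.lattice) (u : W.lattice → ℝ≥0∞),
      (∀ y, ‖y - z‖ < ρ → kernelStep W.kernel u y ≤ u y) → ∀ x, ‖x - z‖ < r → c * u z ≤ u x := by
  let Q : W.lattice → Prop := fun x => ∃ (ρ : ℝ) (c : ℝ≥0∞), c ≠ 0 ∧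
    ∀ (z : W.lattice) (u : W.lattice → ℝ≥0∞),
      (∀ y, ‖y - z‖ < ρ → kernelStep W.kernel u y ≤ u y) → c * u z ≤ u (z + x)
  have hgen : ∀ v ∈ W.p.support, Q v := fun v hv => by
    refine ⟨‖v‖ + 1, W.p v, (PMF.mem_support_iff _ _).1 hv, fun z u hu => ?_⟩
    refine le_trans ?_ (hu (z + v) (by simp))
    have hk : W.kernel (z + v) z = W.p v := by rw [W.kernel_symm, W.kernel_add]
    rw [← hk]
    exact ENNReal.le_tsum (f := fun y => W.kernel (z + v) y * u y) z
  have hzero : Q 0 := ⟨0, 1, one_ne_zero, fun z u _ => by simp⟩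
  have hadd : ∀ x y, Q x → Q y → Q (x + y) := by
    rintro x y ⟨ρ₁, c₁, hc₁, h₁⟩ ⟨ρ₂, c₂, hc₂, h₂⟩
    refine ⟨max ρ₁ (‖x‖ + ρ₂), c₂ * c₁, mul_ne_zero hc₂ hc₁, fun z u hu => ?_⟩
    have e1 := h₁ z u fun y hy => hu y (lt_max_of_lt_left hy)
    have e2 := h₂ (z + x) u fun y hy => hu y (lt_max_of_lt_right (by
      have : y - z = (y - (z + x)) + x := by abel
      rw [this]
      linarith [norm_add_le (y - (z + x)) x]))
    rw [← add_assoc]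
    refine le_trans ?_ e2
    rw [mul_assoc]
    gcongr
  have hQ : ∀ x : W.lattice, Q x ∧ Q (-x) := fun x => by
    have hx : x ∈ AddSubgroup.closure W.p.support := by rw [W.irreducible]; trivial
    induction hx using AddSubgroup.closure_induction with
    | mem v hv =>
      refine ⟨hgen v hv, hgen (-v) ?_⟩
      rw [PMF.mem_support_iff, W.symm]; exact (PMF.mem_support_iff _ _).1 hv
    | zero => exact ⟨hzero, by rw [neg_zero]; exact hzero⟩
    | add x y _ _ hx hy =>
      exact ⟨hadd _ _ hx.1 hy.1, by rw [neg_add]; exact hadd _ _ hx.2 hy.2⟩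
    | neg x _ hx => exact ⟨hx.2, by rw [neg_neg]; exact hx.1⟩
  choose ρ c hc h using fun x => (hQ x).1
  let s := (W.finite_ball r).toFinset
  refine ⟨∑ x ∈ s, |ρ x|, s.inf c, ?_, fun z u hu x hx => ?_⟩
  · rw [← pos_iff_ne_zero, Finset.lt_inf_iff (by simp)]
    exact fun x _ => pos_iff_ne_zero.2 (hc x)
  · have hxs : x - z ∈ s := (Set.Finite.mem_toFinset _).2 (W.mem_ball.2 hx)
    have := h (x - z) z u fun y hy => hu y (hy.trans_le ((le_abs_self _).trans
      (Finset.single_le_sum (f := fun x => |ρ x|) (fun _ _ => abs_nonneg _) hxs)))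
    rw [add_sub_cancel] at this
    refine le_trans ?_ this
    gcongr
    exact Finset.inf_le hxs

lemma summable_barrier_weight {A : ℝ} (hA : 1 ≤ A) :
    Summable fun x : W.lattice => (‖x‖ ^ 2 + A) ^ (-1 - (d : ℝ) / 2) := by
  have := W.discrete
  have := W.isZLattice
  have hrank : Module.finrank ℤ W.lattice = d := by
    rw [ZLattice.rank ℝ W.lattice, finrank_euclideanSpace_fin]
  have h1 : Summable fun x : W.lattice => ‖x‖ ^ (-2 - (d : ℝ)) :=
    ZLattice.summable_norm_rpow W.lattice _ (by rw [hrank]; linarith)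
  have h2 : Summable fun x : W.lattice => if x = 0 then (1 : ℝ) else 0 :=
    summable_of_ne_finset_zero (s := {0}) fun x hx => by
      rw [if_neg (by simpa using hx)]
  have hneg : -1 - (d : ℝ) / 2 ≤ 0 := by
    have : (0 : ℝ) ≤ d := Nat.cast_nonneg d
    linarith
  refine Summable.of_nonneg_of_le (fun x => by positivity) (fun x => ?_) (h1.add h2)
  by_cases hx : x = 0
  · subst hx
    have : ((‖(0 : W.lattice)‖ ^ 2 + A) ^ (-1 - (d : ℝ) / 2)) ≤ 1 :=
      Real.rpow_le_one_of_one_le_of_nonpos (by simpa using hA) hneg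
    have h0 : 0 ≤ ‖(0 : W.lattice)‖ ^ (-2 - (d : ℝ)) := by positivity
    simp only [if_true]
    linarith
  · have hpos : 0 < ‖x‖ := norm_pos_iff.2 hx
    rw [if_neg hx, add_zero]
    calc (‖x‖ ^ 2 + A) ^ (-1 - (d : ℝ) / 2) ≤ (‖x‖ ^ 2) ^ (-1 - (d : ℝ) / 2) :=
          Real.rpow_le_rpow_of_nonpos (by positivity) (by linarith) hneg
      _ = ‖x‖ ^ (-2 - (d : ℝ)) := by
          rw [← Real.rpow_natCast ‖x‖ 2, ← Real.rpow_mul hpos.le]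
          congr 1; push_cast; ring

/-- Suitable shifts of the fundamental solution are superharmonic everywhere, respectively
subharmonic far from the origin. -/
lemma exists_barrier (hd : 2 ≤ d) :
    ∃ A C : ℝ, 1 ≤ A ∧ 0 ≤ C ∧
      (∀ x, W.realStep (W.barrier A) x + (‖x‖ ^ 2 + A) ^ (-1 - (d : ℝ) / 2) ≤ W.barrier A x) ∧
      (∀ x, W.barrier A x ≤
        W.realStep (W.barrier A) x + C * (‖x‖ ^ 2 + A) ^ (-1 - (d : ℝ) / 2)) ∧
      (∀ x, 4 * A ≤ ‖x‖ ^ 2 → W.barrier (-A) x ≤ W.realStep (W.barrier (-A)) x) := by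
  obtain ⟨C, u₀, hC, hu₀, h⟩ := W.exists_laplacian_barrier
  have hd' : (2 : ℝ) ≤ d := by exact_mod_cast hd
  set A := C + u₀ + 1 with hA
  have hA1 : 1 ≤ A := by linarith
  have hdA : C + 1 ≤ d * A := by nlinarith
  refine ⟨A, C + d * A, hA1, by positivity, fun x => ?_, fun x => ?_, fun x hx => ?_⟩
  · have hpos : 0 < ‖x‖ ^ 2 + A := by positivity
    have h1 := (abs_le.1 (h A x (by nlinarith [sq_nonneg ‖x‖]) (by nlinarith [sq_nonneg ‖x‖]))).2
    have hP := Real.rpow_pos_of_pos hpos (-1 - (d : ℝ) / 2)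
    nlinarith
  · have hpos : 0 < ‖x‖ ^ 2 + A := by positivity
    have h1 := (abs_le.1 (h A x (by nlinarith [sq_nonneg ‖x‖]) (by nlinarith [sq_nonneg ‖x‖]))).1
    linarith
  · have hpos : 0 < ‖x‖ ^ 2 + -A := by linarith
    have h1 := (abs_le.1 (h (-A) x (by linarith) (by linarith))).1
    have hP := Real.rpow_pos_of_pos hpos (-1 - (d : ℝ) / 2)
    nlinarith

end LatticeWalk

end MaximumPrinciple

/-! ### Bounds on the Green's function of a ball -/

section GreenBounds

open scoped ENNReal

namespace LatticeWalk

variable {d : ℕ} (W : LatticeWalk d)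

/-- The order of magnitude `r ^ (2 - d)` of the Green's function at distance `r`. -/
noncomputable def greenScale (d : ℕ) (r : ℝ) : ℝ := r ^ 2 * (r ^ 2) ^ (-((d : ℝ) / 2))

lemma mul_sq_rpow {c r : ℝ} (hc : 0 ≤ c) (e : ℝ) :
    (c * r ^ 2) ^ e = c ^ e * (r ^ 2) ^ e := Real.mul_rpow hc (sq_nonneg r)

/-- An upper bound for the Green's function of a set contained in a ball: it is at most a multiple of
the superharmonic barrier, shifted to be nonnegative where the walk leaves the ball. -/
lemma exists_green_le (hd : 2 ≤ d) :
    ∃ C : ℝ, 0 < C ∧ ∀ r : ℝ, W.stepBound ≤ r → ∀ B : Set W.lattice, B ⊆ W.ball (6 * r) → 0 ∈ B →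
      ∀ x, r / 2 ≤ ‖x‖ → green W.kernel B x 0 ≤ ENNReal.ofReal (C * greenScale d r) := by
  obtain ⟨A, -, hA, -, hsup, -, -⟩ := W.exists_barrier hd
  set ρ := A ^ (-1 - (d : ℝ) / 2) with hρ
  have hA0 : 0 < A := by linarith
  have hρ0 : 0 < ρ := Real.rpow_pos_of_pos hA0 _
  refine ⟨ρ⁻¹ * ((49 + A) * (1 / 4) ^ (-((d : ℝ) / 2))), by positivity,
    fun r hr B hB h0 x hx => ?_⟩
  have hr1 : 1 ≤ r := W.one_le_stepBound.trans hr
  by_cases hxB : x ∈ B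
  swap
  · rw [green_of_notMem _ hxB h0]; exact zero_le
  set m := fundSol d ((7 * r) ^ 2 + A) with hm
  have hbd : ∀ y ∈ B, ∀ v ∈ W.increments, 0 ≤ ρ⁻¹ * (W.barrier A (y + v) - m) :=
    fun y hy v hv => by
      refine mul_nonneg (inv_nonneg.2 hρ0.le) (sub_nonneg.2 ?_)
      refine fundSol_antitone d (by positivity) ?_
      have h1 : ‖y‖ < 6 * r := hB hy
      have h2 := W.norm_le_stepBound hv
      have h3 := norm_add_le y v
      have : ‖y + v‖ ≤ 7 * r := by linarith
      gcongr
  have hle := potential_le W.kernel (D := B) (φ := pointCharge 0)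
    (v := fun y => ENNReal.ofReal (ρ⁻¹ * (W.barrier A y - m))) (fun y => ?_) x
  · refine hle.trans (ENNReal.ofReal_le_ofReal ?_)
    rw [mul_assoc]
    refine mul_le_mul_of_nonneg_left ?_ (inv_nonneg.2 hρ0.le)
    have hx7 : ‖x‖ ≤ 7 * r := by linarith [W.mem_ball.1 (hB hxB)]
    have hxpos : 0 < ‖x‖ := by linarith
    have h1 := (fundSol_sub_bounds d (u := ‖x‖ ^ 2 + A) (u' := (7 * r) ^ 2 + A) (by positivity)
      (by gcongr)).2
    refine h1.trans ?_
    have h2 : (‖x‖ ^ 2 + A) ^ (-((d : ℝ) / 2)) ≤ (1 / 4 * r ^ 2) ^ (-((d : ℝ) / 2)) := by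
      refine Real.rpow_le_rpow_of_nonpos (by positivity) ?_ (by simp; positivity)
      nlinarith
    have h3 : (7 * r) ^ 2 + A - (‖x‖ ^ 2 + A) ≤ (49 + A) * r ^ 2 := by nlinarith [sq_nonneg ‖x‖]
    calc _ ≤ (49 + A) * r ^ 2 * (1 / 4 * r ^ 2) ^ (-((d : ℝ) / 2)) := by gcongr
      _ = _ := by rw [mul_sq_rpow (by norm_num), greenScale]; ring
  · by_cases hy : y ∈ B
    · rw [Set.indicator_of_mem hy, kernelStep_ofReal W (hbd y hy), realStep_const_mul, realStep_sub,
        realStep_const]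
      have h1 := hsup y
      have hst : 0 ≤ ρ⁻¹ * (W.realStep (W.barrier A) y - m) := by
        have := W.mean_mono (hbd y hy)
        rw [mean_const, mean_const_mul, mean_sub, mean_const] at this
        exact this
      by_cases hy0 : y = 0
      · subst hy0
        rw [pointCharge_self, ← ENNReal.ofReal_one, ← ENNReal.ofReal_add zero_le_one hst]
        refine ENNReal.ofReal_le_ofReal ?_
        rw [norm_zero, zero_pow two_ne_zero, zero_add, ← hρ] at h1
        have : 1 = ρ⁻¹ * ρ := (inv_mul_cancel₀ hρ0.ne').symm
        calc 1 + ρ⁻¹ * (W.realStep (W.barrier A) 0 - m) =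
              ρ⁻¹ * (W.realStep (W.barrier A) 0 + ρ - m) := by rw [this]; ring
          _ ≤ _ := by gcongr
      · rw [pointCharge_of_ne hy0, zero_add]
        refine ENNReal.ofReal_le_ofReal ?_
        have : 0 ≤ (‖y‖ ^ 2 + A) ^ (-1 - (d : ℝ) / 2) := by positivity
        gcongr
        linarith
    · rw [Set.indicator_of_notMem hy, add_zero, pointCharge_of_ne]
      · exact zero_le
      · rintro rfl; exact hy h0

/-- A lower bound for the Green's function at its pole. The barrier is dominated by the Green's
potential of its own Laplacian, and this potential at the origin is at most a multiple of
`G_B(0, 0)`, since the Laplacian is summable. -/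
lemma exists_le_green_self (hd : 2 ≤ d) {A C : ℝ} (hA : 1 ≤ A) (hC : 0 ≤ C)
    (hsub : ∀ x, W.barrier A x ≤
        W.realStep (W.barrier A) x + C * (‖x‖ ^ 2 + A) ^ (-1 - (d : ℝ) / 2)) :
    ∃ c : ℝ, 0 < c ∧ ∀ r : ℝ, 0 < r →
      c * (fundSol d A - fundSol d (r ^ 2 + A)) ≤ (green W.kernel (W.ball r) 0 0).toReal := by
  have hA0 : 0 < A := by linarith
  let w : W.lattice → ℝ := fun x => C * (‖x‖ ^ 2 + A) ^ (-1 - (d : ℝ) / 2)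
  have hw0 : ∀ x, 0 ≤ w x := fun x => by positivity
  have hsum : Summable w := (W.summable_barrier_weight hA).mul_left C
  set S := ∑' x, w x with hS
  have hS0 : 0 ≤ S := tsum_nonneg hw0
  refine ⟨(S + 1)⁻¹, by positivity, fun r hr => ?_⟩
  set B := W.ball r with hB
  have hBfin : B.Finite := W.finite_ball r
  have h0B : (0 : W.lattice) ∈ B := by simpa [hB, mem_ball] using hr
  have hd0 : 0 < d := by omega
  have hgfin : ∀ x y, y ∈ B → green W.kernel B x y ≠ ∞ := fun x y hy =>
    W.green_ne_top_of_finite hd0 hBfin x hy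
  let φ : W.lattice → ℝ≥0∞ := B.indicator fun y => ENNReal.ofReal (w y)
  have hpot : ∀ x, potential W.kernel B φ x =
      ∑ y ∈ hBfin.toFinset, ENNReal.ofReal (w y) * green W.kernel B x y := fun x => by
    rw [potential_eq_tsum_green, tsum_eq_sum (s := hBfin.toFinset)]
    · refine Finset.sum_congr rfl fun y hy => ?_
      simp only [φ]
      rw [Set.indicator_of_mem (hBfin.mem_toFinset.1 hy)]
    · intro y hy
      simp only [φ]
      rw [Set.indicator_of_notMem (by simpa using hy), zero_mul]
  have hpfin : ∀ x, potential W.kernel B φ x ≠ ∞ := fun x => by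
    rw [hpot]
    exact ENNReal.sum_ne_top.2 fun y hy => ENNReal.mul_ne_top ENNReal.ofReal_ne_top
      (hgfin x y (hBfin.mem_toFinset.1 hy))
  set m := fundSol d (r ^ 2 + A) with hm
  have hmax := W.subharmonic_le_zero hd0 hBfin
    (g := fun x => W.barrier A x - m - (potential W.kernel B φ x).toReal) (fun x hx => ?_)
    (fun x hx v hv hxv => ?_) h0B
  · have h1 : (potential W.kernel B φ 0).toReal ≤ S * (green W.kernel B 0 0).toReal := by
      rw [hpot, ENNReal.toReal_sum fun y hy => ENNReal.mul_ne_top ENNReal.ofReal_ne_top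
        (hgfin 0 y (hBfin.mem_toFinset.1 hy))]
      calc _ ≤ ∑ y ∈ hBfin.toFinset, w y * (green W.kernel B 0 0).toReal := by
            refine Finset.sum_le_sum fun y hy => ?_
            have hyB := hBfin.mem_toFinset.1 hy
            rw [ENNReal.toReal_mul, ENNReal.toReal_ofReal (hw0 y)]
            refine mul_le_mul_of_nonneg_left ?_ (hw0 y)
            refine ENNReal.toReal_mono (hgfin 0 0 h0B) ?_
            rw [green_symm _ W.kernel_symm h0B hyB]
            exact green_le_green_self _ W.tsum_kernel y h0B
        _ ≤ _ := by
            rw [← Finset.sum_mul]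
            gcongr
            exact hsum.sum_le_tsum _ fun y _ => hw0 y
    have h2 : W.barrier A 0 = fundSol d A := by simp [barrier]
    rw [h2] at hmax
    rw [inv_mul_le_iff₀ (by positivity)]
    have : 0 ≤ (green W.kernel B 0 0).toReal := ENNReal.toReal_nonneg
    linarith
  · have hst : W.realStep (fun x => W.barrier A x - m - (potential W.kernel B φ x).toReal) x =
        W.realStep (W.barrier A) x - m - (kernelStep W.kernel (potential W.kernel B φ) x).toReal := by
      rw [toReal_kernelStep W fun v _ => hpfin _, realStep_sub, realStep_sub, realStep_const]
    rw [hst]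
    have e := potential_of_mem W.kernel (φ := φ) hx
    have hkfin : kernelStep W.kernel (potential W.kernel B φ) x ≠ ∞ := by
      refine ne_top_of_le_ne_top (hpfin x) ?_
      rw [e]; exact le_add_self
    have hφ : φ x = ENNReal.ofReal (w x) := Set.indicator_of_mem hx _
    rw [e, hφ, ENNReal.toReal_add ENNReal.ofReal_ne_top hkfin, ENNReal.toReal_ofReal (hw0 x)]
    have := hsub x
    simp only [w]
    linarith
  · have h1 : W.barrier A (x + v) ≤ m := by
      refine fundSol_antitone d (by positivity) ?_
      have : r ≤ ‖x + v‖ := not_lt.1 fun h => hxv h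
      gcongr
    have : 0 ≤ (potential W.kernel B φ (x + v)).toReal := ENNReal.toReal_nonneg
    linarith

lemma le_sq_sub_of_two_mul_le {A s : ℝ} (hA : 1 ≤ A) (h : 2 * A ≤ s) : A ≤ s ^ 2 + -A := by
  nlinarith

set_option maxHeartbeats 1000000 in
/-- A lower bound for the Green's function of a set containing a ball. Near the pole it follows from
the value at the pole by local comparison, and elsewhere by comparison with a multiple of the
subharmonic barrier. -/
lemma exists_le_green (hd : 2 ≤ d) :
    ∃ c r₀ : ℝ, 0 < c ∧ 1 ≤ r₀ ∧ ∀ r : ℝ, r₀ ≤ r → ∀ B : Set W.lattice, W.ball (4 * r) ⊆ B →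
      ∀ x, ‖x‖ ≤ 3 * r → ENNReal.ofReal (c * greenScale d r) ≤ green W.kernel B x 0 := by
  obtain ⟨A, C, hA, hC, -, hsub, hsub'⟩ := W.exists_barrier hd
  obtain ⟨c₁, hc₁, h₁⟩ := W.exists_le_green_self hd hA hC hsub
  have hA0 : 0 < A := by linarith
  have hR := W.one_le_stepBound
  set r₁ := 2 * A + W.stepBound with hr₁
  obtain ⟨ρ, c₂', hc₂', h₂⟩ := W.exists_local_comparison r₁
  obtain ⟨c₂, hc₂, hc₂le⟩ : ∃ c₂ : ℝ, 0 < c₂ ∧ ENNReal.ofReal c₂ ≤ c₂' := by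
    refine ⟨(min c₂' 1).toReal, ENNReal.toReal_pos ?_ ?_, ?_⟩
    · exact (lt_min (pos_iff_ne_zero.2 hc₂') one_pos).ne'
    · exact ne_top_of_le_ne_top ENNReal.one_ne_top (min_le_right _ _)
    · rw [ENNReal.ofReal_toReal (ne_top_of_le_ne_top ENNReal.one_ne_top (min_le_right _ _))]
      exact min_le_left _ _
  set c₃ := c₂ * c₁ with hc₃
  have hc₃0 : 0 < c₃ := mul_pos hc₂ hc₁
  have hd0 : 0 < d := by omega
  have hneg : -((d : ℝ) / 2) ≤ 0 := by simp; positivity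
  refine ⟨c₃ * (7 * 17 ^ (-((d : ℝ) / 2))), max (max 1 (r₁ + A)) (|ρ| + r₁), by positivity,
    le_max_of_le_left (le_max_left _ _), fun r hr B' hB' x hx => ?_⟩
  have hr1 : 1 ≤ r := (le_max_left _ _).trans ((le_max_left _ _).trans hr)
  have hrA : r₁ + A ≤ r := (le_max_right _ _).trans ((le_max_left _ _).trans hr)
  have hrρ : |ρ| + r₁ ≤ r := (le_max_right _ _).trans hr
  refine le_trans ?_ (potential_mono_set W.kernel hB' _ _)
  set B := W.ball (4 * r) with hB
  have hBfin : B.Finite := W.finite_ball _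
  have h0B : (0 : W.lattice) ∈ B := by simp [hB, mem_ball]; linarith
  have hgfin : ∀ x, green W.kernel B x 0 ≠ ∞ := fun x => W.green_ne_top_of_finite hd0 hBfin x h0B
  let g : W.lattice → ℝ := fun x => (green W.kernel B x 0).toReal
  change ENNReal.ofReal _ ≤ green W.kernel B x 0
  rw [← ENNReal.ofReal_toReal (hgfin x)]
  refine ENNReal.ofReal_le_ofReal ?_
  have hg0 : c₁ * (fundSol d A - fundSol d (16 * r ^ 2 + A)) ≤ g 0 := by
    have := h₁ (4 * r) (by linarith)
    rw [show (4 * r) ^ 2 = 16 * r ^ 2 by ring] at this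
    exact this
  have hAsq : r ≤ r ^ 2 := by nlinarith
  have hAr : A ≤ r := by linarith
  -- near the pole
  have hnear : ∀ y : W.lattice, ‖y‖ < r₁ →
      c₃ * (fundSol d A - fundSol d (16 * r ^ 2 + A)) ≤ g y := fun y hy => by
    have h3 := h₂ 0 (fun y => green W.kernel B y 0) (fun y hy => ?_) y (by simpa using hy)
    · have h4 : ENNReal.ofReal c₂ * green W.kernel B 0 0 ≤ green W.kernel B y 0 :=
        le_trans (by gcongr) h3
      have h5 := ENNReal.toReal_mono (hgfin y) h4
      rw [ENNReal.toReal_mul, ENNReal.toReal_ofReal hc₂.le] at h5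
      rw [hc₃, mul_assoc]
      exact (mul_le_mul_of_nonneg_left hg0 hc₂.le).trans h5
    · have hyB : y ∈ B := by
        rw [sub_zero] at hy
        rw [hB, mem_ball]
        have := le_abs_self ρ
        have : 0 ≤ r₁ := by positivity
        linarith
      change _ ≤ potential _ _ _ _
      rw [potential_of_mem W.kernel hyB]
      exact le_add_self
  have hpos16 : 0 < 16 * r ^ 2 + -A := by linarith
  have hmono : fundSol d (16 * r ^ 2 + A) ≤ fundSol d (16 * r ^ 2 + -A) :=
    fundSol_antitone d hpos16 (by linarith)
  have hscale : greenScale d r = r ^ 2 * (r ^ 2) ^ (-((d : ℝ) / 2)) := rfl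
  by_cases hx1 : ‖x‖ < r₁
  · refine le_trans ?_ (hnear x hx1)
    rw [mul_assoc]
    refine mul_le_mul_of_nonneg_left ?_ hc₃0.le
    refine le_trans ?_ (fundSol_sub_bounds d (u := A) (u' := 16 * r ^ 2 + A) hA0 (by nlinarith)).1
    have h6 : (17 * r ^ 2) ^ (-((d : ℝ) / 2)) ≤ (16 * r ^ 2 + A) ^ (-((d : ℝ) / 2)) :=
      Real.rpow_le_rpow_of_nonpos (by positivity) (by nlinarith) hneg
    rw [mul_sq_rpow (by norm_num)] at h6
    rw [hscale]
    calc _ = 7 * r ^ 2 * ((17 : ℝ) ^ (-((d : ℝ) / 2)) * (r ^ 2) ^ (-((d : ℝ) / 2))) := by ring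
      _ ≤ _ := by
        refine mul_le_mul ?_ h6 (by positivity) (by nlinarith)
        nlinarith
  · push Not at hx1
    have hxB : x ∈ B := by rw [hB, mem_ball]; linarith
    have hmax := W.subharmonic_le_zero hd0 (D := B \ W.ball r₁) (hBfin.subset Set.sdiff_subset)
      (g := fun y => c₃ * (W.barrier (-A) y - fundSol d (16 * r ^ 2 + -A)) - g y)
      (fun y hy => ?_) (fun y hy v hv hyv => ?_) (x := x) ⟨hxB, fun h => absurd h hx1.not_gt⟩
    · have h7 : c₃ * (W.barrier (-A) x - fundSol d (16 * r ^ 2 + -A)) ≤ g x := by linarith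
      refine le_trans ?_ h7
      rw [mul_assoc]
      refine mul_le_mul_of_nonneg_left ?_ hc₃0.le
      have hxA : A < ‖x‖ ^ 2 := by nlinarith
      refine le_trans ?_ (fundSol_sub_bounds d (u := ‖x‖ ^ 2 + -A) (u' := 16 * r ^ 2 + -A)
        (by linarith) (by nlinarith [norm_nonneg x])).1
      have h6 : (17 * r ^ 2) ^ (-((d : ℝ) / 2)) ≤ (16 * r ^ 2 + -A) ^ (-((d : ℝ) / 2)) :=
        Real.rpow_le_rpow_of_nonpos (by nlinarith) (by nlinarith) hneg
      rw [mul_sq_rpow (by norm_num)] at h6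
      rw [hscale]
      calc _ = 7 * r ^ 2 * ((17 : ℝ) ^ (-((d : ℝ) / 2)) * (r ^ 2) ^ (-((d : ℝ) / 2))) := by ring
        _ ≤ _ := by
          refine mul_le_mul ?_ h6 (by positivity) ?_
          · nlinarith [norm_nonneg x]
          · nlinarith [norm_nonneg x]
    · have hyn : r₁ ≤ ‖y‖ := not_lt.1 fun h => hy.2 h
      have hg : W.realStep g y ≤ g y := by
        have e := W.toReal_kernelStep (f := fun y => green W.kernel B y 0) (x := y)
          (fun v _ => hgfin _)
        change W.realStep (fun y => (green W.kernel B y 0).toReal) y ≤ _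
        rw [← e]
        refine ENNReal.toReal_mono (hgfin y) ?_
        conv_rhs => rw [green, potential_of_mem W.kernel hy.1]
        exact le_add_self
      rw [realStep_sub, realStep_const_mul, realStep_sub, realStep_const]
      have := hsub' y (by nlinarith)
      have := mul_le_mul_of_nonneg_left this hc₃0.le
      linarith
    · by_cases hyB : y + v ∈ B
      · have hyr : ‖y + v‖ < r₁ := by
          by_contra h
          exact hyv ⟨hyB, h⟩
        have hyn : r₁ ≤ ‖y‖ := not_lt.1 fun h => hy.2 h
        have hv' := W.norm_le_stepBound hv
        have h8 : 2 * A ≤ ‖y + v‖ := by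
          have := norm_sub_le (y + v) v
          rw [add_sub_cancel_right] at this
          linarith
        have h9 : W.barrier (-A) (y + v) ≤ fundSol d A := fundSol_antitone d hA0
          (le_sq_sub_of_two_mul_le hA h8)
        have h10 := hnear _ hyr
        have h11 : c₃ * (W.barrier (-A) (y + v) - fundSol d (16 * r ^ 2 + -A)) ≤
            c₃ * (fundSol d A - fundSol d (16 * r ^ 2 + A)) := by gcongr
        linarith
      · have h8 : 4 * r ≤ ‖y + v‖ := not_lt.1 fun h => hyB h
        have h9 : W.barrier (-A) (y + v) ≤ fundSol d (16 * r ^ 2 + -A) :=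
          fundSol_antitone d hpos16 (by
            have : (4 * r) ^ 2 ≤ ‖y + v‖ ^ 2 := by gcongr
            linarith)
        have h10 : 0 ≤ g (y + v) := ENNReal.toReal_nonneg
        have h11 : c₃ * (W.barrier (-A) (y + v) - fundSol d (16 * r ^ 2 + -A)) ≤ 0 :=
          mul_nonpos_of_nonneg_of_nonpos hc₃0.le (by linarith)
        linarith

end LatticeWalk

end GreenBounds

/-! ### The Harnack inequality -/

section Harnack

open scoped ENNReal

namespace LatticeWalk

variable {d : ℕ} (W : LatticeWalk d)

/-- The ball of radius `r` around a lattice point `a`. -/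
def ballAt (a : W.lattice) (r : ℝ) : Set W.lattice := {x | ‖x - a‖ < r}

lemma mem_ballAt {a x : W.lattice} {r : ℝ} : x ∈ W.ballAt a r ↔ ‖x - a‖ < r := Iff.rfl

lemma ballAt_zero (r : ℝ) : W.ballAt 0 r = W.ball r := by
  ext x; rw [mem_ballAt, sub_zero, mem_ball]

/-- One half of the invariance of potentials under translations. -/
lemma potential_translate_le (a : W.lattice) (D : Set W.lattice) (φ : W.lattice → ℝ≥0∞)
    (x : W.lattice) :
    potential W.kernel ((fun z => z + a) ⁻¹' D) (fun z => φ (z + a)) x ≤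
      potential W.kernel D φ (x + a) := by
  refine potential_le W.kernel (v := fun z => potential W.kernel D φ (z + a)) (fun z => ?_) x
  rw [potential_eq W.kernel D]
  gcongr
  by_cases hz : z + a ∈ D
  · rw [Set.indicator_of_mem (by exact hz), Set.indicator_of_mem hz, kernelStep, kernelStep,
      ← (Equiv.addRight a).tsum_eq (fun y => W.kernel (z + a) y * potential W.kernel D φ y)]
    refine ENNReal.tsum_le_tsum fun y => le_of_eq ?_
    simp [kernel]
  · rw [Set.indicator_of_notMem (by exact hz)]
    exact zero_le

lemma green_translate (D : Set W.lattice) (x a : W.lattice) :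
    green W.kernel D x a = green W.kernel ((fun z => z + a) ⁻¹' D) (x - a) 0 := by
  have e1 : (fun z : W.lattice => pointCharge a (z + a)) = pointCharge 0 := by
    funext z
    by_cases h : z = 0
    · simp [h]
    · rw [pointCharge_of_ne h, pointCharge_of_ne (by simpa using h)]
  apply le_antisymm
  · have := W.potential_translate_le (-a) ((fun z => z + a) ⁻¹' D) (pointCharge 0) x
    rw [← sub_eq_add_neg] at this
    refine le_trans (le_of_eq ?_) this
    rw [green]
    congr 1
    · ext z; simp
    · funext z
      by_cases h : z = a
      · simp [h]
      · rw [pointCharge_of_ne h, pointCharge_of_ne]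
        intro h'; apply h; rwa [← sub_eq_add_neg, sub_eq_zero] at h'
  · have := W.potential_translate_le a D (pointCharge a) (x - a)
    rw [sub_add_cancel, e1] at this
    exact this

/-- The Green's functions of a ball with poles near its centre are comparable away from the
centre. -/
lemma exists_green_comparison (hd : 2 ≤ d) :
    ∃ C r₀ : ℝ, 1 ≤ C ∧ 2 * W.stepBound ≤ r₀ ∧ ∀ r : ℝ, r₀ ≤ r → ∀ a x y w : W.lattice,
      ‖x - a‖ < r → ‖y - a‖ < r → 2 * r ≤ ‖w - a‖ →
      green W.kernel (W.ballAt a (5 * r)) w x ≤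
        ENNReal.ofReal C * green W.kernel (W.ballAt a (5 * r)) w y := by
  obtain ⟨C, hC, hup⟩ := W.exists_green_le hd
  obtain ⟨c, r₀, hc, hr₀, hlow⟩ := W.exists_le_green hd
  have hR := W.one_le_stepBound
  refine ⟨max 1 (C / c), max r₀ (2 * W.stepBound), le_max_left _ _, le_max_right _ _,
    fun r hr a x y w hx hy hw => ?_⟩
  have hr0 : r₀ ≤ r := (le_max_left _ _).trans hr
  have hrR : 2 * W.stepBound ≤ r := (le_max_right _ _).trans hr
  have hrpos : 0 < r := by linarith
  set B := W.ballAt a (5 * r) with hB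
  have hxB : x ∈ B := by rw [hB, mem_ballAt]; linarith
  have hyB : y ∈ B := by rw [hB, mem_ballAt]; linarith
  set D := {z | z ∈ B ∧ 2 * r ≤ ‖z - a‖} with hD
  have hDB : D ⊆ B := fun z hz => hz.1
  have hmark : ∀ p : W.lattice, ‖p - a‖ < r → green W.kernel B w p =
      potential W.kernel D (Dᶜ.indicator fun z => green W.kernel B z p) w := fun p hp =>
    potential_markov_of_zero W.kernel hDB (fun z hz => pointCharge_of_ne (by
      rintro rfl
      have := hz.2
      linarith)) w
  rw [hmark x hx, hmark y hy, ← potential_const_mul]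
  refine potential_mono_of_mem W.kernel (N := {z | 2 * r - W.stepBound ≤ ‖z - a‖})
    (fun p hp _ z hz => ?_) (fun z hz => ?_) (show 2 * r - W.stepBound ≤ ‖w - a‖ by linarith)
  · have h1 := W.norm_sub_le_stepBound hz
    have h2 := hp.2
    have h3 := norm_sub_le (z - a) (z - p)
    rw [sub_sub_sub_cancel_left] at h3
    have h4 : ‖p - a‖ ≤ ‖z - a‖ + ‖z - p‖ := h3
    change _ ≤ ‖z - a‖
    linarith
  · have hz' : 2 * r - W.stepBound ≤ ‖z - a‖ := hz
    by_cases hzD : z ∈ D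
    · simp [hzD]
    rw [Set.indicator_of_mem (by exact hzD), Set.indicator_of_mem (by exact hzD)]
    by_cases hzB : z ∈ B
    swap
    · rw [green_of_notMem _ hzB hxB]; exact zero_le
    have hz2 : ‖z - a‖ < 2 * r := by
      by_contra h
      exact hzD ⟨hzB, not_lt.1 h⟩
    have hzx : r / 2 ≤ ‖z - x‖ := by
      have := norm_add_le (z - x) (x - a)
      rw [sub_add_sub_cancel] at this
      linarith
    have hzy : ‖z - y‖ ≤ 3 * r := by
      have := norm_sub_le (z - a) (y - a)
      rw [sub_sub_sub_cancel_right] at this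
      linarith
    have h1 := hup r (by linarith) ((fun z => z + x) ⁻¹' B) (fun p hp => ?_) (by simpa using hxB)
      (z - x) hzx
    · have h2 := hlow r hr0 ((fun z => z + y) ⁻¹' B) (fun p hp => ?_) (z - y) hzy
      · rw [← green_translate] at h1 h2
        refine h1.trans ?_
        calc ENNReal.ofReal (C * greenScale d r)
            = ENNReal.ofReal (C / c) * ENNReal.ofReal (c * greenScale d r) := by
              rw [← ENNReal.ofReal_mul (by positivity)]
              congr 1
              field_simp
          _ ≤ _ := by gcongr; exact le_max_right _ _
      · rw [mem_ball] at hp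
        change ‖p + y - a‖ < 5 * r
        have := norm_add_le p (y - a)
        rw [← add_sub_assoc] at this
        linarith
    · rw [mem_ball]
      have hp' : ‖p + x - a‖ < 5 * r := hp
      have := norm_sub_le (p + x - a) (x - a)
      rw [sub_sub_sub_cancel_right, add_sub_cancel_right] at this
      linarith

/-- The Harnack inequality on balls. A harmonic function on the ball of radius `5 r` is the Green's
potential of a charge next to the boundary of this ball, where the Green's functions with poles in
the ball of radius `r` are comparable. -/
theorem exists_harnack (hd : 2 ≤ d) :
    ∃ C r₀ : ℝ, 1 ≤ C ∧ 2 * W.stepBound ≤ r₀ ∧ ∀ r : ℝ, r₀ ≤ r → ∀ (a : W.lattice)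
      (D : Set W.lattice) (φ : W.lattice → ℝ≥0∞), W.ballAt a (5 * r) ⊆ D → (∀ x ∈ D, φ x = 0) →
      ∀ x y, ‖x - a‖ < r → ‖y - a‖ < r →
        potential W.kernel D φ x ≤ ENNReal.ofReal C * potential W.kernel D φ y := by
  obtain ⟨C, r₀, hC, hr₀, h⟩ := W.exists_green_comparison hd
  refine ⟨C, r₀, hC, hr₀, fun r hr a D φ hD hφ x y hx hy => ?_⟩
  have hR := W.one_le_stepBound
  have hrpos : 0 < r := by linarith
  set B := W.ballAt a (5 * r) with hB
  have hmem : ∀ z, ‖z - a‖ < r → z ∈ B := fun z hz => by rw [hB, mem_ballAt]; linarith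
  rw [potential_markov_of_zero W.kernel hD (fun z hz => hφ z (hD hz)) x,
    potential_markov_of_zero W.kernel hD (fun z hz => hφ z (hD hz)) y]
  set ψ := Bᶜ.indicator (potential W.kernel D φ) with hψ
  have hψ0 : ∀ z ∈ B, ψ z = 0 := fun z hz => by simp [hψ, hz]
  have key : ∀ p, ‖p - a‖ < r → potential W.kernel B ψ p =
      ∑' w, B.indicator (kernelStep W.kernel ψ) w * green W.kernel B p w := fun p hp => by
    rw [potential_eq_add_potential_step, hψ0 p (hmem p hp), zero_add, potential_eq_tsum_green]
  rw [key x hx, key y hy, ← ENNReal.tsum_mul_left]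
  refine ENNReal.tsum_le_tsum fun w => ?_
  by_cases hw : w ∈ B
  swap
  · rw [Set.indicator_of_notMem hw, zero_mul]; exact zero_le
  by_cases hw0 : kernelStep W.kernel ψ w = 0
  · rw [Set.indicator_of_mem hw, hw0, zero_mul]; exact zero_le
  have hwa : 2 * r ≤ ‖w - a‖ := by
    obtain ⟨z, hz⟩ : ∃ z, W.kernel w z * ψ z ≠ 0 := by
      by_contra hcon
      push Not at hcon
      exact hw0 (ENNReal.tsum_eq_zero.2 hcon)
    have hz1 := W.norm_sub_le_stepBound (left_ne_zero_of_mul hz)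
    have hz2 : z ∉ B := fun h => right_ne_zero_of_mul hz (hψ0 z h)
    rw [hB, mem_ballAt, not_lt] at hz2
    have := norm_add_le (z - w) (w - a)
    rw [sub_add_sub_cancel] at this
    linarith
  rw [green_symm _ W.kernel_symm (hmem x hx) hw, green_symm _ W.kernel_symm (hmem y hy) hw,
    mul_left_comm]
  gcongr
  exact h r hr a x y w hx hy hwa

/-- The Harnack inequality for real harmonic functions that are nonnegative on a ball. -/
lemma exists_harnack_real (hd : 2 ≤ d) :
    ∃ C r₀ : ℝ, 1 ≤ C ∧ 2 * W.stepBound ≤ r₀ ∧ ∀ r : ℝ, r₀ ≤ r → ∀ g : W.lattice → ℝ,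
      (∀ x ∈ W.ball (5 * r), W.realStep g x = g x) → (∀ x ∈ W.ball (6 * r), 0 ≤ g x) →
      ∀ x ∈ W.ball r, ∀ y ∈ W.ball r, g x ≤ C * g y := by
  obtain ⟨C, r₀, hC, hr₀, h⟩ := W.exists_harnack hd
  refine ⟨C, r₀, hC, hr₀, fun r hr g hg hg0 x hx y hy => ?_⟩
  have hR := W.one_le_stepBound
  have hrpos : 0 < r := by linarith
  set B := W.ball (5 * r) with hB
  have hBfin : B.Finite := W.finite_ball _
  have hball : ∀ z ∈ W.ball r, z ∈ B ∧ z ∈ W.ball (6 * r) := fun z hz => by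
    rw [mem_ball] at hz
    rw [hB, mem_ball, mem_ball]
    constructor <;> linarith
  have hnb : ∀ z ∈ B, ∀ v ∈ W.increments, 0 ≤ g (z + v) := fun z hz v hv => by
    apply hg0
    have h1 := W.norm_le_stepBound hv
    have h2 := norm_add_le z v
    rw [hB, mem_ball] at hz
    rw [mem_ball]
    linarith
  set ψ := Bᶜ.indicator fun z => ENNReal.ofReal (g z) with hψ
  have hle : ∀ z, potential W.kernel B ψ z ≤ ENNReal.ofReal (g z) := by
    refine potential_le W.kernel (v := fun z => ENNReal.ofReal (g z)) fun z => ?_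
    by_cases hz : z ∈ B
    · rw [Set.indicator_of_mem hz, kernelStep_ofReal W (hnb z hz), hg z hz]
      simp [hψ, hz]
    · simp [hψ, hz]
  have hfin : ∀ z, potential W.kernel B ψ z ≠ ∞ := fun z =>
    ne_top_of_le_ne_top ENNReal.ofReal_ne_top (hle z)
  have heq : ∀ z ∈ B, g z ≤ (potential W.kernel B ψ z).toReal := fun z hz => by
    have := W.subharmonic_le_zero (by omega) hBfin
      (g := fun z => g z - (potential W.kernel B ψ z).toReal) (fun p hp => ?_)
      (fun p hp v hv hpv => ?_) hz
    · linarith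
    · rw [realStep_sub, hg p hp, ← toReal_kernelStep W fun v _ => hfin _, potential_of_mem _ hp]
      simp [hψ, hp]
    · rw [potential_of_notMem _ hpv, hψ, Set.indicator_of_mem (by exact hpv),
        ENNReal.toReal_ofReal (hnb p hp v hv), sub_self]
  have hh := h r hr 0 B ψ (by rw [ballAt_zero]) (fun z hz => by simp [hψ, hz]) x y
    (by rw [sub_zero]; exact hx) (by rw [sub_zero]; exact hy)
  have h1 := ENNReal.toReal_mono (ENNReal.mul_ne_top ENNReal.ofReal_ne_top (hfin y)) hh
  rw [ENNReal.toReal_mul, ENNReal.toReal_ofReal (by linarith)] at h1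
  refine (heq x (hball x hx).1).trans (h1.trans ?_)
  refine mul_le_mul_of_nonneg_left ?_ (by linarith)
  exact ENNReal.toReal_le_of_le_ofReal (hg0 y (hball y hy).2) (hle y)

/-- Hölder continuity of positive harmonic functions: their oscillation decreases geometrically
along a geometric sequence of balls. -/
lemma exists_oscillation (hd : 2 ≤ d) :
    ∃ C q r₀ : ℝ, 1 ≤ C ∧ 0 < q ∧ q < 1 ∧ 2 * W.stepBound ≤ r₀ ∧ ∀ (m : ℕ) (r : ℝ), r₀ ≤ r →
      ∀ g : W.lattice → ℝ, (∀ x ∈ W.ball (6 ^ m * (5 * r)), W.realStep g x = g x) →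
      (∀ x ∈ W.ball (6 ^ m * (6 * r)), 0 ≤ g x) →
      ∀ x ∈ W.ball r, ∀ y ∈ W.ball r, g x - g y ≤ C * q ^ m * g 0 := by
  obtain ⟨C, r₀, hC, hr₀, h⟩ := W.exists_harnack_real hd
  have hR := W.one_le_stepBound
  refine ⟨C, C / (C + 1), r₀, hC, by positivity, by rw [div_lt_one (by linarith)]; linarith, hr₀,
    fun m => ?_⟩
  have hq0 : 0 ≤ C / (C + 1) := by positivity
  induction m with
  | zero =>
    intro r hr g hg hg0 x hx y hy
    rw [pow_zero, one_mul] at hg hg0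
    have h0 : (0 : W.lattice) ∈ W.ball r := by rw [mem_ball, norm_zero]; linarith
    have hy0 : 0 ≤ g y := hg0 y (by rw [mem_ball] at hy ⊢; linarith)
    have := h r hr g hg hg0 x hx 0 h0
    rw [pow_zero, mul_one]
    linarith
  | succ m ih =>
    intro r hr g hg hg0 x hx y hy
    have hrpos : 0 < r := by linarith
    have h1 := ih (6 * r) (by linarith) g
      (fun z hz => hg z (by
        rw [mem_ball] at hz ⊢
        rwa [show (6 : ℝ) ^ (m + 1) * (5 * r) = 6 ^ m * (5 * (6 * r)) by ring]))
      (fun z hz => hg0 z (by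
        rw [mem_ball] at hz ⊢
        rwa [show (6 : ℝ) ^ (m + 1) * (6 * r) = 6 ^ m * (6 * (6 * r)) by ring]))
    have hfin := W.finite_ball (6 * r)
    have h06 : (0 : W.lattice) ∈ W.ball (6 * r) := by rw [mem_ball, norm_zero]; linarith
    obtain ⟨p, hp, hpmax⟩ := hfin.toFinset.exists_max_image g ⟨0, hfin.mem_toFinset.2 h06⟩
    obtain ⟨s, hs, hsmin⟩ := hfin.toFinset.exists_min_image g ⟨0, hfin.mem_toFinset.2 h06⟩
    simp only [Set.Finite.mem_toFinset] at hp hpmax hs hsmin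
    have hosc := h1 p hp s hs
    have hharm : ∀ z ∈ W.ball (5 * r), W.realStep g z = g z := fun z hz => hg z (by
      rw [mem_ball] at hz ⊢
      have : (1 : ℝ) ≤ 6 ^ (m + 1) := one_le_pow₀ (by norm_num)
      nlinarith)
    have k1 := h r hr (fun z => g z - g s) (fun z hz => by
      rw [realStep_sub, realStep_const, hharm z hz]) (fun z hz => sub_nonneg.2 (hsmin z hz))
      x hx y hy
    have k2 := h r hr (fun z => g p - g z) (fun z hz => by
      rw [realStep_sub, realStep_const, hharm z hz]) (fun z hz => sub_nonneg.2 (hpmax z hz))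
      y hy x hx
    have hCpos : 0 < C + 1 := by linarith
    have hsp : g s ≤ g p := hsmin p hp
    have k3 : (g x - g y) * (C + 1) ≤ C * (g p - g s) := by nlinarith
    have k4 : g x - g y ≤ C / (C + 1) * (g p - g s) := by
      rw [div_mul_eq_mul_div, le_div_iff₀ hCpos]; exact k3
    refine k4.trans ((mul_le_mul_of_nonneg_left hosc hq0).trans (le_of_eq ?_))
    rw [pow_succ]; ring

end LatticeWalk

end Harnack

/-! ### Chains of lattice points -/

section Chains

open scoped ENNReal

namespace LatticeWalk

variable {d : ℕ} (W : LatticeWalk d)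

lemma exists_covering_radius : ∃ c₀ : ℝ, 0 < c₀ ∧ ∀ e : EuclideanSpace ℝ (Fin d), ∃ x : W.lattice,
    ‖(x : EuclideanSpace ℝ (Fin d)) - e‖ ≤ c₀ := by
  have := W.discrete
  have := W.isZLattice
  let b := (Module.Free.chooseBasis ℤ W.lattice).ofZLatticeBasis ℝ W.lattice
  have hb : Submodule.span ℤ (Set.range b) = W.lattice :=
    (Module.Free.chooseBasis ℤ W.lattice).ofZLatticeBasis_span ℝ
  refine ⟨∑ i, ‖b i‖ + 1, by positivity, fun e =>
    ⟨⟨ZSpan.floor b e, hb.le (ZSpan.floor b e).2⟩, ?_⟩⟩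
  have h := ZSpan.norm_fract_le b e
  rw [ZSpan.fract_apply] at h
  rw [norm_sub_rev]
  exact h.trans (by linarith)

/-- How far a lattice point can be from the nearest points of the ambient space. -/
noncomputable def coveringRadius : ℝ := W.exists_covering_radius.choose

lemma coveringRadius_pos : 0 < W.coveringRadius := W.exists_covering_radius.choose_spec.1

lemma exists_near (e : EuclideanSpace ℝ (Fin d)) : ∃ x : W.lattice,
    ‖(x : EuclideanSpace ℝ (Fin d)) - e‖ ≤ W.coveringRadius :=
  W.exists_covering_radius.choose_spec.2 e

/-- Lattice points near two close points of the ambient space are close. -/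
lemma norm_sub_lt_of_near {r : ℝ} {x y : W.lattice} {e e' : EuclideanSpace ℝ (Fin d)}
    (hx : ‖(x : EuclideanSpace ℝ (Fin d)) - e‖ ≤ W.coveringRadius)
    (hy : ‖(y : EuclideanSpace ℝ (Fin d)) - e'‖ ≤ W.coveringRadius)
    (hr : 4 * W.coveringRadius ≤ r) (he : ‖e' - e‖ ≤ r / 4) : ‖x - y‖ < r := by
  have h0 := W.coveringRadius_pos
  have e1 : ((x - y : W.lattice) : EuclideanSpace ℝ (Fin d)) =
      ((x : EuclideanSpace ℝ (Fin d)) - e) - (y - e') - (e' - e) := by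
    push_cast; abel
  have h1 := norm_sub_le (((x : EuclideanSpace ℝ (Fin d)) - e) - (y - e')) (e' - e)
  have h2 := norm_sub_le ((x : EuclideanSpace ℝ (Fin d)) - e) (y - e')
  rw [← e1] at h1
  change ‖((x - y : W.lattice) : EuclideanSpace ℝ (Fin d))‖ < r
  linarith

/-- A local comparison inequality propagates along a segment. -/
lemma le_of_segment_chain {f : W.lattice → ℝ≥0∞} {K : ℝ≥0∞} {r : ℝ}
    (hr : 4 * W.coveringRadius ≤ r) {U : Set W.lattice}
    (H : ∀ x ∈ U, ∀ y ∈ U, ‖x - y‖ < r → f x ≤ K * f y) {e₀ e₁ : EuclideanSpace ℝ (Fin d)} {N : ℕ}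
    (hN : ‖e₁ - e₀‖ ≤ N * (r / 4))
    (hU : ∀ t ∈ Set.Icc (0 : ℝ) 1, ∀ x : W.lattice,
      ‖(x : EuclideanSpace ℝ (Fin d)) - (e₀ + t • (e₁ - e₀))‖ ≤ W.coveringRadius → x ∈ U)
    {x y : W.lattice} (hx : ‖(x : EuclideanSpace ℝ (Fin d)) - e₀‖ ≤ W.coveringRadius)
    (hy : ‖(y : EuclideanSpace ℝ (Fin d)) - e₁‖ ≤ W.coveringRadius) :
    f x ≤ K ^ (N + 2) * f y := by
  have h0 := W.coveringRadius_pos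
  let e : ℕ → EuclideanSpace ℝ (Fin d) := fun i => e₀ + ((i : ℝ) / N) • (e₁ - e₀)
  have hmem : ∀ i ≤ N, ∀ z : W.lattice, ‖(z : EuclideanSpace ℝ (Fin d)) - e i‖ ≤ W.coveringRadius →
      z ∈ U := fun i hi z hz => hU ((i : ℝ) / N) ⟨by positivity,
        div_le_one_of_le₀ (by exact_mod_cast hi) (by positivity)⟩ z hz
  have hx0 : ‖(x : EuclideanSpace ℝ (Fin d)) - e 0‖ ≤ W.coveringRadius := by simpa [e] using hx
  have key : ∀ i ≤ N, ∀ z : W.lattice,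
      ‖(z : EuclideanSpace ℝ (Fin d)) - e i‖ ≤ W.coveringRadius → f x ≤ K ^ (i + 1) * f z := by
    intro i
    induction i with
    | zero =>
      intro _ z hz
      rw [zero_add, pow_one]
      exact H x (hmem 0 (Nat.zero_le _) x hx0) z (hmem 0 (Nat.zero_le _) z hz)
        (W.norm_sub_lt_of_near hx0 hz hr (by simp; linarith))
    | succ i ih =>
      intro hi z hz
      obtain ⟨w, hw⟩ := W.exists_near (e i)
      refine (ih (by omega) w hw).trans ?_
      rw [pow_succ K (i + 1), mul_assoc]
      gcongr
      refine H w (hmem i (by omega) w hw) z (hmem _ hi z hz) (W.norm_sub_lt_of_near hw hz hr ?_)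
      have hNpos : (0 : ℝ) < N := by
        have : 0 < N := by omega
        exact_mod_cast this
      have : e (i + 1) - e i = (1 / N : ℝ) • (e₁ - e₀) := by
        simp only [e]
        rw [add_sub_add_left_eq_sub, ← sub_smul]
        congr 1
        push_cast
        ring
      rw [this, norm_smul, Real.norm_of_nonneg (by positivity), one_div, inv_mul_le_iff₀ hNpos]
      exact hN
  obtain ⟨w, hw⟩ := W.exists_near (e N)
  have hyU : y ∈ U := hU 1 ⟨zero_le_one, le_rfl⟩ y (by simpa using hy)
  refine (key N le_rfl w hw).trans ?_
  rw [pow_succ K (N + 1), mul_assoc]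
  gcongr
  refine H w (hmem N le_rfl w hw) y hyU (W.norm_sub_lt_of_near hw hy hr ?_)
  -- if `N = 0` then `e N = e₀`, but the two end points coincide in this case
  rcases Nat.eq_zero_or_pos N with rfl | hNpos
  · simpa [e] using hN.trans (by simp; linarith : _ ≤ r / 4)
  · have : e N = e₁ := by
      simp only [e]
      rw [div_self (by positivity)]
      simp
    rw [this, sub_self, norm_zero]
    linarith

lemma exists_orthogonal (hd : 2 ≤ d) (a b : EuclideanSpace ℝ (Fin d)) {s : ℝ} (hs : 0 ≤ s) :
    ∃ c : EuclideanSpace ℝ (Fin d), ‖c‖ = s ∧ inner ℝ a c = 0 ∧ 0 ≤ inner ℝ c b := by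
  have hne : ∃ c : EuclideanSpace ℝ (Fin d), c ≠ 0 ∧ inner ℝ a c = 0 := by
    let f : EuclideanSpace ℝ (Fin d) →ₗ[ℝ] ℝ := (innerSL ℝ a).toLinearMap
    have : LinearMap.ker f ≠ ⊥ := by
      apply LinearMap.ker_ne_bot_of_finrank_lt
      rw [finrank_euclideanSpace_fin, Module.finrank_self]
      omega
    obtain ⟨c, hc, hc0⟩ := Submodule.exists_mem_ne_zero_of_ne_bot this
    exact ⟨c, hc0, hc⟩
  obtain ⟨c, hc0, hc⟩ := hne
  have hn : 0 < ‖c‖ := norm_pos_iff.2 hc0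
  have h1 : ‖(s / ‖c‖) • c‖ = s := by
    rw [norm_smul, Real.norm_of_nonneg (by positivity), div_mul_cancel₀ _ hn.ne']
  have h2 : inner ℝ a ((s / ‖c‖) • c) = 0 := by rw [inner_smul_right, hc, mul_zero]
  rcases le_total 0 (inner ℝ ((s / ‖c‖) • c) b) with h | h
  · exact ⟨_, h1, h2, h⟩
  · exact ⟨-((s / ‖c‖) • c), by rw [norm_neg, h1], by rw [inner_neg_right, h2, neg_zero],
      by rw [inner_neg_left]; linarith⟩

lemma norm_segment_le {a b : EuclideanSpace ℝ (Fin d)} {S : ℝ} (ha : ‖a‖ ≤ S) (hb : ‖b‖ ≤ S) {t : ℝ}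
    (ht : t ∈ Set.Icc (0 : ℝ) 1) : ‖a + t • (b - a)‖ ≤ S := by
  have h := (convex_closedBall (0 : EuclideanSpace ℝ (Fin d)) S).add_smul_sub_mem
    (x := a) (y := b) (by simpa using ha) (by simpa using hb) ht
  simpa using h

lemma le_norm_segment {a b : EuclideanSpace ℝ (Fin d)} {s : ℝ} (hs : 0 ≤ s) (ha : s ≤ ‖a‖)
    (hb : s ≤ ‖b‖) (hab : 0 ≤ inner ℝ a b) {t : ℝ} (ht : t ∈ Set.Icc (0 : ℝ) 1) :
    7 / 10 * s ≤ ‖a + t • (b - a)‖ := by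
  have e : a + t • (b - a) = (1 - t) • a + t • b := by
    rw [smul_sub, sub_smul, one_smul]; abel
  have ht0 := ht.1
  have ht1 : 0 ≤ 1 - t := sub_nonneg.2 ht.2
  rw [e]
  have h := norm_add_sq_real ((1 - t) • a) (t • b)
  rw [inner_smul_left, inner_smul_right, norm_smul, norm_smul, Real.norm_of_nonneg ht1,
    Real.norm_of_nonneg ht0] at h
  have h1 : 0 ≤ (1 - t) * (t * inner ℝ a b) := by positivity
  have h2 : s ^ 2 ≤ ‖a‖ ^ 2 := by gcongr
  have h3 : s ^ 2 ≤ ‖b‖ ^ 2 := by gcongr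
  have h4 : (1 - t) ^ 2 * s ^ 2 ≤ (1 - t) ^ 2 * ‖a‖ ^ 2 := by gcongr
  have h5 : t ^ 2 * s ^ 2 ≤ t ^ 2 * ‖b‖ ^ 2 := by gcongr
  simp only [conj_trivial] at h
  have h6 : s ^ 2 / 2 ≤ ((1 - t) ^ 2 + t ^ 2) * s ^ 2 := by
    nlinarith [mul_nonneg (sq_nonneg (2 * t - 1)) (sq_nonneg s)]
  refine le_of_sq_le_sq ?_ (norm_nonneg _)
  nlinarith [sq_nonneg s]

/-- A local comparison inequality in an annulus propagates around the annulus: every point is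
joined to every other one by two segments avoiding the inner ball, through a vector orthogonal to
the first one. -/
lemma le_of_annulus_chain (hd : 2 ≤ d) {f : W.lattice → ℝ≥0∞} {K : ℝ≥0∞} {r s S : ℝ}
    (hr : 4 * W.coveringRadius ≤ r) (hs : 0 ≤ s)
    (H : ∀ x y : W.lattice, 7 / 10 * s - W.coveringRadius ≤ ‖x‖ → ‖x‖ ≤ S + W.coveringRadius →
      7 / 10 * s - W.coveringRadius ≤ ‖y‖ → ‖y‖ ≤ S + W.coveringRadius → ‖x - y‖ < r →
      f x ≤ K * f y) {N : ℕ} (hN : 2 * S ≤ N * (r / 4)) {a b : W.lattice}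
    (ha : s ≤ ‖a‖) (ha' : ‖a‖ ≤ S) (hb : s ≤ ‖b‖) (hb' : ‖b‖ ≤ S) :
    f a ≤ K ^ (N + 2) * (K ^ (N + 2) * f b) := by
  have h0 := W.coveringRadius_pos
  obtain ⟨c, hc, hac, hcb⟩ := exists_orthogonal hd (a : EuclideanSpace ℝ (Fin d))
    (b : EuclideanSpace ℝ (Fin d)) hs
  have hsS : s ≤ S := ha.trans ha'
  obtain ⟨w, hw⟩ := W.exists_near c
  let U : Set W.lattice :=
    {x | 7 / 10 * s - W.coveringRadius ≤ ‖x‖ ∧ ‖x‖ ≤ S + W.coveringRadius}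
  have HU : ∀ x ∈ U, ∀ y ∈ U, ‖x - y‖ < r → f x ≤ K * f y := fun x hx y hy hxy =>
    H x y hx.1 hx.2 hy.1 hy.2 hxy
  have hmem : ∀ (x : W.lattice) (e : EuclideanSpace ℝ (Fin d)),
      ‖(x : EuclideanSpace ℝ (Fin d)) - e‖ ≤ W.coveringRadius → 7 / 10 * s ≤ ‖e‖ → ‖e‖ ≤ S →
      x ∈ U := fun x e hx he he' => by
    have h1 := norm_sub_norm_le (x : EuclideanSpace ℝ (Fin d)) e
    have h2 := norm_sub_norm_le e (x : EuclideanSpace ℝ (Fin d))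
    rw [norm_sub_rev] at h2
    have h3 : ‖(x : EuclideanSpace ℝ (Fin d))‖ = ‖x‖ := rfl
    constructor <;> linarith
  have hlen : ∀ e e' : EuclideanSpace ℝ (Fin d), ‖e‖ ≤ S → ‖e'‖ ≤ S →
      ‖e' - e‖ ≤ N * (r / 4) := fun e e' he he' => by
    have := norm_sub_le e' e
    linarith
  have h1 := W.le_of_segment_chain hr HU (e₀ := a) (e₁ := c) (hlen _ _ ha' (by linarith))
    (fun t ht x hx => hmem x _ hx (le_norm_segment hs ha hc.ge hac.ge ht)
      (norm_segment_le ha' (by linarith) ht))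
    (x := a) (y := w) (by simpa using h0.le) hw
  have h2 := W.le_of_segment_chain hr HU (e₀ := c) (e₁ := b) (hlen _ _ (by linarith) hb')
    (fun t ht x hx => hmem x _ hx (le_norm_segment hs hc.ge hb hcb ht)
      (norm_segment_le (by linarith) hb' ht))
    (x := w) (y := b) hw (by simpa using h0.le)
  refine h1.trans ?_
  gcongr

end LatticeWalk

end Chains

/-! ### Hitting and escape probabilities of balls -/

section Hitting

open scoped ENNReal

namespace LatticeWalk

variable {d : ℕ} (W : LatticeWalk d)

/-- From every point there is a direction of steps that always lead away from the origin. -/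
lemma exists_outward_increment (hd : 0 < d) (y : W.lattice) : ∃ v ∈ W.increments, v ≠ 0 ∧
    ∀ k : ℕ, ‖y‖ ^ 2 + (k : ℝ) ^ 2 * ‖v‖ ^ 2 ≤ ‖y + k • v‖ ^ 2 := by
  obtain ⟨v, hv, hv0⟩ := W.exists_increment_ne_zero hd
  have key : ∀ v : W.lattice,
      0 ≤ inner ℝ (y : EuclideanSpace ℝ (Fin d)) (v : EuclideanSpace ℝ (Fin d)) →
      ∀ k : ℕ, ‖y‖ ^ 2 + (k : ℝ) ^ 2 * ‖v‖ ^ 2 ≤ ‖y + k • v‖ ^ 2 := fun v hv k => by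
    have h1 := W.norm_add_sq' y (k • v)
    have h2 : ‖k • v‖ = k * ‖v‖ := by
      have : ‖(k : ℝ) • (v : EuclideanSpace ℝ (Fin d))‖ = k * ‖(v : EuclideanSpace ℝ (Fin d))‖ := by
        rw [norm_smul, Real.norm_of_nonneg (by positivity)]
      rw [Nat.cast_smul_eq_nsmul] at this
      exact this
    have h3 : inner ℝ (y : EuclideanSpace ℝ (Fin d)) ((k • v : W.lattice) :
        EuclideanSpace ℝ (Fin d)) = k * inner ℝ (y : EuclideanSpace ℝ (Fin d)) v := by
      have : ((k • v : W.lattice) : EuclideanSpace ℝ (Fin d)) =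
          (k : ℝ) • (v : EuclideanSpace ℝ (Fin d)) := by
        rw [Nat.cast_smul_eq_nsmul]; rfl
      rw [this, inner_smul_right]
    rw [h1, h2, h3, mul_pow]
    have : 0 ≤ (k : ℝ) * inner ℝ (y : EuclideanSpace ℝ (Fin d)) v := by positivity
    linarith
  rcases le_total 0 (inner ℝ (y : EuclideanSpace ℝ (Fin d)) (v : EuclideanSpace ℝ (Fin d)))
    with h | h
  · exact ⟨v, hv, hv0, key v h⟩
  · refine ⟨-v, W.neg_mem_increments hv, neg_ne_zero.2 hv0, key (-v) ?_⟩
    rw [NegMemClass.coe_neg, inner_neg_right]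
    linarith

/-- Outside a ball every point can be reached from every other one without entering the ball: both
points can be moved far away from the ball, where lattice points are joined by chains. -/
lemma hit_avoiding_ball_ne_zero (hd : 2 ≤ d) {l : ℝ} {y z : W.lattice} (hy : l ≤ ‖y‖)
    (hz : l ≤ ‖z‖) : green W.kernel ((W.ball l)ᶜ \ {z}) y z ≠ 0 := by
  have hd0 : 0 < d := by omega
  have h0 := W.coveringRadius_pos
  set D := (W.ball l)ᶜ \ {z} with hD
  have hzD : z ∉ D := fun h => h.2 rfl
  -- the hitting probability `u` of `z` is superharmonic outside the ball
  let u : W.lattice → ℝ≥0∞ := fun x => green W.kernel D x z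
  have huz : u z = 1 := by
    change potential _ _ _ _ = _
    rw [potential_of_notMem _ hzD, pointCharge_self]
  have hsup : ∀ x, l ≤ ‖x‖ → kernelStep W.kernel u x ≤ u x := fun x hx => by
    by_cases hxz : x = z
    · rw [hxz, huz]
      refine (kernelStep_mono W.kernel (g := fun _ => 1) (fun w => ?_) z).trans
        (kernelStep_const W.kernel W.tsum_kernel 1 z).le
      exact green_hit_le_one _ W.tsum_kernel D w hzD
    · change _ ≤ potential _ _ _ _
      rw [potential_of_mem W.kernel (show x ∈ D from ⟨fun h => absurd h hx.not_gt, hxz⟩)]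
      exact le_add_self
  have hstep : ∀ x v, l ≤ ‖x‖ → v ∈ W.increments → u (x + v) ≠ 0 → u x ≠ 0 :=
    fun x v hx hv huv h => by
      have h1 : W.kernel x (x + v) * u (x + v) ≤ kernelStep W.kernel u x :=
        ENNReal.le_tsum (f := fun w => W.kernel x w * u w) (x + v)
      have h2 := h1.trans (hsup x hx)
      rw [h, nonpos_iff_eq_zero, mul_eq_zero, kernel_add] at h2
      rcases h2 with h2 | h2
      · exact W.mem_increments.1 hv h2
      · exact huv h2
  have hfar : ∀ (x v : W.lattice) (k : ℕ), l ≤ ‖x‖ →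
      ‖x‖ ^ 2 + (k : ℝ) ^ 2 * ‖v‖ ^ 2 ≤ ‖x + k • v‖ ^ 2 → l ≤ ‖x + k • v‖ := fun x v k hx h => by
    refine hx.trans (le_of_sq_le_sq ?_ (norm_nonneg _))
    have : 0 ≤ (k : ℝ) ^ 2 * ‖v‖ ^ 2 := by positivity
    linarith
  obtain ⟨v, hv, hv0, hvk⟩ := W.exists_outward_increment hd0 y
  obtain ⟨w, hw, hw0, hwk⟩ := W.exists_outward_increment hd0 z
  have hback : ∀ k : ℕ, u (y + k • v) ≠ 0 → u y ≠ 0 := fun k => by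
    induction k with
    | zero => intro h; simpa using h
    | succ k ih =>
      intro h
      refine ih (hstep _ v (hfar y v k hy (hvk k)) hv ?_)
      rwa [add_assoc, ← succ_nsmul]
  have hforth : ∀ k : ℕ, u (z + k • w) ≠ 0 := fun k => by
    induction k with
    | zero => rw [zero_smul, add_zero, huz]; exact one_ne_zero
    | succ k ih =>
      refine hstep _ (-w) (hfar z w _ hz (hwk _)) (W.neg_mem_increments hw) ?_
      rwa [succ_nsmul, ← add_assoc, add_neg_cancel_right]
  obtain ⟨ρ, c, hc, h⟩ := W.exists_local_comparison (4 * W.coveringRadius)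
  set c' := min c 1 with hc'
  have hc'0 : c' ≠ 0 := (lt_min (pos_iff_ne_zero.2 hc) one_pos).ne'
  have hc't : c' ≠ ∞ := ne_top_of_le_ne_top ENNReal.one_ne_top (min_le_right _ _)
  set s := 2 * (|ρ| + |l| + W.coveringRadius) with hs
  have hs0 : 0 ≤ s := by positivity
  have hlarge : ∀ (x v : W.lattice), v ≠ 0 →
      (∀ k : ℕ, ‖x‖ ^ 2 + (k : ℝ) ^ 2 * ‖v‖ ^ 2 ≤ ‖x + k • v‖ ^ 2) → ∃ k : ℕ, s ≤ ‖x + k • v‖ :=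
    fun x v hv0 hk => by
      have hpos : 0 < ‖v‖ := norm_pos_iff.2 hv0
      obtain ⟨k, hkk⟩ := exists_nat_ge (s / ‖v‖)
      rw [div_le_iff₀ hpos] at hkk
      refine ⟨k, le_of_sq_le_sq ?_ (norm_nonneg _)⟩
      have h1 : s ^ 2 ≤ (k * ‖v‖) ^ 2 := by gcongr
      have := hk k
      rw [mul_pow] at h1
      nlinarith [sq_nonneg ‖x‖]
  obtain ⟨i, hi⟩ := hlarge y v hv0 hvk
  obtain ⟨j, hj⟩ := hlarge z w hw0 hwk
  set a := z + j • w with ha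
  set b := y + i • v with hb
  obtain ⟨N, hN⟩ := exists_nat_ge (2 * max ‖a‖ ‖b‖ / (4 * W.coveringRadius / 4))
  rw [div_le_iff₀ (by positivity)] at hN
  have hchain := W.le_of_annulus_chain hd (f := u) (K := c'⁻¹) le_rfl hs0
    (S := max ‖a‖ ‖b‖) (fun p q hp _ _ _ hpq => ?_) hN hj (le_max_left _ _) hi (le_max_right _ _)
  · apply hback i
    intro h0
    rw [h0, mul_zero, mul_zero] at hchain
    exact hforth j (nonpos_iff_eq_zero.1 hchain)
  · have h1 := h p u (fun q hq => hsup q ?_) q (by rwa [norm_sub_rev])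
    · calc u p = c'⁻¹ * (c' * u p) := by
            rw [← mul_assoc, ENNReal.inv_mul_cancel hc'0 hc't, one_mul]
        _ ≤ c'⁻¹ * (c * u p) := by gcongr; exact min_le_left _ _
        _ ≤ _ := by gcongr
    · have h2 := norm_sub_norm_le p q
      rw [norm_sub_rev] at h2
      have := le_abs_self ρ
      have := le_abs_self l
      have := abs_nonneg ρ
      have := abs_nonneg l
      linarith

lemma zpow_two_sub_eq {n : ℝ} (hn : 0 < n) (d : ℕ) :
    n ^ (2 - (d : ℤ)) = (n ^ 2) ^ (1 - (d : ℝ) / 2) := by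
  rw [← Real.rpow_intCast, ← Real.rpow_natCast n 2, ← Real.rpow_mul hn.le]
  congr 1
  push_cast
  ring

/-- In dimension at least three, the probability of ever reaching a ball decays with the distance
like the fundamental solution. -/
lemma exists_hit_le (hd : 3 ≤ d) :
    ∃ C l₀ : ℝ, 0 < C ∧ 1 ≤ l₀ ∧ ∀ l n : ℝ, l₀ ≤ l → 1 ≤ n → ∀ z : W.lattice, n * l ≤ ‖z‖ →
      potential W.kernel (W.ball l)ᶜ ((W.ball l).indicator 1) z ≤
        ENNReal.ofReal (C * n ^ (2 - (d : ℤ))) := by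
  obtain ⟨A, -, hA, -, hsup, -, -⟩ := W.exists_barrier (by omega)
  have hd' : (3 : ℝ) ≤ d := by exact_mod_cast hd
  set e := 1 - (d : ℝ) / 2 with he
  have hneg : e ≤ 0 := by linarith
  have hden : 0 < (d : ℝ) / 2 - 1 := by linarith
  have hfund : ∀ u, fundSol d u = u ^ e / ((d : ℝ) / 2 - 1) := fun u => by
    rw [fundSol, if_neg (by omega)]
  have hpos : ∀ u, 0 < u → 0 < fundSol d u := fun u hu => by
    rw [hfund]; exact div_pos (Real.rpow_pos_of_pos hu _) hden
  refine ⟨(2 ^ e)⁻¹, A, by positivity, hA, fun l n hl hn z hz => ?_⟩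
  have hl1 : 1 ≤ l := hA.trans hl
  have hAl : A ≤ l ^ 2 := by nlinarith
  have hm := hpos (l ^ 2 + A) (by positivity)
  set m := fundSol d (l ^ 2 + A) with hmdef
  have hb : ∀ x, 0 ≤ m⁻¹ * W.barrier A x := fun x =>
    mul_nonneg (inv_nonneg.2 hm.le) (hpos _ (by positivity)).le
  refine (potential_le W.kernel (v := fun x => ENNReal.ofReal (m⁻¹ * W.barrier A x))
    (fun x => ?_) z).trans (ENNReal.ofReal_le_ofReal ?_)
  · by_cases hx : x ∈ W.ball l
    · rw [Set.indicator_of_mem hx, Set.indicator_of_notMem (by exact fun h => h hx), add_zero,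
        Pi.one_apply, ENNReal.one_le_ofReal, ← inv_mul_cancel₀ hm.ne']
      refine mul_le_mul_of_nonneg_left (fundSol_antitone d (by positivity) ?_) (inv_nonneg.2 hm.le)
      have : ‖x‖ ≤ l := hx.le
      gcongr
    · rw [Set.indicator_of_notMem hx, Set.indicator_of_mem (by exact hx), zero_add,
        kernelStep_ofReal W fun v _ => hb _, realStep_const_mul]
      refine ENNReal.ofReal_le_ofReal (mul_le_mul_of_nonneg_left ?_ (inv_nonneg.2 hm.le))
      have h1 := hsup x
      have : 0 ≤ (‖x‖ ^ 2 + A) ^ (-1 - (d : ℝ) / 2) := by positivity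
      linarith
  · rw [inv_mul_le_iff₀ hm]
    have h1 : W.barrier A z ≤ (n ^ 2) ^ e * (l ^ 2) ^ e / ((d : ℝ) / 2 - 1) := by
      rw [barrier, hfund, ← Real.mul_rpow (by positivity) (by positivity), ← mul_pow]
      gcongr ?_ / _
      refine Real.rpow_le_rpow_of_nonpos (by positivity) ?_ hneg
      have : (n * l) ^ 2 ≤ ‖z‖ ^ 2 := by gcongr
      linarith
    have h2 : 2 ^ e * (l ^ 2) ^ e / ((d : ℝ) / 2 - 1) ≤ m := by
      rw [hmdef, hfund, ← Real.mul_rpow (by positivity) (by positivity)]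
      gcongr ?_ / _
      exact Real.rpow_le_rpow_of_nonpos (by positivity) (by linarith) hneg
    have h3 : (0 : ℝ) < 2 ^ e := by positivity
    rw [zpow_two_sub_eq (by linarith), ← he]
    have h4 : (0 : ℝ) ≤ (2 ^ e)⁻¹ * (n ^ 2) ^ e := by positivity
    calc _ ≤ (n ^ 2) ^ e * (l ^ 2) ^ e / ((d : ℝ) / 2 - 1) := h1
      _ = (2 ^ e * (l ^ 2) ^ e / ((d : ℝ) / 2 - 1)) * ((2 ^ e)⁻¹ * (n ^ 2) ^ e) := by
        field_simp
      _ ≤ _ := mul_le_mul_of_nonneg_right h2 h4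

/-- In the plane, a walk started away from a ball reaches an `n` times larger ball first with
probability at least of order `1 / log n`. -/
lemma exists_le_escape (W : LatticeWalk 2) :
    ∃ c l₀ : ℝ, 0 < c ∧ 1 ≤ l₀ ∧ ∀ l n : ℝ, l₀ ≤ l → 4 ≤ n → ∀ w : W.lattice, 2 * l ≤ ‖w‖ →
      ENNReal.ofReal (c / Real.log n) ≤
        potential W.kernel (W.ball (n * l) \ W.ball l) ((W.ball (n * l))ᶜ.indicator 1) w := by
  obtain ⟨A, -, hA, -, hsup, -, -⟩ := W.exists_barrier le_rfl
  have hR := W.one_le_stepBound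
  have hfund : ∀ u, fundSol 2 u = -Real.log u := fun u => by rw [fundSol, if_pos rfl]
  have hlog2 : 0 < Real.log 2 := Real.log_pos (by norm_num)
  refine ⟨Real.log 2 / 4, max A W.stepBound, by positivity, le_max_of_le_left hA,
    fun l n hl hn w hw => ?_⟩
  have hlA : A ≤ l := (le_max_left _ _).trans hl
  have hlR : W.stepBound ≤ l := (le_max_right _ _).trans hl
  have hl1 : 1 ≤ l := hA.trans hlA
  have hAl : A ≤ l ^ 2 := by nlinarith
  have hlogn : Real.log 2 ≤ Real.log n := Real.log_le_log (by norm_num) (by linarith)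
  have hQ : 0 < 4 * Real.log n := by linarith
  have hc1 : Real.log 2 / 4 / Real.log n ≤ 1 := by
    rw [div_le_one (by linarith)]; linarith
  set B := W.ball (n * l) with hB
  set D := B \ W.ball l with hD
  set h := potential W.kernel D (Bᶜ.indicator 1) with hh
  have hle1 : ∀ x, h x ≤ 1 := fun x => potential_le_const _ W.tsum_kernel
    (fun x hx => by simp [hx.1]) (fun x => Set.indicator_le_self' (fun _ _ => zero_le) x) x
  have hfin : ∀ x, h x ≠ ∞ := fun x => ne_top_of_le_ne_top ENNReal.one_ne_top (hle1 x)
  by_cases hwB : w ∈ B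
  swap
  · rw [hh, potential_of_notMem _ (fun hx => hwB hx.1), Set.indicator_of_mem (by exact hwB)]
    exact ENNReal.ofReal_le_one.2 hc1
  set m := fundSol 2 (l ^ 2 + A) with hm
  have hmax := W.subharmonic_le_zero (by norm_num) (D := D)
    ((W.finite_ball _).subset Set.sdiff_subset)
    (g := fun x => (4 * Real.log n)⁻¹ * (m - W.barrier A x) - (h x).toReal) (x := w)
    (fun x hx => ?_) (fun x hx v hv hxv => ?_) ⟨hwB, fun hx => by
      have : ‖w‖ < l := hx
      linarith⟩
  · refine ENNReal.ofReal_le_of_le_toReal ?_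
    have h1 : Real.log 2 ≤ m - W.barrier A w := by
      rw [hm, barrier, hfund, hfund]
      have : Real.log (2 * (l ^ 2 + A)) ≤ Real.log (‖w‖ ^ 2 + A) := by
        refine Real.log_le_log (by positivity) ?_
        have : (2 * l) ^ 2 ≤ ‖w‖ ^ 2 := by gcongr
        nlinarith
      rw [Real.log_mul (by norm_num) (by positivity)] at this
      linarith
    have h2 : Real.log 2 / 4 / Real.log n ≤ (4 * Real.log n)⁻¹ * (m - W.barrier A w) := by
      rw [div_div, div_eq_inv_mul]
      exact mul_le_mul_of_nonneg_left h1 (inv_nonneg.2 hQ.le)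
    linarith
  · have e := potential_of_mem W.kernel (φ := Bᶜ.indicator 1) hx
    rw [← hh, Set.indicator_of_notMem (s := Bᶜ) (fun h => h hx.1), zero_add] at e
    rw [realStep_sub, realStep_const_mul, realStep_sub, realStep_const,
      ← toReal_kernelStep W fun v _ => hfin _, ← e]
    have h1 := hsup x
    have h2 : 0 ≤ (‖x‖ ^ 2 + A) ^ (-1 - ((2 : ℕ) : ℝ) / 2) := by positivity
    have h3 : W.realStep (W.barrier A) x ≤ W.barrier A x := by linarith
    gcongr
  · by_cases hxB : x + v ∈ B
    · have h1 : ‖x + v‖ < l := by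
        by_contra hcon
        exact hxv ⟨hxB, fun h => hcon h⟩
      have h2 : m ≤ W.barrier A (x + v) := fundSol_antitone 2 (by positivity) (by gcongr)
      have h3 : (4 * Real.log n)⁻¹ * (m - W.barrier A (x + v)) ≤ 0 :=
        mul_nonpos_of_nonneg_of_nonpos (inv_nonneg.2 hQ.le) (by linarith)
      have : 0 ≤ (h (x + v)).toReal := ENNReal.toReal_nonneg
      linarith
    · have h1 : h (x + v) = 1 := by
        rw [hh, potential_of_notMem _ (fun hx => hxB hx.1), Set.indicator_of_mem (by exact hxB)]
        rfl
      rw [h1, ENNReal.toReal_one, sub_nonpos, inv_mul_le_iff₀ hQ, mul_one, hm, barrier, hfund,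
        hfund]
      have hxn : ‖x‖ < n * l := hx.1
      have hnl : l ≤ n * l := by nlinarith
      have h2 : ‖x + v‖ ≤ 2 * (n * l) := by
        have := norm_add_le x v
        have := W.norm_le_stepBound hv
        linarith
      have h3 : Real.log (‖x + v‖ ^ 2 + A) ≤ Real.log (n ^ 4 * (l ^ 2 + A)) := by
        refine Real.log_le_log (by positivity) ?_
        have h4 : ‖x + v‖ ^ 2 ≤ (2 * (n * l)) ^ 2 := by gcongr
        have h5 : 1 ≤ n ^ 2 := by nlinarith
        have h6 : 4 * n ^ 2 ≤ n ^ 4 := by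
          nlinarith [mul_nonneg (sq_nonneg n) (show 0 ≤ n ^ 2 - 4 by nlinarith)]
        have h7 : 1 ≤ n ^ 4 := by nlinarith
        nlinarith [mul_le_mul_of_nonneg_right h6 (sq_nonneg l)]
      rw [Real.log_mul (by positivity) (by positivity), Real.log_pow] at h3
      push_cast at h3
      linarith

end LatticeWalk

end Hitting

/-! ### Enlarging the domain of the loop-erased walk -/

section Comparison

open scoped ENNReal

variable {α : Type*} (k : α → α → ℝ≥0∞)

/-- The weight of a self-avoiding path `η ++ [y]` as the beginning of the loop-erased walk in `K`,
up to its transition probabilities, which do not depend on `K`. -/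
noncomputable def loopErasedWeight (K : Set α) (η : List α) (y : α) : ℝ :=
  (greenProd k K η).toReal * (escapeProb k K {x | x ∈ η} y).toReal

variable {k}

/-- The decomposition of a potential according to whether the walk visits `E`. -/
lemma potential_eq_add_hit {B E : Set α} (hE : E ⊆ B) {φ : α → ℝ≥0∞} (hφ : ∀ x ∈ B, φ x = 0)
    (x : α) :
    potential k B φ x =
      potential k (B \ E) φ x + potential k (B \ E) (E.indicator (potential k B φ)) x := by
  rw [potential_markov_of_zero k (D := B) (D' := B \ E) Set.sdiff_subset (fun z hz => hφ z hz.1) x,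
    ← potential_add]
  congr 1
  funext z
  by_cases hzB : z ∈ B
  · by_cases hzE : z ∈ E
    · rw [Set.indicator_of_mem (s := (B \ E)ᶜ) (fun h => h.2 hzE), Set.indicator_of_mem hzE,
        hφ z hzB, zero_add]
    · rw [Set.indicator_of_notMem (s := (B \ E)ᶜ) (fun h => h ⟨hzB, hzE⟩),
        Set.indicator_of_notMem hzE, hφ z hzB, zero_add]
  · rw [Set.indicator_of_mem (s := (B \ E)ᶜ) (fun h => hzB h.1),
      Set.indicator_of_notMem (fun h => hzB (hE h)), add_zero, potential_of_notMem k hzB]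

lemma potential_escape_le_one (hk : ∀ x, ∑' y, k x y = 1) (B K E : Set α) (x : α) :
    potential k B (Bᶜ.indicator (escapeProb k K E)) x ≤ 1 :=
  potential_le_const k hk (fun _ hz => Set.indicator_of_notMem (s := Bᶜ) (fun h => h hz) _)
    (fun z => (Set.indicator_le_self' (fun _ _ => zero_le) z).trans (escapeProb_le_one hk K E z)) x

/-- If the probability of escaping from `K` after leaving `B` is nearly constant on `E` and at `w`,
then escaping from `K` is nearly the same as escaping from `B`, with an absolute error. -/
lemma escapeProb_mem_Icc (hk : ∀ x, ∑' y, k x y = 1) {B K E : Set α} (hBK : B ⊆ K) (hE : E ⊆ B)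
    (hB : ∀ x, potential k B (Bᶜ.indicator 1) x = 1) {a₀ a₁ : ℝ} (ha₀ : 0 ≤ a₀) (ha₁ : 0 ≤ a₁)
    {w : α} (hs : ∀ x, x ∈ E ∨ x = w →
      a₀ ≤ (potential k B (Bᶜ.indicator (escapeProb k K E)) x).toReal ∧
      (potential k B (Bᶜ.indicator (escapeProb k K E)) x).toReal ≤ a₁) :
    a₀ - a₁ * (1 - (escapeProb k B E w).toReal) ≤ (escapeProb k K E w).toReal ∧
      (escapeProb k K E w).toReal ≤ a₁ - a₀ * (1 - (escapeProb k B E w).toReal) := by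
  set s := potential k B (Bᶜ.indicator (escapeProb k K E)) with hsdef
  have hsfin : ∀ x, s x ≠ ∞ := fun x =>
    ne_top_of_le_ne_top ENNReal.one_ne_top (potential_escape_le_one hk B K E x)
  set P := potential k (B \ E) (E.indicator 1) w with hP
  have h1 : s w = escapeProb k K E w + potential k (B \ E) (E.indicator s) w := by
    rw [hsdef, potential_eq_add_hit hE (fun x hx => Set.indicator_of_notMem (s := Bᶜ) (fun h => h hx) _) w,
      ← escapeProb_markov hBK w (hE.trans hBK)]
  have h2 : 1 = escapeProb k B E w + P := by
    have := potential_eq_add_hit (k := k) hE (φ := Bᶜ.indicator 1)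
      (fun x hx => Set.indicator_of_notMem (s := Bᶜ) (fun h => h hx) _) w
    rw [hB] at this
    rw [this, escapeProb, hP]
    congr 2
    funext z
    by_cases hz : z ∈ E <;> simp [hz, hB]
  have hPfin : P ≠ ∞ := ne_top_of_le_ne_top ENNReal.one_ne_top (h2 ▸ le_add_self)
  have hlow : ENNReal.ofReal a₀ * P ≤ potential k (B \ E) (E.indicator s) w := by
    rw [hP, ← potential_const_mul]
    refine potential_mono k (fun z => ?_) w
    by_cases hz : z ∈ E
    · simp only [Set.indicator_of_mem hz, Pi.one_apply, mul_one]
      exact ENNReal.ofReal_le_of_le_toReal (hs z (Or.inl hz)).1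
    · simp [hz]
  have hup : potential k (B \ E) (E.indicator s) w ≤ ENNReal.ofReal a₁ * P := by
    rw [hP, ← potential_const_mul]
    refine potential_mono k (fun z => ?_) w
    by_cases hz : z ∈ E
    · simp only [Set.indicator_of_mem hz, Pi.one_apply, mul_one]
      exact (ENNReal.le_ofReal_iff_toReal_le (hsfin z) ha₁).2 (hs z (Or.inl hz)).2
    · simp [hz]
  have hQfin : potential k (B \ E) (E.indicator s) w ≠ ∞ :=
    ne_top_of_le_ne_top (hsfin w) (h1 ▸ le_add_self)
  have hle := ENNReal.toReal_mono hQfin hlow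
  have hge := ENNReal.toReal_mono (ENNReal.mul_ne_top ENNReal.ofReal_ne_top hPfin) hup
  rw [ENNReal.toReal_mul, ENNReal.toReal_ofReal ha₀] at hle
  rw [ENNReal.toReal_mul, ENNReal.toReal_ofReal ha₁] at hge
  have hfin1 := ne_top_of_le_ne_top ENNReal.one_ne_top (escapeProb_le_one hk K E w)
  have hfin2 := ne_top_of_le_ne_top ENNReal.one_ne_top (escapeProb_le_one hk B E w)
  have h1' := congrArg ENNReal.toReal h1
  rw [ENNReal.toReal_add hfin1 hQfin] at h1'
  have h2' := congrArg ENNReal.toReal h2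
  rw [ENNReal.toReal_one, ENNReal.toReal_add hfin2 hPfin] at h2'
  have hw := hs w (Or.inr rfl)
  have e : 1 - (escapeProb k B E w).toReal = P.toReal := by linarith
  rw [e]
  constructor <;> linarith

/-- The row sums of `1 - T` are the probabilities of escaping from `K` after leaving `B`. -/
lemma one_sub_sum_returnMatrix (hk : ∀ x, ∑' y, k x y = 1) {B K : Set α} (hBK : B ⊆ K) {η : List α}
    (hη : η.Nodup) (hB : ∀ x ∈ η, x ∈ B) (he : ∀ x ∈ η, potential k K (Kᶜ.indicator 1) x = 1)
    (i : Fin η.length) :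
    1 - ∑ j, returnMatrix k B K η i j =
      (potential k B (Bᶜ.indicator (escapeProb k K {x | x ∈ η})) (η.get i)).toReal := by
  have h := congrArg ENNReal.toReal
    (escape_add_return_eq_one hBK hη hB he (he _ (List.get_mem η i)))
  have hfin : ∀ j : Fin η.length, returnProb k B K {x | x ∈ η} (η.get i) (η.get j) ≠ ∞ := fun j =>
    ne_top_of_le_ne_top ENNReal.one_ne_top (returnProb_le_one hk B K _ (List.get_mem η j))
  rw [ENNReal.toReal_add (ne_top_of_le_ne_top ENNReal.one_ne_top
    (potential_escape_le_one hk B K _ _)) (ENNReal.sum_ne_top.2 fun j _ => hfin j),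
    ENNReal.toReal_sum fun j _ => hfin j, ENNReal.toReal_one] at h
  simp only [returnMatrix, Matrix.of_apply]
  linarith

lemma det_returnMatrix_pos (hk : ∀ x, ∑' y, k x y = 1) {B K : Set α} (hBK : B ⊆ K) {η : List α}
    (hη : η.Nodup) (hB : ∀ x ∈ η, x ∈ B) (he : ∀ x ∈ η, potential k K (Kᶜ.indicator 1) x = 1) :
    0 < (1 - returnMatrix k B K η).det := by
  have hfin : ∀ x ∈ η, green k K x x ≠ ∞ := fun x hx =>
    green_self_ne_top hk (hBK (hB x hx)) (by rw [he x hx]; exact one_ne_zero)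
  have h := det_returnMatrix_mul hk hBK hη hB hfin
  have h1 := ENNReal.toReal_mono (greenProd_ne_top hη fun x hx => ne_top_of_le_ne_top (hfin x hx)
    (potential_mono_set k hBK _ _)) (one_le_greenProd (k := k) B η)
  rw [ENNReal.toReal_one, ← h] at h1
  exact pos_of_mul_pos_left (one_pos.trans_le h1) ENNReal.toReal_nonneg

/-- Bounds on the determinant of the return probabilities and on the escape probability give bounds
on the loop-erased weight; a common factor `s` of the two bounds cancels. -/
lemma loopErasedWeight_mem_Icc (hk : ∀ x, ∑' y, k x y = 1) {B K : Set α} (hBK : B ⊆ K) {η : List α}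
    (hη : η.Nodup) (hB : ∀ x ∈ η, x ∈ B) (he : ∀ x ∈ η, potential k K (Kᶜ.indicator 1) x = 1)
    {y : α} {s c₀ c₁ e₀ e₁ : ℝ} (hs : 0 < s) (hc₀ : 0 < c₀)
    (hdet₀ : c₀ * s ≤ (1 - returnMatrix k B K η).det)
    (hdet₁ : (1 - returnMatrix k B K η).det ≤ c₁ * s)
    (hesc₀ : e₀ * s * (escapeProb k B {x | x ∈ η} y).toReal ≤
      (escapeProb k K {x | x ∈ η} y).toReal)
    (hesc₁ : (escapeProb k K {x | x ∈ η} y).toReal ≤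
      e₁ * s * (escapeProb k B {x | x ∈ η} y).toReal) :
    e₀ / c₁ * loopErasedWeight k B η y ≤ loopErasedWeight k K η y ∧
      loopErasedWeight k K η y ≤ e₁ / c₀ * loopErasedWeight k B η y := by
  have hfin : ∀ x ∈ η, green k K x x ≠ ∞ := fun x hx =>
    green_self_ne_top hk (hBK (hB x hx)) (by rw [he x hx]; exact one_ne_zero)
  have h := det_returnMatrix_mul hk hBK hη hB hfin
  set D := (1 - returnMatrix k B K η).det
  set gK := (greenProd k K η).toReal with hgK
  set hK := (escapeProb k K {x | x ∈ η} y).toReal with hhK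
  set hBy := (escapeProb k B {x | x ∈ η} y).toReal with hhB
  have hgK0 : 0 ≤ gK := ENNReal.toReal_nonneg
  have hhK0 : 0 ≤ hK := ENNReal.toReal_nonneg
  have hhB0 : 0 ≤ hBy := ENNReal.toReal_nonneg
  have hD : 0 < D := lt_of_lt_of_le (mul_pos hc₀ hs) hdet₀
  have hc₁ : 0 < c₁ := by
    by_contra hcon
    have : c₁ * s ≤ 0 := mul_nonpos_of_nonpos_of_nonneg (not_lt.1 hcon) hs.le
    linarith
  rw [loopErasedWeight, loopErasedWeight, ← hgK, ← hhK, ← hhB, ← h]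
  have hM : 0 ≤ gK * hK := mul_nonneg hgK0 hhK0
  constructor
  · rw [div_mul_eq_mul_div, div_le_iff₀ hc₁]
    have h1 : (D * gK) * (e₀ * s * hBy) ≤ (D * gK) * hK :=
      mul_le_mul_of_nonneg_left hesc₀ (mul_nonneg hD.le hgK0)
    have h2 : D * (gK * hK) ≤ c₁ * s * (gK * hK) := mul_le_mul_of_nonneg_right hdet₁ hM
    refine le_of_mul_le_mul_right ?_ hs
    nlinarith
  · rw [div_mul_eq_mul_div, le_div_iff₀ hc₀]
    have h1 : (D * gK) * hK ≤ (D * gK) * (e₁ * s * hBy) :=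
      mul_le_mul_of_nonneg_left hesc₁ (mul_nonneg hD.le hgK0)
    have h2 : c₀ * s * (gK * hK) ≤ D * (gK * hK) := mul_le_mul_of_nonneg_right hdet₀ hM
    refine le_of_mul_le_mul_right ?_ hs
    nlinarith

/-- Comparing escape probabilities outside `B` compares them inside. -/
lemma mul_escapeProb_le_mul {B K K' E : Set α} (hBK : B ⊆ K) (hBK' : B ⊆ K') (hE : E ⊆ B)
    {N : Set α} (hN : ∀ y ∈ B, y ∈ N → ∀ z, k y z ≠ 0 → z ∈ N) {c c' : ℝ≥0∞}
    (h : ∀ z ∈ N, z ∉ B → c * escapeProb k K E z ≤ c' * escapeProb k K' E z) {x : α} (hx : x ∈ N) :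
    c * escapeProb k K E x ≤ c' * escapeProb k K' E x := by
  rw [escapeProb_markov hBK x (hE.trans hBK), escapeProb_markov hBK' x (hE.trans hBK'),
    ← potential_const_mul, ← potential_const_mul]
  refine potential_mono_of_mem k (fun y hy => hN y hy.1) (fun z hz => ?_) hx
  by_cases hzB : z ∈ B
  · rw [Set.indicator_of_notMem (s := Bᶜ) (fun h => h hzB), mul_zero]; exact zero_le
  · rw [Set.indicator_of_mem (by exact hzB), Set.indicator_of_mem (by exact hzB)]
    exact h z hz hzB

lemma escapeProb_self_of_notMem {K E : Set α} {z : α} (hz : z ∉ K) : escapeProb k K E z = 1 := by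
  rw [escapeProb, potential_of_notMem k (fun h => hz h.1), Set.indicator_of_mem (by exact hz)]
  rfl

lemma isClosed_exit (hk : ∀ x, ∑' y, k x y = 1) {B K : Set α} (hBK : B ⊆ K) :
    ∀ y ∈ B, y ∈ {z | potential k K (Kᶜ.indicator 1) z = 1} → ∀ z, k y z ≠ 0 →
      z ∈ {z | potential k K (Kᶜ.indicator 1) z = 1} := fun _ hy hy1 _ hyz =>
  exit_eq_one_of_step hk (hBK hy) hy1 hyz

end Comparison

/-! ### Loop-erased weights in much larger domains -/

section LargeDomains

open scoped ENNReal

/-- With `m` of order `log n`, a geometric decay `q ^ m` beats powers of `log n`. -/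
lemma exists_geometric_scale {q : ℝ} (hq0 : 0 < q) (hq1 : q < 1) :
    ∃ C : ℝ, 0 < C ∧ ∀ n : ℝ, 18 ≤ n → ∃ m : ℕ, (6 : ℝ) ^ m * 18 ≤ n ∧
      q ^ m * Real.log n ^ 2 ≤ C := by
  have hlim := tendsto_pow_const_mul_const_pow_of_abs_lt_one 2 (r := q)
    (by rw [abs_of_pos hq0]; exact hq1)
  obtain ⟨M, hM⟩ := hlim.bddAbove_range
  have hM' : ∀ k : ℕ, (k : ℝ) ^ 2 * q ^ k ≤ M := fun k => hM ⟨k, rfl⟩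
  have hM0 : 0 ≤ M := by simpa using hM' 0
  refine ⟨4 * M * (q ^ 3)⁻¹ + 1, by positivity, fun n hn => ?_⟩
  obtain ⟨m, hm, hm'⟩ := exists_nat_pow_near (x := n / 18) (y := 6)
    (by rw [le_div_iff₀ (by norm_num)]; linarith) (by norm_num)
  rw [le_div_iff₀ (by norm_num)] at hm
  rw [div_lt_iff₀ (by norm_num)] at hm'
  refine ⟨m, hm, ?_⟩
  have hlog0 : 0 ≤ Real.log n := Real.log_nonneg (by linarith)
  have hlog : Real.log n ≤ 2 * ((m + 3 : ℕ) : ℝ) := by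
    have h1 : n ≤ 6 ^ (m + 3) := by
      have : (0 : ℝ) < 6 ^ (m + 1) := by positivity
      rw [show m + 3 = (m + 1) + 2 by ring, pow_add]
      nlinarith
    have h2 := Real.log_le_log (by linarith) h1
    rw [Real.log_pow] at h2
    have h3 : Real.log 6 ≤ 2 := by
      have h4 : Real.log 6 ≤ Real.log (Real.exp 1 ^ 2) := by
        refine Real.log_le_log (by norm_num) ?_
        nlinarith [Real.exp_one_gt_d9]
      rw [Real.log_pow, Real.log_exp] at h4
      norm_num at h4
      exact h4
    have h5 : (0 : ℝ) ≤ ((m + 3 : ℕ) : ℝ) := Nat.cast_nonneg _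
    nlinarith
  have h1 : Real.log n ^ 2 ≤ (2 * ((m + 3 : ℕ) : ℝ)) ^ 2 := by gcongr
  have h2 := hM' (m + 3)
  have hqm : 0 < q ^ m := by positivity
  have hq3 : 0 < q ^ 3 := by positivity
  calc q ^ m * Real.log n ^ 2 ≤ q ^ m * (2 * ((m + 3 : ℕ) : ℝ)) ^ 2 := by gcongr
    _ = 4 * (((m + 3 : ℕ) : ℝ) ^ 2 * q ^ (m + 3)) * (q ^ 3)⁻¹ := by
      rw [pow_add]; field_simp; norm_num
    _ ≤ 4 * M * (q ^ 3)⁻¹ := by gcongr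
    _ ≤ _ := by linarith

namespace LatticeWalk

variable {d : ℕ} (W : LatticeWalk d)

lemma realStep_potential {D : Set W.lattice} {φ : W.lattice → ℝ≥0∞} {x : W.lattice} (hx : x ∈ D)
    (hφ : φ x = 0) (hfin : ∀ y, potential W.kernel D φ y ≠ ∞) :
    W.realStep (fun y => (potential W.kernel D φ y).toReal) x = (potential W.kernel D φ x).toReal := by
  rw [← toReal_kernelStep W fun v _ => hfin _, potential_of_mem _ hx, hφ, zero_add]

/-- Functions with values in `[0, 1]` that are harmonic in a large disc are nearly constant near its
centre. -/
lemma exists_nearly_constant (hd : 2 ≤ d) :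
    ∃ C l₀ : ℝ, 0 < C ∧ 1 ≤ l₀ ∧ ∀ l n : ℝ, l₀ ≤ l → 18 ≤ n → ∃ δ : ℝ, 0 ≤ δ ∧
      δ * Real.log n ^ 2 ≤ C ∧ ∀ φ : W.lattice → ℝ≥0∞, (∀ x ∈ W.ball (n * l), φ x = 0) →
        (∀ x, φ x ≤ 1) → ∀ x, ‖x‖ < 3 * l →
          (1 - δ) * (potential W.kernel (W.ball (n * l)) φ 0).toReal ≤
            (potential W.kernel (W.ball (n * l)) φ x).toReal ∧
          (potential W.kernel (W.ball (n * l)) φ x).toReal ≤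
            (1 + δ) * (potential W.kernel (W.ball (n * l)) φ 0).toReal := by
  obtain ⟨C, q, r₀, hC, hq0, hq1, hr₀, h⟩ := W.exists_oscillation hd
  obtain ⟨C', hC', hscale⟩ := exists_geometric_scale hq0 hq1
  have hR := W.one_le_stepBound
  refine ⟨C * C', r₀, by positivity, by linarith, fun l n hl hn => ?_⟩
  obtain ⟨m, hm, hm'⟩ := hscale n hn
  have hl0 : 0 < l := by linarith
  refine ⟨C * q ^ m, by positivity, ?_, fun φ hφ hφ1 x hx => ?_⟩
  · rw [mul_assoc]
    exact mul_le_mul_of_nonneg_left hm' (by linarith)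
  · have hfin : ∀ y, potential W.kernel (W.ball (n * l)) φ y ≠ ∞ := fun y =>
      ne_top_of_le_ne_top ENNReal.one_ne_top
        (potential_le_const _ W.tsum_kernel hφ hφ1 y)
    have hsub : ∀ z ∈ W.ball (6 ^ m * (5 * (3 * l))), z ∈ W.ball (n * l) := fun z hz => by
      rw [mem_ball] at hz ⊢
      have h6 : (0 : ℝ) < 6 ^ m := by positivity
      have : (6 : ℝ) ^ m * (5 * (3 * l)) ≤ 6 ^ m * 18 * l := by nlinarith [mul_pos h6 hl0]
      have : 6 ^ m * 18 * l ≤ n * l := by gcongr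
      linarith
    have hosc := h m (3 * l) (by linarith)
      (fun z => (potential W.kernel (W.ball (n * l)) φ z).toReal)
      (fun z hz => W.realStep_potential (hsub z hz) (hφ z (hsub z hz)) hfin)
      (fun z _ => ENNReal.toReal_nonneg)
    have h0 : (0 : W.lattice) ∈ W.ball (3 * l) := by rw [mem_ball, norm_zero]; linarith
    have h1 := hosc x hx 0 h0
    have h2 := hosc 0 h0 x hx
    constructor <;> linarith

lemma ball_subset_ball {r r' : ℝ} (h : r ≤ r') : W.ball r ⊆ W.ball r' := fun _ hx =>
  lt_of_lt_of_le (W.mem_ball.1 hx) h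

lemma returnMatrix_nonneg {B K : Set W.lattice} {η : List W.lattice} (i j : Fin η.length) :
    0 ≤ returnMatrix W.kernel B K η i j := ENNReal.toReal_nonneg

/-- The conditions on the lattice points of a path under which loop-erased weights are compared: the
path `η ++ [y]` consists of a self-avoiding path in `B_l` and a point `y` of `B_{2l}`, and the walk
leaves `K` almost surely from each of its points. -/
structure IsAdmissible (K : Set W.lattice) (l : ℝ) (η : List W.lattice) (y : W.lattice) : Prop where
  ne_nil : η ≠ []
  nodup : η.Nodup
  mem_ball : ∀ x ∈ η, x ∈ W.ball l
  exit : ∀ x ∈ η, potential W.kernel K (Kᶜ.indicator 1) x = 1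
  exit_last : potential W.kernel K (Kᶜ.indicator 1) y = 1
  norm_last : ‖y‖ < 2 * l

lemma one_sub_ratio_bounds {ε δ κ : ℝ} (hδ : 0 ≤ δ) (hδε : δ ≤ ε) (hκε : κ ≤ ε)
    (hε : ε ≤ 1 / 32) :
    1 - 16 * ε ≤ (1 - κ) / ((1 + 4 * δ) * (1 + δ)) ∧
      (1 + κ) / (Real.exp (-((1 + 4 * δ) * (4 * δ))) * (1 - δ)) ≤ 1 + 16 * ε ∧
      0 < Real.exp (-((1 + 4 * δ) * (4 * δ))) * (1 - δ) := by
  have hexp : 1 - 6 * δ ≤ Real.exp (-((1 + 4 * δ) * (4 * δ))) := by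
    have := Real.add_one_le_exp (-((1 + 4 * δ) * (4 * δ)))
    nlinarith
  have h1 : (1 - 6 * δ) * (1 - δ) ≤ Real.exp (-((1 + 4 * δ) * (4 * δ))) * (1 - δ) :=
    mul_le_mul_of_nonneg_right hexp (by linarith)
  have h2 : 1 - 7 * ε ≤ Real.exp (-((1 + 4 * δ) * (4 * δ))) * (1 - δ) := by nlinarith
  have h3 : 0 < Real.exp (-((1 + 4 * δ) * (4 * δ))) * (1 - δ) := by linarith
  refine ⟨?_, ?_, h3⟩
  · have h4 : (1 + 4 * δ) * (1 + δ) ≤ 1 + 6 * ε := by nlinarith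
    rw [le_div_iff₀ (by positivity)]
    have h5 : 0 ≤ 1 - 16 * ε := by linarith
    calc _ ≤ (1 - 16 * ε) * (1 + 6 * ε) := mul_le_mul_of_nonneg_left h4 h5
      _ ≤ _ := by nlinarith
  · rw [div_le_iff₀ h3]
    have h5 : 0 ≤ 1 + 16 * ε := by linarith
    calc _ ≤ (1 + 16 * ε) * (1 - 7 * ε) := by nlinarith
      _ ≤ _ := mul_le_mul_of_nonneg_left h2 h5

/-- In the plane, the probabilities of returning from outside `B_{nl}` to the points of a path, and
of escaping, are nearly independent of the starting point in `B_{3l}`. The error in the escape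
probability is small compared with the escape probability itself, which is at least of order
`1 / log n` away from `B_l`. -/
lemma exists_weight_close_planar (W : LatticeWalk 2) :
    ∃ C l₀ n₀ : ℝ, 0 < C ∧ 1 ≤ l₀ ∧ 4 ≤ n₀ ∧ ∀ l n : ℝ, l₀ ≤ l → n₀ ≤ n →
      ∀ K : Set W.lattice, W.ball (n * l) ⊆ K → ∀ η y, W.IsAdmissible K l η y →
        (1 - C * (1 / Real.log n)) * loopErasedWeight W.kernel (W.ball (n * l)) η y ≤
            loopErasedWeight W.kernel K η y ∧
          loopErasedWeight W.kernel K η y ≤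
            (1 + C * (1 / Real.log n)) * loopErasedWeight W.kernel (W.ball (n * l)) η y := by
  obtain ⟨C₁, l₁, hC₁, hl₁, hconst⟩ := W.exists_nearly_constant le_rfl
  obtain ⟨c, l₂, hc, hl₂, hesc⟩ := W.exists_le_escape
  have hR := W.one_le_stepBound
  set C₂ := C₁ + 2 * C₁ / c with hC₂
  have hC₂0 : 0 < C₂ := by positivity
  refine ⟨16 * C₂, max (max l₁ l₂) W.stepBound, max 18 (Real.exp (32 * C₂ + 1)), by positivity,
    le_max_of_le_right hR, le_max_of_le_left (by norm_num), fun l n hl hn K hK η y had => ?_⟩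
  have hll₁ : l₁ ≤ l := (le_max_left _ _).trans ((le_max_left _ _).trans hl)
  have hll₂ : l₂ ≤ l := (le_max_right _ _).trans ((le_max_left _ _).trans hl)
  have hlR : W.stepBound ≤ l := (le_max_right _ _).trans hl
  have hl0 : 0 < l := by linarith
  have hn18 : 18 ≤ n := (le_max_left _ _).trans hn
  have hL : 32 * C₂ + 1 ≤ Real.log n := by
    rw [Real.le_log_iff_exp_le (by linarith)]; exact (le_max_right _ _).trans hn
  set L := Real.log n with hLdef
  have hL0 : 0 < L := by linarith
  obtain ⟨δ, hδ0, hδL, hδ⟩ := hconst l n hll₁ hn18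
  set B := W.ball (n * l) with hB
  set E : Set W.lattice := {x | x ∈ η} with hE
  have hηB : ∀ x ∈ η, x ∈ B := fun x hx => by
    have h1 : ‖x‖ < l := had.mem_ball x hx
    rw [hB, W.mem_ball]; nlinarith
  have hEB : E ⊆ B := hηB
  have hBfin : B.Finite := W.finite_ball _
  -- the parameters `δ` and `κ = 2 δ L / c` are at most `ε = C₂ / L`
  set κ := 2 * δ * L / c with hκ
  set ε := C₂ * (1 / L) with hε
  have hδL1 : δ * L ≤ C₁ * (1 / L) := by
    rw [mul_one_div, le_div_iff₀ hL0]
    nlinarith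
  have hδε : δ ≤ ε := by
    have h1 : δ ≤ δ * L := le_mul_of_one_le_right hδ0 (by linarith)
    have h2 : C₁ * (1 / L) ≤ C₂ * (1 / L) := by
      refine mul_le_mul_of_nonneg_right ?_ (by positivity)
      have : 0 ≤ 2 * C₁ / c := by positivity
      linarith
    linarith
  have hκε : κ ≤ ε := by
    have h1 : κ = 2 / c * (δ * L) := by rw [hκ]; ring
    have h2 : 2 / c * (δ * L) ≤ 2 / c * (C₁ * (1 / L)) :=
      mul_le_mul_of_nonneg_left hδL1 (by positivity)
    have h3 : ε = C₁ * (1 / L) + 2 / c * (C₁ * (1 / L)) := by rw [hε, hC₂]; ring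
    have h4 : 0 ≤ C₁ * (1 / L) := by positivity
    linarith
  have hκ0 : 0 ≤ κ := by positivity
  have hε32 : ε ≤ 1 / 32 := by
    rw [hε, mul_one_div, div_le_iff₀ hL0]; linarith
  -- the escape probability after leaving `B`
  set φ := Bᶜ.indicator (escapeProb W.kernel K E) with hφ
  set s : W.lattice → ℝ := fun x => (potential W.kernel B φ x).toReal with hs
  have hφ0 : ∀ x ∈ B, φ x = 0 := fun x hx => Set.indicator_of_notMem (s := Bᶜ) (fun h => h hx) _
  have hφ1 : ∀ x, φ x ≤ 1 := fun x => (Set.indicator_le_self' (fun _ _ => zero_le) x).trans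
    (escapeProb_le_one W.tsum_kernel K E x)
  have hs3 : ∀ x, ‖x‖ < 3 * l → (1 - δ) * s 0 ≤ s x ∧ s x ≤ (1 + δ) * s 0 := hδ φ hφ0 hφ1
  have hs00 : 0 ≤ s 0 := ENNReal.toReal_nonneg
  have hη3 : ∀ x ∈ η, ‖x‖ < 3 * l := fun x hx => by
    have h1 : ‖x‖ < l := had.mem_ball x hx
    linarith
  -- the determinant of the return probabilities
  have hTC : ∀ i i' j, returnMatrix W.kernel B K η i j ≤
      (1 + 4 * δ) * returnMatrix W.kernel B K η i' j := fun i i' j => by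
    have h1 := hδ (Bᶜ.indicator fun z => green W.kernel (K \ E) z (η.get j))
      (fun x hx => Set.indicator_of_notMem (s := Bᶜ) (fun h => h hx) _)
      (fun x => (Set.indicator_le_self' (fun _ _ => zero_le) x).trans
        (green_hit_le_one _ W.tsum_kernel _ _ fun h => h.2 (List.get_mem η j)))
    have h2 := (h1 (η.get i) (hη3 _ (List.get_mem η i))).2
    have h3 := (h1 (η.get i') (hη3 _ (List.get_mem η i'))).1
    set t := (potential W.kernel B
      (Bᶜ.indicator fun z => green W.kernel (K \ E) z (η.get j)) 0).toReal
    have ht : 0 ≤ t := ENNReal.toReal_nonneg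
    have h4 : (1 + δ) * t ≤ (1 + 4 * δ) * ((1 - δ) * t) := by
      have : 1 + δ ≤ (1 + 4 * δ) * (1 - δ) := by nlinarith
      rw [← mul_assoc]
      exact mul_le_mul_of_nonneg_right this ht
    change (potential W.kernel B _ _).toReal ≤ (1 + 4 * δ) * (potential W.kernel B _ _).toReal
    have h5 := mul_le_mul_of_nonneg_left h3 (show 0 ≤ 1 + 4 * δ by linarith)
    exact h2.trans (h4.trans h5)
  have hrow := one_sub_sum_returnMatrix W.tsum_kernel hK had.nodup hηB had.exit
  have hdet := det_one_sub_mem_Icc_of_rows (List.length_pos_iff.2 had.ne_nil)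
    (T := returnMatrix W.kernel B K η) (C := 1 + 4 * δ) (by linarith)
    (fun i j => W.returnMatrix_nonneg i j) hTC
    (lo := (1 - δ) * s 0) (hi := (1 + δ) * s 0) (mul_nonneg (by linarith) hs00)
    (fun i => by rw [hrow i]; exact (hs3 _ (hη3 _ (List.get_mem η i))).1)
    (fun i => by rw [hrow i]; exact (hs3 _ (hη3 _ (List.get_mem η i))).2)
  rw [add_sub_cancel_left] at hdet
  have hspos : 0 < s 0 := by
    refine lt_of_le_of_ne hs00 fun h0 => ?_
    have h1 := hdet.2
    rw [← h0, mul_zero, mul_zero] at h1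
    exact h1.not_gt (det_returnMatrix_pos W.tsum_kernel hK had.nodup hηB had.exit)
  -- the escape probability away from `B_l`
  have hfinK : ∀ z, escapeProb W.kernel K E z ≠ ∞ := fun z =>
    ne_top_of_le_ne_top ENNReal.one_ne_top (escapeProb_le_one W.tsum_kernel K E z)
  have hfinB : ∀ z, escapeProb W.kernel B E z ≠ ∞ := fun z =>
    ne_top_of_le_ne_top ENNReal.one_ne_top (escapeProb_le_one W.tsum_kernel B E z)
  have hw : ∀ w, 2 * l ≤ ‖w‖ → ‖w‖ < 3 * l →
      (1 - κ) * s 0 * (escapeProb W.kernel B E w).toReal ≤ (escapeProb W.kernel K E w).toReal ∧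
      (escapeProb W.kernel K E w).toReal ≤
        (1 + κ) * s 0 * (escapeProb W.kernel B E w).toReal := fun w hw hw3 => by
    have h1 := escapeProb_mem_Icc W.tsum_kernel hK hEB (W.exit_eq_one_of_finite (by norm_num) hBfin)
      (a₀ := (1 - δ) * s 0) (a₁ := (1 + δ) * s 0) (mul_nonneg (by linarith) hs00)
      (mul_nonneg (by linarith) hs00) (w := w) (fun x hx => hs3 x (by
        rcases hx with hx | rfl
        · exact hη3 x hx
        · exact hw3))
    have h2 : c / L ≤ (escapeProb W.kernel B E w).toReal := by
      refine (ENNReal.ofReal_le_iff_le_toReal (hfinB w)).1 ((hesc l n hll₂ (by linarith) w hw).trans ?_)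
      exact potential_mono_set _ (Set.sdiff_subset_sdiff_right fun x hx => had.mem_ball x hx) _ _
    set b := (escapeProb W.kernel B E w).toReal
    have hb1 : b ≤ 1 := ENNReal.toReal_mono ENNReal.one_ne_top
      (escapeProb_le_one W.tsum_kernel B E w)
    have hb0 : 0 ≤ b := ENNReal.toReal_nonneg
    have h3 : 2 * δ ≤ κ * b := by
      have : κ * (c / L) = 2 * δ := by rw [hκ]; field_simp
      rw [← this]
      exact mul_le_mul_of_nonneg_left h2 hκ0
    have h4 : 0 ≤ s 0 * δ * b := by positivity
    have h5 : s 0 * (2 * δ) ≤ s 0 * (κ * b) := mul_le_mul_of_nonneg_left h3 hs00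
    constructor
    · refine le_trans ?_ h1.1
      linarith
    · refine h1.2.trans ?_
      linarith
  -- the escape probability at `y`, by the first exit from `B_{2l}`
  set B₂ := W.ball (2 * l) with hB₂
  have hB₂B : B₂ ⊆ B := W.ball_subset_ball (by nlinarith)
  have hEB₂ : E ⊆ B₂ := fun x hx => W.ball_subset_ball (by linarith) (had.mem_ball x hx)
  have hN : ∀ p ∈ B₂, p ∈ W.ball (3 * l) → ∀ z, W.kernel p z ≠ 0 → z ∈ W.ball (3 * l) :=
    fun p hp _ z hz => by
      have h1 := W.norm_sub_le_stepBound hz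
      have h2 : ‖p‖ < 2 * l := hp
      have h3 := norm_add_le (z - p) p
      rw [sub_add_cancel] at h3
      rw [W.mem_ball]; linarith
  have hyN : y ∈ W.ball (3 * l) := by
    rw [W.mem_ball]; linarith [had.norm_last]
  have hκ1 : 0 ≤ (1 - κ) * s 0 := mul_nonneg (by linarith) hs00
  have hκ2 : 0 ≤ (1 + κ) * s 0 := mul_nonneg (by linarith) hs00
  have hy1 : escapeProb W.kernel K E y ≤
      ENNReal.ofReal ((1 + κ) * s 0) * escapeProb W.kernel B E y := by
    rw [← one_mul (escapeProb W.kernel K E y)]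
    refine mul_escapeProb_le_mul (hB₂B.trans hK) hB₂B hEB₂ hN (fun z hz hzB => ?_) hyN
    have h1 := (hw z (not_lt.1 fun h => hzB h) hz).2
    rw [one_mul, ← ENNReal.ofReal_toReal (hfinK z), ← ENNReal.ofReal_toReal (hfinB z),
      ← ENNReal.ofReal_mul hκ2]
    exact ENNReal.ofReal_le_ofReal h1
  have hy2 : ENNReal.ofReal ((1 - κ) * s 0) * escapeProb W.kernel B E y ≤
      escapeProb W.kernel K E y := by
    rw [← one_mul (escapeProb W.kernel K E y)]
    refine mul_escapeProb_le_mul hB₂B (hB₂B.trans hK) hEB₂ hN (fun z hz hzB => ?_) hyN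
    have h1 := (hw z (not_lt.1 fun h => hzB h) hz).1
    rw [one_mul, ← ENNReal.ofReal_toReal (hfinK z), ← ENNReal.ofReal_toReal (hfinB z),
      ← ENNReal.ofReal_mul hκ1]
    exact ENNReal.ofReal_le_ofReal h1
  have hy1' := ENNReal.toReal_mono (ENNReal.mul_ne_top ENNReal.ofReal_ne_top (hfinB y)) hy1
  rw [ENNReal.toReal_mul, ENNReal.toReal_ofReal hκ2] at hy1'
  have hy2' := ENNReal.toReal_mono (hfinK y) hy2
  rw [ENNReal.toReal_mul, ENNReal.toReal_ofReal hκ1] at hy2'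
  obtain ⟨hr1, hr2, hr3⟩ := one_sub_ratio_bounds hδ0 hδε hκε hε32
  have hfinal := loopErasedWeight_mem_Icc W.tsum_kernel hK had.nodup hηB had.exit hspos hr3
    (c₁ := (1 + 4 * δ) * (1 + δ)) (e₀ := 1 - κ) (e₁ := 1 + κ) (by rw [mul_assoc]; exact hdet.1)
    (by rw [mul_assoc]; exact hdet.2) hy2' hy1'
  have hwt : 0 ≤ loopErasedWeight W.kernel B η y :=
    mul_nonneg ENNReal.toReal_nonneg ENNReal.toReal_nonneg
  rw [mul_assoc 16 C₂, ← hε]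
  exact ⟨(mul_le_mul_of_nonneg_right hr1 hwt).trans hfinal.1,
    hfinal.2.trans (mul_le_mul_of_nonneg_right hr2 hwt)⟩

/-- A walk leaving `K` either does so before visiting `E ⊆ B_l`, or it visits `B_l`. -/
lemma escapeProb_add_hit_ge (K : Set W.lattice) {E : Set W.lattice} {l : ℝ} (hEK : E ⊆ K)
    (hE : E ⊆ W.ball l) (z : W.lattice) :
    potential W.kernel K (Kᶜ.indicator 1) z ≤ escapeProb W.kernel K E z +
      potential W.kernel (W.ball l)ᶜ ((W.ball l).indicator 1) z := by
  rw [potential_eq_add_hit hEK (fun x hx => Set.indicator_of_notMem (s := Kᶜ) (fun h => h hx) _) z]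
  refine add_le_add le_rfl ?_
  have hin : ∀ x ∈ W.ball l,
      potential W.kernel (W.ball l)ᶜ ((W.ball l).indicator 1) x = 1 := fun x hx => by
    rw [potential_of_notMem (D := (W.ball l)ᶜ) _ (fun h => h hx), Set.indicator_of_mem hx,
      Pi.one_apply]
  have hle : ∀ x, potential W.kernel (W.ball l)ᶜ ((W.ball l).indicator 1) x ≤ 1 := fun x =>
    potential_le_const _ W.tsum_kernel (fun y hy => Set.indicator_of_notMem hy _)
      (fun y => Set.indicator_le_self' (fun _ _ => zero_le) y) x
  refine potential_le _ (fun x => ?_) z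
  by_cases hxl : x ∈ W.ball l
  · rw [hin x hxl]
    by_cases hxE : x ∈ E
    · rw [Set.indicator_of_mem hxE, Set.indicator_of_notMem (s := K \ E) (fun h => h.2 hxE), add_zero]
      exact exit_le_one W.tsum_kernel K x
    · rw [Set.indicator_of_notMem hxE, zero_add]
      refine (Set.indicator_le_self' (fun _ _ => zero_le) x).trans ?_
      exact (kernelStep_mono _ hle x).trans (kernelStep_const _ W.tsum_kernel 1 x).le
  · rw [Set.indicator_of_notMem (fun h => hxl (hE h)), zero_add,
      potential_of_mem W.kernel (D := (W.ball l)ᶜ) hxl, Set.indicator_of_notMem hxl, zero_add]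
    exact Set.indicator_le_self' (fun _ _ => zero_le) x

lemma one_sub_div_bounds {C ε : ℝ} (hC : 1 ≤ C) (hε : 0 ≤ ε) (h : 4 * C * ε ≤ 1) :
    1 - 4 * C * ε ≤ (1 - ε) / 1 ∧ 1 / Real.exp (-(C * ε) / (1 - ε)) ≤ 1 + 4 * C * ε := by
  have h1 : 0 ≤ C * ε := by positivity
  have h2 : ε ≤ C * ε := le_mul_of_one_le_left hε hC
  refine ⟨by rw [div_one]; linarith, ?_⟩
  have h3 : 0 < 1 - ε := by linarith
  have h4 : -(2 * (C * ε)) ≤ -(C * ε) / (1 - ε) := by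
    rw [le_div_iff₀ h3]; nlinarith
  have h5 : 1 - 2 * (C * ε) ≤ Real.exp (-(C * ε) / (1 - ε)) := by
    have := Real.add_one_le_exp (-(C * ε) / (1 - ε))
    linarith
  rw [div_le_iff₀ (Real.exp_pos _)]
  have h6 := mul_le_mul_of_nonneg_left h5 (show 0 ≤ 1 + 4 * C * ε by linarith)
  nlinarith

/-- In dimension at least three, the walk returns to `B_l` from outside `B_{nl}` with a probability
of order at most `n ^ (2 - d)`, so that enlarging the domain beyond `B_{nl}` changes little. -/
lemma exists_weight_close_transient (hd : 3 ≤ d) :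
    ∃ C l₀ n₀ : ℝ, 0 < C ∧ 1 ≤ l₀ ∧ 4 ≤ n₀ ∧ ∀ l n : ℝ, l₀ ≤ l → n₀ ≤ n →
      ∀ K : Set W.lattice, W.ball (n * l) ⊆ K → ∀ η y, W.IsAdmissible K l η y →
        (1 - C * n ^ (2 - (d : ℤ))) * loopErasedWeight W.kernel (W.ball (n * l)) η y ≤
            loopErasedWeight W.kernel K η y ∧
          loopErasedWeight W.kernel K η y ≤
            (1 + C * n ^ (2 - (d : ℤ))) * loopErasedWeight W.kernel (W.ball (n * l)) η y := by
  obtain ⟨C₁, l₁, hC₁, hl₁, hhit⟩ := W.exists_hit_le hd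
  obtain ⟨C₂, r₀, hC₂, hr₀, hharnack⟩ := W.exists_harnack (by omega)
  have hR := W.one_le_stepBound
  refine ⟨4 * C₂ * C₁, max l₁ r₀, max 5 (4 * C₂ * C₁), by positivity, le_max_of_le_left hl₁,
    le_max_of_le_left (by norm_num), fun l n hl hn K hK η y had => ?_⟩
  have hll₁ : l₁ ≤ l := (le_max_left _ _).trans hl
  have hlr : r₀ ≤ l := (le_max_right _ _).trans hl
  have hl0 : 0 < l := by linarith
  have hn5 : 5 ≤ n := (le_max_left _ _).trans hn
  have hn4 : 4 * C₂ * C₁ ≤ n := (le_max_right _ _).trans hn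
  set ε := C₁ * n ^ (2 - (d : ℤ)) with hε
  have hε0 : 0 ≤ ε := by positivity
  have hε4 : 4 * C₂ * ε ≤ 1 := by
    have h1 : n ^ (2 - (d : ℤ)) ≤ n ^ (-1 : ℤ) := zpow_le_zpow_right₀ (by linarith) (by omega)
    rw [zpow_neg_one] at h1
    calc 4 * C₂ * ε = 4 * C₂ * C₁ * n ^ (2 - (d : ℤ)) := by rw [hε]; ring
      _ ≤ n * n⁻¹ := mul_le_mul hn4 h1 (by positivity) (by linarith)
      _ = 1 := mul_inv_cancel₀ (by linarith)
  have hε1 : ε ≤ 1 / 4 := by nlinarith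
  set B := W.ball (n * l) with hB
  set E : Set W.lattice := {x | x ∈ η} with hE
  have hηB : ∀ x ∈ η, x ∈ B := fun x hx => W.ball_subset_ball (by nlinarith) (had.mem_ball x hx)
  have hEB : E ⊆ B := hηB
  have hBfin : B.Finite := W.finite_ball _
  have hd0 : 0 < d := by omega
  set N : Set W.lattice := {z | potential W.kernel K (Kᶜ.indicator 1) z = 1} with hNdef
  have hN : ∀ p ∈ B, p ∈ N → ∀ z, W.kernel p z ≠ 0 → z ∈ N := isClosed_exit W.tsum_kernel hK
  have hescN : ∀ z ∈ N, z ∉ B → ENNReal.ofReal (1 - ε) ≤ escapeProb W.kernel K E z :=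
    fun z hz hzB => by
      have h1 := W.escapeProb_add_hit_ge K (hEB.trans hK) (fun x hx => had.mem_ball x hx) z
      rw [show potential W.kernel K (Kᶜ.indicator 1) z = 1 from hz] at h1
      have h2 := hhit l n hll₁ (by linarith) z (not_lt.1 fun h => hzB h)
      rw [ENNReal.ofReal_sub _ hε0, ENNReal.ofReal_one, tsub_le_iff_right]
      exact h1.trans (add_le_add le_rfl h2)
  -- the determinant of the return probabilities
  have hrow := one_sub_sum_returnMatrix W.tsum_kernel hK had.nodup hηB had.exit
  have hs : ∀ x ∈ η,
      1 - ε ≤ (potential W.kernel B (Bᶜ.indicator (escapeProb W.kernel K E)) x).toReal :=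
    fun x hx => by
      refine (ENNReal.ofReal_le_iff_le_toReal (ne_top_of_le_ne_top ENNReal.one_ne_top
        (potential_escape_le_one W.tsum_kernel B K E x))).1 ?_
      rw [← mul_one (ENNReal.ofReal (1 - ε)), ← W.exit_eq_one_of_finite hd0 hBfin x,
        ← potential_const_mul]
      refine potential_mono_of_mem _ hN (fun z hz => ?_) (had.exit x hx)
      by_cases hzB : z ∈ B
      · rw [Set.indicator_of_notMem (s := Bᶜ) (fun h => h hzB), mul_zero]; exact zero_le
      · rw [Set.indicator_of_mem (s := Bᶜ) hzB, Set.indicator_of_mem (s := Bᶜ) hzB, Pi.one_apply,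
          mul_one]
        exact hescN z hz hzB
  have hrowle : ∀ i, ∑ j, returnMatrix W.kernel B K η i j ≤ ε := fun i => by
    have h1 := hs _ (List.get_mem η i)
    rw [← hrow i] at h1
    linarith
  let i₀ : Fin η.length := ⟨0, List.length_pos_iff.2 had.ne_nil⟩
  have hTC : ∀ i j, returnMatrix W.kernel B K η i j ≤ C₂ * returnMatrix W.kernel B K η i₀ j :=
    fun i j => by
      have h1 := hharnack l hlr 0 B
        (Bᶜ.indicator fun z => green W.kernel (K \ E) z (η.get j))
        (by rw [ballAt_zero]; exact W.ball_subset_ball (by nlinarith))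
        (fun x hx => Set.indicator_of_notMem (s := Bᶜ) (fun h => h hx) _) (η.get i) (η.get i₀)
        (by rw [sub_zero]; exact had.mem_ball _ (List.get_mem η i))
        (by rw [sub_zero]; exact had.mem_ball _ (List.get_mem η i₀))
      have h2 := ENNReal.toReal_mono (ENNReal.mul_ne_top ENNReal.ofReal_ne_top
        (ne_top_of_le_ne_top ENNReal.one_ne_top
          (returnProb_le_one W.tsum_kernel B K _ (List.get_mem η j)))) h1
      rw [ENNReal.toReal_mul, ENNReal.toReal_ofReal (by linarith)] at h2
      exact h2
  have hdet := det_one_sub_mem_Icc (E := returnMatrix W.kernel B K η) (θ := ε)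
    (b := fun j => C₂ * returnMatrix W.kernel B K η i₀ j) (by linarith)
    (fun i j => W.returnMatrix_nonneg i j) hrowle hTC
  have hsum : ∑ j, C₂ * returnMatrix W.kernel B K η i₀ j ≤ C₂ * ε := by
    rw [← Finset.mul_sum]
    exact mul_le_mul_of_nonneg_left (hrowle i₀) (by linarith)
  have hexp : Real.exp (-(C₂ * ε) / (1 - ε)) ≤ (1 - returnMatrix W.kernel B K η).det := by
    refine le_trans (Real.exp_le_exp.2 ?_) hdet.1
    have : 0 < 1 - ε := by linarith
    gcongr
  -- the escape probability at `y`
  have hfinK := ne_top_of_le_ne_top ENNReal.one_ne_top (escapeProb_le_one W.tsum_kernel K E y)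
  have hfinB := ne_top_of_le_ne_top ENNReal.one_ne_top (escapeProb_le_one W.tsum_kernel B E y)
  have hy1 : 1 * escapeProb W.kernel K E y ≤ 1 * escapeProb W.kernel B E y :=
    mul_escapeProb_le_mul hK le_rfl hEB hN (fun z _ hzB => by
      rw [escapeProb_self_of_notMem hzB, one_mul, one_mul]
      exact escapeProb_le_one W.tsum_kernel K E z) had.exit_last
  have hy2 : ENNReal.ofReal (1 - ε) * escapeProb W.kernel B E y ≤
      1 * escapeProb W.kernel K E y :=
    mul_escapeProb_le_mul le_rfl hK hEB hN (fun z hz hzB => by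
      rw [escapeProb_self_of_notMem hzB, one_mul, mul_one]
      exact hescN z hz hzB) had.exit_last
  rw [one_mul, one_mul] at hy1
  rw [one_mul] at hy2
  have hy1' := ENNReal.toReal_mono hfinB hy1
  have hy2' := ENNReal.toReal_mono hfinK hy2
  rw [ENNReal.toReal_mul, ENNReal.toReal_ofReal (by linarith)] at hy2'
  obtain ⟨hr1, hr2⟩ := one_sub_div_bounds hC₂ hε0 hε4
  have hfinal := loopErasedWeight_mem_Icc W.tsum_kernel hK had.nodup hηB had.exit one_pos
    (Real.exp_pos (-(C₂ * ε) / (1 - ε))) (y := y) (c₁ := 1) (e₀ := 1 - ε) (e₁ := 1)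
    (by rw [mul_one]; exact hexp) (by rw [mul_one]; exact hdet.2)
    (by rw [mul_one]; exact hy2') (by rw [one_mul, one_mul]; exact hy1')
  have hwt : 0 ≤ loopErasedWeight W.kernel B η y :=
    mul_nonneg ENNReal.toReal_nonneg ENNReal.toReal_nonneg
  rw [mul_assoc (4 * C₂) C₁, ← hε]
  exact ⟨(mul_le_mul_of_nonneg_right hr1 hwt).trans hfinal.1,
    hfinal.2.trans (mul_le_mul_of_nonneg_right hr2 hwt)⟩

end LatticeWalk

end LargeDomains

/-! ### Loop-erased weights in domains of comparable size -/

section ComparableDomains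

open scoped ENNReal

namespace LatticeWalk

variable {d : ℕ} (W : LatticeWalk d)

/-- The Harnack inequality on `B_l` for functions harmonic on `B_{2l}`. -/
lemma exists_harnack_inner (hd : 2 ≤ d) :
    ∃ C l₀ : ℝ, 1 ≤ C ∧ 1 ≤ l₀ ∧ ∀ l : ℝ, l₀ ≤ l → ∀ φ : W.lattice → ℝ≥0∞,
      (∀ x ∈ W.ball (2 * l), φ x = 0) → ∀ x ∈ W.ball l, ∀ y ∈ W.ball l,
        potential W.kernel (W.ball (2 * l)) φ x ≤
          ENNReal.ofReal C * potential W.kernel (W.ball (2 * l)) φ y := by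
  obtain ⟨C, r₀, hC, hr₀, h⟩ := W.exists_harnack hd
  have hR := W.one_le_stepBound
  have h0 := W.coveringRadius_pos
  -- balls of radius `5 r = l / 4` around points of `B_l` are contained in `B_{2l}`
  refine ⟨C ^ (160 + 2), max (20 * r₀) (80 * W.coveringRadius), one_le_pow₀ hC,
    le_max_of_le_left (by linarith), fun l hl φ hφ x hx y hy => ?_⟩
  have hlr : 20 * r₀ ≤ l := (le_max_left _ _).trans hl
  have hlc : 80 * W.coveringRadius ≤ l := (le_max_right _ _).trans hl
  have hx' : ‖(x : EuclideanSpace ℝ (Fin d))‖ < l := hx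
  have hy' : ‖(y : EuclideanSpace ℝ (Fin d))‖ < l := hy
  have hchain := W.le_of_segment_chain (f := potential W.kernel (W.ball (2 * l)) φ)
    (K := ENNReal.ofReal C) (r := l / 20) (by linarith) (U := {z | ‖z‖ ≤ l + W.coveringRadius})
    (fun p _ q hq hpq => ?_) (e₀ := x) (e₁ := y) (N := 160) ?_ (fun t ht z hz => ?_) (x := x)
    (y := y) (by simpa using h0.le) (by simpa using h0.le)
  · rwa [ENNReal.ofReal_pow (by linarith)]
  · refine h (l / 20) (by linarith) q _ φ (fun z hz => ?_) hφ p q hpq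
      (by rw [sub_self, norm_zero]; linarith)
    have h1 : ‖z - q‖ < 5 * (l / 20) := hz
    have h2 : ‖q‖ ≤ l + W.coveringRadius := hq
    have h3 := norm_add_le (z - q) q
    rw [sub_add_cancel] at h3
    rw [mem_ball]; linarith
  · have := norm_sub_le (y : EuclideanSpace ℝ (Fin d)) x
    push_cast
    linarith
  · have h1 := norm_segment_le hx'.le hy'.le ht
    have h2 := norm_sub_norm_le (z : EuclideanSpace ℝ (Fin d)) (x + t • (y - x) : EuclideanSpace ℝ (Fin d))
    have h3 : ‖(z : EuclideanSpace ℝ (Fin d))‖ ≤ l + W.coveringRadius := by linarith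
    exact h3

/-- The Harnack inequality near the sphere of radius `2 l` for functions harmonic on
`B_{4l} \ B_l`. -/
lemma exists_harnack_annulus (hd : 2 ≤ d) :
    ∃ C l₀ : ℝ, 1 ≤ C ∧ 1 ≤ l₀ ∧ ∀ l : ℝ, l₀ ≤ l → ∀ (D : Set W.lattice) (φ : W.lattice → ℝ≥0∞),
      W.ball (4 * l) \ W.ball l ⊆ D → (∀ x ∈ D, φ x = 0) → ∀ x y : W.lattice, 2 * l ≤ ‖x‖ →
        ‖x‖ ≤ 3 * l → 2 * l ≤ ‖y‖ → ‖y‖ ≤ 3 * l →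
          potential W.kernel D φ x ≤ ENNReal.ofReal C * potential W.kernel D φ y := by
  obtain ⟨C, r₀, hC, hr₀, h⟩ := W.exists_harnack hd
  have hR := W.one_le_stepBound
  have h0 := W.coveringRadius_pos
  refine ⟨C ^ (480 + 2) * C ^ (480 + 2), max (20 * r₀) (80 * W.coveringRadius),
    one_le_mul_of_one_le_of_one_le (one_le_pow₀ hC) (one_le_pow₀ hC),
    le_max_of_le_left (by linarith), fun l hl D φ hD hφ x y hx hx' hy hy' => ?_⟩
  have hlr : 20 * r₀ ≤ l := (le_max_left _ _).trans hl
  have hlc : 80 * W.coveringRadius ≤ l := (le_max_right _ _).trans hl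
  have hchain := W.le_of_annulus_chain hd (f := potential W.kernel D φ)
    (K := ENNReal.ofReal C) (r := l / 20) (s := 2 * l) (S := 3 * l) (by linarith) (by linarith)
    (fun p q _ _ hq hq' hpq => ?_) (N := 480) (by push_cast; linarith) hx hx' hy hy'
  · rw [ENNReal.ofReal_mul (by positivity), ENNReal.ofReal_pow (by linarith), mul_assoc]
    exact hchain
  · refine h (l / 20) (by linarith) q D φ (fun z hz => hD ⟨?_, fun hzl => ?_⟩) hφ p q hpq
      (by rw [sub_self, norm_zero]; linarith)
    · have h1 : ‖z - q‖ < 5 * (l / 20) := hz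
      have h3 := norm_add_le (z - q) q
      rw [sub_add_cancel] at h3
      rw [mem_ball]; linarith
    · have h1 : ‖z - q‖ < 5 * (l / 20) := hz
      have h2 : ‖z‖ < l := hzl
      have h3 := norm_sub_le z (z - q)
      rw [sub_sub_cancel] at h3
      linarith

lemma exists_lattice_norm_mem (hd : 2 ≤ d) {l : ℝ} (hl : 2 * W.coveringRadius ≤ l) :
    ∃ z : W.lattice, 2 * l ≤ ‖z‖ ∧ ‖z‖ ≤ 3 * l := by
  have h0 := W.coveringRadius_pos
  obtain ⟨c, hc, -, -⟩ := exists_orthogonal (d := d) hd 0 0 (s := 5 / 2 * l) (by linarith)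
  obtain ⟨z, hz⟩ := W.exists_near c
  have h1 := norm_sub_norm_le (z : EuclideanSpace ℝ (Fin d)) c
  have h2 := norm_sub_norm_le c (z : EuclideanSpace ℝ (Fin d))
  rw [norm_sub_rev] at h2
  have h3 : ‖(z : EuclideanSpace ℝ (Fin d))‖ = ‖z‖ := rfl
  exact ⟨z, by linarith, by linarith⟩

/-- In all domains containing `B_{4l}` the loop-erased weights are comparable to those in `B_{2l}`.
By the Harnack inequality the escape probabilities of all points near the sphere of radius `2 l` are
comparable, and so are the return probabilities from all points of `B_l`. -/
lemma exists_weight_comparable (hd : 2 ≤ d) :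
    ∃ C l₀ : ℝ, 0 < C ∧ 1 ≤ l₀ ∧ ∀ l : ℝ, l₀ ≤ l → ∀ K : Set W.lattice, W.ball (4 * l) ⊆ K →
      ∀ η y, W.IsAdmissible K l η y →
        C⁻¹ * loopErasedWeight W.kernel (W.ball (2 * l)) η y ≤ loopErasedWeight W.kernel K η y ∧
          loopErasedWeight W.kernel K η y ≤
            C * loopErasedWeight W.kernel (W.ball (2 * l)) η y := by
  obtain ⟨C₁, l₁, hC₁, hl₁, hinner⟩ := W.exists_harnack_inner hd
  obtain ⟨C₂, l₂, hC₂, hl₂, hannulus⟩ := W.exists_harnack_annulus hd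
  have hR := W.one_le_stepBound
  have hd0 : 0 < d := by omega
  have hC₁0 : 0 < C₁ := by linarith
  have hC₂0 : 0 < C₂ := by linarith
  refine ⟨C₁ * C₂ ^ 2 * Real.exp (C₁ * (C₁ - 1)), max (max l₁ l₂)
    (max W.stepBound (2 * W.coveringRadius)), by positivity,
    le_max_of_le_left (le_max_of_le_left hl₁), fun l hl K hK η y had => ?_⟩
  have hll₁ : l₁ ≤ l := (le_max_left _ _).trans ((le_max_left _ _).trans hl)
  have hll₂ : l₂ ≤ l := (le_max_right _ _).trans ((le_max_left _ _).trans hl)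
  have hlR : W.stepBound ≤ l := (le_max_left _ _).trans ((le_max_right _ _).trans hl)
  have hlc : 2 * W.coveringRadius ≤ l := (le_max_right _ _).trans ((le_max_right _ _).trans hl)
  have hl0 : 0 < l := by linarith
  set B := W.ball (2 * l) with hB
  set E : Set W.lattice := {x | x ∈ η} with hE
  have hBK : B ⊆ K := (W.ball_subset_ball (by linarith)).trans hK
  have hηB : ∀ x ∈ η, x ∈ B := fun x hx => W.ball_subset_ball (by linarith) (had.mem_ball x hx)
  have hEB : E ⊆ B := hηB
  have hBfin : B.Finite := W.finite_ball _
  set N := W.ball (3 * l) with hNdef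
  have hN : ∀ p ∈ B, p ∈ N → ∀ z, W.kernel p z ≠ 0 → z ∈ N := fun p hp _ z hz => by
    have h1 := W.norm_sub_le_stepBound hz
    have h2 : ‖p‖ < 2 * l := hp
    have h3 := norm_add_le (z - p) p
    rw [sub_add_cancel] at h3
    rw [hNdef, W.mem_ball]; linarith
  obtain ⟨z₀, hz₀, hz₀'⟩ := W.exists_lattice_norm_mem hd hlc
  have hfin : ∀ (A : Set W.lattice) z, escapeProb W.kernel A E z ≠ ∞ := fun A z =>
    ne_top_of_le_ne_top ENNReal.one_ne_top (escapeProb_le_one W.tsum_kernel A E z)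
  set H := (escapeProb W.kernel K E z₀).toReal with hH
  have hH0 : 0 ≤ H := ENNReal.toReal_nonneg
  have hHeq : ENNReal.ofReal H = escapeProb W.kernel K E z₀ := ENNReal.ofReal_toReal (hfin K z₀)
  have hcomp : ∀ p q : W.lattice, 2 * l ≤ ‖p‖ → ‖p‖ ≤ 3 * l → 2 * l ≤ ‖q‖ → ‖q‖ ≤ 3 * l →
      escapeProb W.kernel K E p ≤ ENNReal.ofReal C₂ * escapeProb W.kernel K E q :=
    hannulus l hll₂ (K \ E) _
      (fun z hz => ⟨hK hz.1, fun hzE => hz.2 (had.mem_ball z hzE)⟩)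
      (fun z hz => Set.indicator_of_notMem (s := Kᶜ) (fun h => h hz.1) _)
  have hup : ∀ z ∈ N, z ∉ B → escapeProb W.kernel K E z ≤ ENNReal.ofReal (C₂ * H) :=
    fun z hz hzB => by
      rw [ENNReal.ofReal_mul hC₂0.le, hHeq]
      exact hcomp z z₀ (not_lt.1 fun h => hzB h) (le_of_lt hz) hz₀ hz₀'
  have hlow : ∀ z ∈ N, z ∉ B → ENNReal.ofReal (C₂⁻¹ * H) ≤ escapeProb W.kernel K E z :=
    fun z hz hzB => by
      refine ENNReal.ofReal_le_of_le_toReal ?_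
      have h1 := ENNReal.toReal_mono (ENNReal.mul_ne_top ENNReal.ofReal_ne_top (hfin K z))
        (hcomp z₀ z hz₀ hz₀' (not_lt.1 fun h => hzB h) (le_of_lt hz))
      rw [ENNReal.toReal_mul, ENNReal.toReal_ofReal hC₂0.le] at h1
      rwa [inv_mul_le_iff₀ hC₂0]
  -- the determinant of the return probabilities
  have hηN : ∀ x ∈ η, x ∈ N := fun x hx => W.ball_subset_ball (by linarith) (had.mem_ball x hx)
  have hs : ∀ x ∈ η,
      C₂⁻¹ * H ≤ (potential W.kernel B (Bᶜ.indicator (escapeProb W.kernel K E)) x).toReal ∧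
      (potential W.kernel B (Bᶜ.indicator (escapeProb W.kernel K E)) x).toReal ≤ C₂ * H :=
    fun x hx => by
      have hexit := W.exit_eq_one_of_finite hd0 hBfin x
      constructor
      · refine (ENNReal.ofReal_le_iff_le_toReal (ne_top_of_le_ne_top ENNReal.one_ne_top
          (potential_escape_le_one W.tsum_kernel B K E x))).1 ?_
        rw [← mul_one (ENNReal.ofReal _), ← hexit, ← potential_const_mul]
        refine potential_mono_of_mem _ hN (fun z hz => ?_) (hηN x hx)
        by_cases hzB : z ∈ B
        · rw [Set.indicator_of_notMem (s := Bᶜ) (fun h => h hzB), mul_zero]; exact zero_le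
        · rw [Set.indicator_of_mem (s := Bᶜ) hzB, Set.indicator_of_mem (s := Bᶜ) hzB, Pi.one_apply,
            mul_one]
          exact hlow z hz hzB
      · refine ENNReal.toReal_le_of_le_ofReal (by positivity) ?_
        rw [← mul_one (ENNReal.ofReal _), ← hexit, ← potential_const_mul]
        refine potential_mono_of_mem _ hN (fun z hz => ?_) (hηN x hx)
        by_cases hzB : z ∈ B
        · rw [Set.indicator_of_notMem (s := Bᶜ) (fun h => h hzB)]; exact zero_le
        · rw [Set.indicator_of_mem (s := Bᶜ) hzB, Set.indicator_of_mem (s := Bᶜ) hzB, Pi.one_apply,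
            mul_one]
          exact hup z hz hzB
  have hTC : ∀ i i' j, returnMatrix W.kernel B K η i j ≤
      C₁ * returnMatrix W.kernel B K η i' j := fun i i' j => by
    have h1 := hinner l hll₁ (Bᶜ.indicator fun z => green W.kernel (K \ E) z (η.get j))
      (fun x hx => Set.indicator_of_notMem (s := Bᶜ) (fun h => h hx) _)
      (η.get i) (had.mem_ball _ (List.get_mem η i)) (η.get i') (had.mem_ball _ (List.get_mem η i'))
    have h2 := ENNReal.toReal_mono (ENNReal.mul_ne_top ENNReal.ofReal_ne_top
      (ne_top_of_le_ne_top ENNReal.one_ne_top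
        (returnProb_le_one W.tsum_kernel B K _ (List.get_mem η j)))) h1
    rw [ENNReal.toReal_mul, ENNReal.toReal_ofReal hC₁0.le] at h2
    exact h2
  have hrow := one_sub_sum_returnMatrix W.tsum_kernel hBK had.nodup hηB had.exit
  have hdet := det_one_sub_mem_Icc_of_rows (List.length_pos_iff.2 had.ne_nil)
    (T := returnMatrix W.kernel B K η) hC₁ (fun i j => W.returnMatrix_nonneg i j) hTC
    (lo := C₂⁻¹ * H) (hi := C₂ * H) (by positivity)
    (fun i => by rw [hrow i]; exact (hs _ (List.get_mem η i)).1)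
    (fun i => by rw [hrow i]; exact (hs _ (List.get_mem η i)).2)
  have hHpos : 0 < H := by
    refine lt_of_le_of_ne hH0 fun h0 => ?_
    have h1 := hdet.2
    rw [← h0, mul_zero, mul_zero] at h1
    exact h1.not_gt (det_returnMatrix_pos W.tsum_kernel hBK had.nodup hηB had.exit)
  -- the escape probability at `y`
  have hyN : y ∈ N := by
    rw [hNdef, W.mem_ball]; linarith [had.norm_last]
  have hy1 : 1 * escapeProb W.kernel K E y ≤
      ENNReal.ofReal (C₂ * H) * escapeProb W.kernel B E y :=
    mul_escapeProb_le_mul hBK le_rfl hEB hN (fun z hz hzB => by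
      rw [escapeProb_self_of_notMem hzB, one_mul, mul_one]
      exact hup z hz hzB) hyN
  have hy2 : ENNReal.ofReal (C₂⁻¹ * H) * escapeProb W.kernel B E y ≤
      1 * escapeProb W.kernel K E y :=
    mul_escapeProb_le_mul le_rfl hBK hEB hN (fun z hz hzB => by
      rw [escapeProb_self_of_notMem hzB, one_mul, mul_one]
      exact hlow z hz hzB) hyN
  rw [one_mul] at hy1 hy2
  have hy1' := ENNReal.toReal_mono (ENNReal.mul_ne_top ENNReal.ofReal_ne_top (hfin B y)) hy1
  have hy2' := ENNReal.toReal_mono (hfin K y) hy2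
  rw [ENNReal.toReal_mul, ENNReal.toReal_ofReal (by positivity)] at hy1' hy2'
  have hfinal := loopErasedWeight_mem_Icc W.tsum_kernel hBK had.nodup hηB had.exit hHpos
    (c₀ := Real.exp (-(C₁ * (C₁ - 1))) * C₂⁻¹) (c₁ := C₁ * C₂) (e₀ := C₂⁻¹) (e₁ := C₂) (y := y)
    (by positivity) (by rw [mul_assoc]; exact hdet.1) (by rw [mul_assoc]; exact hdet.2) hy2' hy1'
  have hwt : 0 ≤ loopErasedWeight W.kernel B η y :=
    mul_nonneg ENNReal.toReal_nonneg ENNReal.toReal_nonneg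
  have hexp1 : 1 ≤ Real.exp (C₁ * (C₁ - 1)) :=
    Real.one_le_exp (mul_nonneg hC₁0.le (by linarith))
  constructor
  · refine (mul_le_mul_of_nonneg_right ?_ hwt).trans hfinal.1
    rw [← one_div_div, div_inv_eq_mul, one_div]
    refine inv_anti₀ (by positivity) ?_
    have : C₁ * C₂ * C₂ ≤ C₁ * C₂ ^ 2 * Real.exp (C₁ * (C₁ - 1)) := by
      rw [show C₁ * C₂ * C₂ = C₁ * C₂ ^ 2 * 1 by ring]
      gcongr
    exact this
  · refine hfinal.2.trans (mul_le_mul_of_nonneg_right ?_ hwt)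
    rw [Real.exp_neg, div_le_iff₀ (by positivity)]
    have : C₁ * C₂ ^ 2 * Real.exp (C₁ * (C₁ - 1)) * ((Real.exp (C₁ * (C₁ - 1)))⁻¹ * C₂⁻¹) =
        C₁ * C₂ := by
      field_simp
    rw [this]
    exact le_mul_of_one_le_left hC₂0.le hC₁

end LatticeWalk

end ComparableDomains

/-! ### The error term -/

section ErrorRate

/-- The order of magnitude `e(n)` of the dependence on a domain containing `B_{nl}`. -/
noncomputable def errorRate (d : ℕ) (n : ℝ) : ℝ :=
  if d = 2 then 1 / Real.log n else n ^ (2 - (d : ℤ))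

lemma errorRate_pos (d : ℕ) {n : ℝ} (hn : 1 < n) : 0 < errorRate d n := by
  rw [errorRate]
  split_ifs
  · exact one_div_pos.2 (Real.log_pos hn)
  · positivity

lemma errorRate_anti {d : ℕ} (hd : 2 ≤ d) {n n' : ℝ} (hn : 1 < n) (h : n ≤ n') :
    errorRate d n' ≤ errorRate d n := by
  rw [errorRate, errorRate]
  split_ifs with h2
  · exact one_div_le_one_div_of_le (Real.log_pos hn) (Real.log_le_log (by linarith) h)
  · obtain ⟨m, rfl⟩ : ∃ m, d = m + 2 := ⟨d - 2, by omega⟩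
    rw [show 2 - ((m + 2 : ℕ) : ℤ) = -(m : ℤ) by push_cast; ring, zpow_neg, zpow_neg, zpow_natCast,
      zpow_natCast]
    gcongr

lemma exists_errorRate_div_le {d : ℕ} (hd : 2 ≤ d) {c : ℝ} (hc : 1 ≤ c) :
    ∃ A n₀ : ℝ, 0 < A ∧ ∀ n : ℝ, n₀ ≤ n → errorRate d (n / c) ≤ A * errorRate d n := by
  by_cases h2 : d = 2
  · refine ⟨2, max 4 (c ^ 2), by norm_num, fun n hn => ?_⟩
    have hn4 : 4 ≤ n := (le_max_left _ _).trans hn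
    have hnc : c ^ 2 ≤ n := (le_max_right _ _).trans hn
    rw [errorRate, errorRate, if_pos h2, if_pos h2, Real.log_div (by linarith) (by linarith)]
    have h3 := Real.log_le_log (by positivity) hnc
    rw [Real.log_pow] at h3
    push_cast at h3
    have h4 : 0 < Real.log n := Real.log_pos (by linarith)
    rw [mul_one_div, div_le_div_iff₀ (by linarith) h4]
    linarith
  · refine ⟨c ^ (d - 2), 0, by positivity, fun n _ => ?_⟩
    obtain ⟨m, rfl⟩ : ∃ m, d = m + 2 := ⟨d - 2, by omega⟩
    rw [errorRate, errorRate, if_neg h2, if_neg h2,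
      show 2 - ((m + 2 : ℕ) : ℤ) = -(m : ℤ) by push_cast; ring, zpow_neg, zpow_neg, zpow_natCast,
      zpow_natCast, div_pow, inv_div, Nat.add_sub_cancel, div_eq_mul_inv]

lemma exists_errorRate_le {d : ℕ} (hd : 2 ≤ d) {c : ℝ} (hc : 0 < c) :
    ∃ n₀ : ℝ, 4 ≤ n₀ ∧ ∀ n : ℝ, n₀ ≤ n → errorRate d n ≤ c := by
  have hlarge : ∃ n₀ : ℝ, 4 ≤ n₀ ∧ errorRate d n₀ ≤ c := by
    by_cases h2 : d = 2
    · have hpos : 0 < 1 / c + 2 := by positivity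
      refine ⟨Real.exp (1 / c + 2), ?_, ?_⟩
      · have h1 : Real.exp 2 ≤ Real.exp (1 / c + 2) := Real.exp_le_exp.2 (by
          have : 0 < 1 / c := by positivity
          linarith)
        have h3 : Real.exp 2 = Real.exp 1 * Real.exp 1 := by rw [← Real.exp_add]; norm_num
        nlinarith [Real.exp_one_gt_d9]
      · rw [errorRate, if_pos h2, Real.log_exp, div_le_iff₀ hpos, mul_add, mul_one_div,
          div_self hc.ne']
        linarith
    · refine ⟨max 4 c⁻¹, le_max_left _ _, ?_⟩
      have h4 : (4 : ℝ) ≤ max 4 c⁻¹ := le_max_left _ _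
      rw [errorRate, if_neg h2]
      calc max 4 c⁻¹ ^ (2 - (d : ℤ)) ≤ max 4 c⁻¹ ^ (-1 : ℤ) :=
            zpow_le_zpow_right₀ (by linarith) (by omega)
        _ = (max 4 c⁻¹)⁻¹ := zpow_neg_one _
        _ ≤ (c⁻¹)⁻¹ := inv_anti₀ (inv_pos.2 hc) (le_max_right _ _)
        _ = c := inv_inv c
  obtain ⟨n₀, h4, h⟩ := hlarge
  exact ⟨n₀, h4, fun n hn => (errorRate_anti hd (by linarith) hn).trans h⟩

end ErrorRate

/-! ### The law of the loop-erased walk -/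

section Law

open scoped ENNReal

lemma List.finite_setOf_nodup_subset {α : Type*} {s : Set α} (hs : s.Finite) :
    {t : List α | t.Nodup ∧ ∀ x ∈ t, x ∈ s}.Finite := by
  have := hs.fintype
  refine ((List.finite_length_le s (Fintype.card s)).image (List.map Subtype.val)).subset ?_
  rintro t ⟨ht, hts⟩
  refine ⟨t.attachWith (· ∈ s) hts, ?_, by simp⟩
  exact List.Nodup.length_le_card (List.Nodup.of_map Subtype.val (by simpa using ht))

namespace LatticeWalk

variable {d : ℕ} (W : LatticeWalk d)

lemma exists_weight_close (hd : 2 ≤ d) :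
    ∃ C l₀ n₀ : ℝ, 0 < C ∧ 1 ≤ l₀ ∧ 4 ≤ n₀ ∧ ∀ l n : ℝ, l₀ ≤ l → n₀ ≤ n →
      ∀ K : Set W.lattice, W.ball (n * l) ⊆ K → ∀ η y, W.IsAdmissible K l η y →
        (1 - C * errorRate d n) * loopErasedWeight W.kernel (W.ball (n * l)) η y ≤
            loopErasedWeight W.kernel K η y ∧
          loopErasedWeight W.kernel K η y ≤
            (1 + C * errorRate d n) * loopErasedWeight W.kernel (W.ball (n * l)) η y := by
  by_cases h2 : d = 2
  · subst h2
    simp only [errorRate, if_true]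
    exact W.exists_weight_close_planar
  · simp only [errorRate, if_neg h2]
    exact W.exists_weight_close_transient (by omega)

lemma lerwLaw_eq_zero_of_not_nodup (l : ℕ) (K : Set W.lattice) {ω : List W.lattice}
    (hω : ¬ω.Nodup) : W.lerwLaw l K ω = 0 := by
  have : {X | initialSegment (W.ball l) (W.lerw K X) = ω} = ∅ := by
    refine Set.eq_empty_of_forall_notMem fun X hX => hω ?_
    rw [← show initialSegment (W.ball l) (W.lerw K X) = ω from hX]
    exact (List.take_sublist _ _).nodup (nodup_loopErase _)
  rw [lerwLaw, this, measureReal_empty]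

lemma lerwLaw_le_one (l : ℕ) (K : Set W.lattice) (ω : List W.lattice) : W.lerwLaw l K ω ≤ 1 :=
  measureReal_le_one

lemma lerwLaw_nonneg (l : ℕ) (K : Set W.lattice) (ω : List W.lattice) : 0 ≤ W.lerwLaw l K ω :=
  measureReal_nonneg

lemma pathProb_toReal_pos {x : W.lattice} {t : List W.lattice}
    (h : (x :: t).IsChain (fun x y => 0 < W.p (y - x))) : 0 < (pathProb W.kernel x t).toReal := by
  induction t generalizing x with
  | nil => simp [pathProb]
  | cons y t ih =>
    rw [List.isChain_cons_cons] at h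
    rw [pathProb, ENNReal.toReal_mul]
    exact mul_pos (ENNReal.toReal_pos h.1.ne' (W.p.apply_ne_top _)) (ih h.2)

lemma exit_eq_one_of_isChain {K : Set W.lattice} {x : W.lattice} {t : List W.lattice}
    (h : (x :: t).IsChain (fun x y => 0 < W.p (y - x))) (hK : ∀ z ∈ (x :: t).dropLast, z ∈ K)
    (hx : potential W.kernel K (Kᶜ.indicator 1) x = 1) :
    ∀ z ∈ x :: t, potential W.kernel K (Kᶜ.indicator 1) z = 1 := by
  induction t generalizing x with
  | nil => simpa using hx
  | cons y t ih =>
    rw [List.isChain_cons_cons] at h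
    rw [List.dropLast_cons_cons] at hK
    intro z hz
    rcases List.mem_cons.1 hz with rfl | hz
    · exact hx
    · exact ih h.2 (fun z hz => hK z (List.mem_cons_of_mem _ hz))
        (exit_eq_one_of_step W.tsum_kernel (hK x (by simp)) hx h.1.ne') z hz

lemma norm_lt_of_mem_outerBoundary {r : ℝ} {y : W.lattice} (hy : y ∈ W.outerBoundary (W.ball r)) :
    ‖y‖ < r + W.stepBound := by
  obtain ⟨-, z, hz, hzy⟩ := hy
  have h1 := W.norm_sub_le_stepBound (x := y) (y := z) hzy.ne'
  have h2 : ‖z‖ < r := hz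
  have h3 := norm_sub_le z (z - y)
  rw [sub_sub_cancel] at h3
  linarith

/-- The law of the loop-erased walk at a self-avoiding path is the product of a factor not depending
on the domain and the loop-erased weight. -/
lemma exists_lerwLaw_eq {l : ℕ} {ω : List W.lattice} (hω : ω ∈ W.pathsToBoundary l)
    (hnd : ω.Nodup) :
    1 ≤ l ∧ ∃ (P : ℝ) (η : List W.lattice) (y : W.lattice), 0 < P ∧ (l : ℝ) ≤ ‖y‖ ∧
      (∀ x ∈ η, x ∈ W.ball l) ∧
      ∀ K : Set W.lattice, W.ball l ⊆ K → W.ExitsAlmostSurely K →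
        W.lerwLaw l K ω = P * loopErasedWeight W.kernel K η y ∧
        ∀ l' : ℝ, (l : ℝ) ≤ l' → W.stepBound ≤ l' → W.IsAdmissible K l' η y := by
  classical
  obtain ⟨hhead, hchain, hin, y, hy, hyout⟩ := hω
  have hω' : ω.dropLast ++ [y] = ω := List.dropLast_append_getLast? y hy
  have hl : 1 ≤ l := by
    obtain ⟨-, z, hz, -⟩ := hyout
    have h1 : ‖z‖ < l := hz
    have h2 : (0 : ℝ) < l := (norm_nonneg z).trans_lt h1
    exact_mod_cast h2
  have h0 : (0 : W.lattice) ∈ W.ball l := by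
    rw [mem_ball, norm_zero]; exact_mod_cast hl
  obtain ⟨η, hη⟩ : ∃ η, ω.dropLast = 0 :: η := by
    rcases h : ω.dropLast with _ | ⟨a, η⟩
    · rw [h, List.nil_append] at hω'
      rw [← hω', List.head?_cons, Option.some_inj] at hhead
      exact absurd (hhead ▸ h0) hyout.1
    · rw [h] at hω'
      rw [← hω', List.cons_append, List.head?_cons, Option.some_inj] at hhead
      exact ⟨η, by rw [hhead]⟩
  rw [hη] at hω' hin
  have hwhole : ω = 0 :: (η ++ [y]) := by rw [← hω', List.cons_append]
  have hnd' : (0 :: η).Nodup := by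
    rw [← hω'] at hnd
    exact (List.nodup_append.1 hnd).1
  refine ⟨hl, (pathProb W.kernel 0 (η ++ [y])).toReal, 0 :: η, y,
    W.pathProb_toReal_pos (hwhole ▸ hchain), not_lt.1 hyout.1, hin, fun K hK hexit => ?_⟩
  have hexit0 := W.exit_probability_eq_one (hK h0) hexit
  have hall := W.exit_eq_one_of_isChain (hwhole ▸ hchain) (fun z hz => hK (hin z (by
    rwa [← List.cons_append, List.dropLast_concat] at hz))) hexit0
  refine ⟨?_, fun l' hl' hR => ⟨by simp, hnd', fun x hx => W.ball_subset_ball hl' (hin x hx),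
    fun x hx => hall x ?_, hall y (by simp), ?_⟩⟩
  · rw [W.lerwLaw_eq_loopErasedSum (hK h0) hexit (by rw [hwhole]; simp)
      (by rw [hη]; exact hin) ⟨y, hy, hyout.1⟩, ← hω',
      loopErasedSum_eq W.kernel (fun x hx => Set.indicator_of_notMem (s := Kᶜ) (fun h => h hx) _)
      0 y η hnd' (fun x hx => hK (hin x hx)), ENNReal.toReal_mul, ENNReal.toReal_mul, mul_assoc]
    rfl
  · rw [← List.cons_append]; exact List.mem_append_left _ hx
  · have := W.norm_lt_of_mem_outerBoundary hyout
    linarith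

lemma finite_nodup_pathsToBoundary (l : ℕ) : {ω ∈ W.pathsToBoundary l | ω.Nodup}.Finite := by
  refine (List.finite_setOf_nodup_subset (W.finite_ball (l + W.stepBound))).subset ?_
  rintro ω ⟨⟨-, -, hin, y, hy, hyout⟩, hnd⟩
  refine ⟨hnd, fun x hx => ?_⟩
  rw [← List.dropLast_append_getLast? y hy, List.mem_append, List.mem_singleton] at hx
  rcases hx with hx | rfl
  · exact W.ball_subset_ball (by linarith [W.one_le_stepBound]) (hin x hx)
  · exact W.norm_lt_of_mem_outerBoundary hyout

/-- A lower bound for escape probabilities from domains that miss the point `z`. -/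
lemma hit_le_escapeProb {K E : Set W.lattice} {l : ℝ} (hE : E ⊆ W.ball l) {z : W.lattice}
    (hz : z ∉ K) (y : W.lattice) :
    green W.kernel ((W.ball l)ᶜ \ {z}) y z ≤ escapeProb W.kernel K E y := by
  refine potential_le _ (fun x => ?_) y
  by_cases hxK : x ∈ K
  · have hxz : x ≠ z := by rintro rfl; exact hz hxK
    rw [pointCharge_of_ne hxz, zero_add]
    by_cases hxl : x ∈ W.ball l
    · rw [Set.indicator_of_notMem (s := (W.ball l)ᶜ \ {z}) (fun h => h.1 hxl)]
      exact zero_le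
    · have hxE : x ∈ K \ E := ⟨hxK, fun h => hxl (hE h)⟩
      rw [Set.indicator_of_mem (s := (W.ball l)ᶜ \ {z}) ⟨hxl, hxz⟩]
      conv_rhs => rw [escapeProb, potential_of_mem _ hxE]
      exact le_add_self
  · rw [escapeProb_self_of_notMem hxK]
    by_cases hxz : x = z
    · subst hxz
      rw [pointCharge_self, Set.indicator_of_notMem (s := (W.ball l)ᶜ \ {x}) (fun h => h.2 rfl),
        add_zero]
    · rw [pointCharge_of_ne hxz, zero_add]
      refine (Set.indicator_le_self' (fun _ _ => zero_le) x).trans ?_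
      exact (kernelStep_mono _ (escapeProb_le_one W.tsum_kernel K E) x).trans
        (kernelStep_const _ W.tsum_kernel 1 x).le

lemma escapeProb_le_loopErasedWeight {K : Set W.lattice} {l : ℝ} {η : List W.lattice} {y : W.lattice}
    (had : W.IsAdmissible K l η y) (hK : ∀ x ∈ η, x ∈ K) :
    (escapeProb W.kernel K {x | x ∈ η} y).toReal ≤ loopErasedWeight W.kernel K η y := by
  have hfin := greenProd_ne_top had.nodup fun x hx => green_self_ne_top W.tsum_kernel
    (hK x hx) (by rw [had.exit x hx]; exact one_ne_zero)
  have h := ENNReal.toReal_mono hfin (one_le_greenProd (k := W.kernel) K η)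
  rw [ENNReal.toReal_one] at h
  exact le_mul_of_one_le_left ENNReal.toReal_nonneg h

/-- The law of the loop-erased walk at a fixed self-avoiding path is bounded below uniformly in the
domain. A domain either contains a large ball, and can then be replaced by this ball, or misses a
point of this ball, and then the walk can escape by going to this point. -/
lemma exists_le_lerwLaw (hd : 2 ≤ d) {l : ℕ} {ω : List W.lattice} (hω : ω ∈ W.pathsToBoundary l)
    (hnd : ω.Nodup) : ∃ c : ℝ, 0 < c ∧ ∀ K : Set W.lattice, W.ball l ⊆ K →
      W.ExitsAlmostSurely K → c ≤ W.lerwLaw l K ω := by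
  obtain ⟨hl, P, η, y, hP, hy, hηl, hlaw⟩ := W.exists_lerwLaw_eq hω hnd
  obtain ⟨C, l₀, n₀, hC, hl₀, hn₀, hclose⟩ := W.exists_weight_close hd
  obtain ⟨n₁, hn₁, hrate⟩ := exists_errorRate_le hd (c := (2 * C)⁻¹) (by positivity)
  have hR := W.one_le_stepBound
  have h0 := W.coveringRadius_pos
  set l' := max (max (l : ℝ) l₀) (max W.stepBound (2 * W.coveringRadius)) with hl'def
  have hl' : (l : ℝ) ≤ l' := (le_max_left _ _).trans (le_max_left _ _)
  have hl₀' : l₀ ≤ l' := (le_max_right _ _).trans (le_max_left _ _)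
  have hR' : W.stepBound ≤ l' := (le_max_left _ _).trans (le_max_right _ _)
  have hc' : 2 * W.coveringRadius ≤ l' := (le_max_right _ _).trans (le_max_right _ _)
  set n := max n₀ n₁ with hn
  have hn4 : 4 ≤ n := hn₀.trans (le_max_left _ _)
  have hCn : C * errorRate d n ≤ 1 / 2 := by
    have h1 := mul_le_mul_of_nonneg_left (hrate n (le_max_right _ _)) hC.le
    have h2 : C * (2 * C)⁻¹ = 1 / 2 := by field_simp
    rwa [h2] at h1
  have hl'n : l' ≤ n * l' := by nlinarith
  set B := W.ball (n * l') with hB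
  obtain ⟨z₁, hz₁, -⟩ := W.exists_lattice_norm_mem hd (l := n * l') (by linarith)
  have hz₁B : z₁ ∉ B := fun h => by
    have : ‖z₁‖ < n * l' := h
    linarith
  let g : W.lattice → ℝ := fun z => (green W.kernel ((W.ball l)ᶜ \ {z}) y z).toReal
  have hg : ∀ z, (l : ℝ) ≤ ‖z‖ → 0 < g z := fun z hz =>
    ENNReal.toReal_pos (W.hit_avoiding_ball_ne_zero hd hy hz) (ne_top_of_le_ne_top
      ENNReal.one_ne_top (green_hit_le_one _ W.tsum_kernel _ _ fun h => h.2 rfl))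
  have hZfin : (insert z₁ (B \ W.ball l)).Finite :=
    ((W.finite_ball _).subset Set.sdiff_subset).insert z₁
  obtain ⟨z₂, hz₂, hmin⟩ := hZfin.toFinset.exists_min_image g
    ⟨z₁, hZfin.mem_toFinset.2 (Set.mem_insert _ _)⟩
  simp only [Set.Finite.mem_toFinset] at hz₂ hmin
  have hz₂l : (l : ℝ) ≤ ‖z₂‖ := by
    rcases hz₂ with rfl | hz₂
    · linarith
    · exact not_lt.1 fun h => hz₂.2 h
  have hgz₂ := hg z₂ hz₂l
  have hesc : ∀ K : Set W.lattice, ∀ z ∉ K, g z ≤ (escapeProb W.kernel K {x | x ∈ η} y).toReal :=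
    fun K z hz => ENNReal.toReal_mono (ne_top_of_le_ne_top ENNReal.one_ne_top
      (escapeProb_le_one W.tsum_kernel K _ y)) (W.hit_le_escapeProb (fun x hx => hηl x hx) hz y)
  refine ⟨P * (1 / 2 * g z₂), by positivity, fun K hK hexit => ?_⟩
  obtain ⟨heq, had⟩ := hlaw K hK hexit
  rw [heq]
  refine mul_le_mul_of_nonneg_left ?_ hP.le
  by_cases hBK : B ⊆ K
  · have h1 := (hclose l' n hl₀' (le_max_left _ _) K hBK η y (had l' hl' hR')).1
    have hBfin : B.Finite := W.finite_ball _
    have hadB : W.IsAdmissible B l' η y := by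
      have h := had l' hl' hR'
      exact ⟨h.ne_nil, h.nodup, h.mem_ball, fun x _ => W.exit_eq_one_of_finite (by omega) hBfin x,
        W.exit_eq_one_of_finite (by omega) hBfin y, h.norm_last⟩
    have h2 := (hesc B z₁ hz₁B).trans
      (W.escapeProb_le_loopErasedWeight hadB
      fun x hx => W.ball_subset_ball hl'n (hadB.mem_ball x hx))
    have h3 := (hmin z₁ (Set.mem_insert _ _)).trans h2
    refine le_trans ?_ h1
    exact mul_le_mul (by linarith) h3 hgz₂.le (by linarith)
  · obtain ⟨z, hzB, hzK⟩ := Set.not_subset.1 hBK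
    have h1 := hmin z (Set.mem_insert_of_mem _ ⟨hzB, fun h => hzK (hK h)⟩)
    have h2 := (h1.trans (hesc K z hzK)).trans
      (W.escapeProb_le_loopErasedWeight (had l' hl' hR') fun x hx => hK (hηl x hx))
    linarith

/-- The laws in two domains containing `B_{4l}` are comparable. Only finitely many paths have to be
considered for small `l`. -/
theorem exists_lerwLaw_comparable (hd : 2 ≤ d) :
    ∃ C : ℝ, 0 < C ∧ ∀ (l : ℕ) (K₁ K₂ : Set W.lattice), W.ball (4 * l) ⊆ K₁ →
      W.ball (4 * l) ⊆ K₂ → W.ExitsAlmostSurely K₁ → W.ExitsAlmostSurely K₂ →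
      ∀ ω ∈ W.pathsToBoundary l, W.lerwLaw l K₁ ω ≤ C * W.lerwLaw l K₂ ω := by
  obtain ⟨C, l₀, hC, hl₀, hcomp⟩ := W.exists_weight_comparable hd
  obtain ⟨N, hN⟩ := exists_nat_ge (max l₀ W.stepBound)
  have hsub : ∀ (l : ℕ) (K : Set W.lattice), W.ball (4 * l) ⊆ K → W.ball l ⊆ K := fun l K h =>
    (W.ball_subset_ball (by linarith [Nat.cast_nonneg (α := ℝ) l])).trans h
  have hsmall : ∀ᶠ c in nhdsWithin (0 : ℝ) (Set.Ioi 0), ∀ l ∈ Set.Iio N,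
      ∀ ω ∈ {ω ∈ W.pathsToBoundary l | ω.Nodup}, ∀ K : Set W.lattice, W.ball l ⊆ K →
        W.ExitsAlmostSurely K → c ≤ W.lerwLaw l K ω := by
    refine (Filter.eventually_all_finite (Set.finite_Iio N)).2 fun l _ =>
      (Filter.eventually_all_finite (W.finite_nodup_pathsToBoundary l)).2 fun ω hω => ?_
    obtain ⟨c, hc, h⟩ := W.exists_le_lerwLaw hd hω.1 hω.2
    filter_upwards [Ioo_mem_nhdsGT hc] with c' hc' K hK hexit
    exact hc'.2.le.trans (h K hK hexit)
  obtain ⟨c, hc, hc0⟩ := (hsmall.and self_mem_nhdsWithin).exists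
  have hc0 : 0 < c := hc0
  refine ⟨max (C * C) c⁻¹, lt_max_of_lt_left (mul_pos hC hC),
    fun l K₁ K₂ hK₁ hK₂ hexit₁ hexit₂ ω hω => ?_⟩
  by_cases hnd : ω.Nodup
  swap
  · rw [W.lerwLaw_eq_zero_of_not_nodup l K₁ hnd, W.lerwLaw_eq_zero_of_not_nodup l K₂ hnd, mul_zero]
  by_cases hlN : l < N
  · have h1 := hc l hlN ω ⟨hω, hnd⟩ K₂ (hsub l K₂ hK₂) hexit₂
    calc W.lerwLaw l K₁ ω ≤ 1 := W.lerwLaw_le_one l K₁ ω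
      _ = c⁻¹ * c := (inv_mul_cancel₀ hc0.ne').symm
      _ ≤ _ := mul_le_mul (le_max_right _ _) h1 hc0.le
        (le_max_of_le_right (inv_nonneg.2 hc0.le))
  · obtain ⟨hl, P, η, y, hP, hy, -, hlaw⟩ := W.exists_lerwLaw_eq hω hnd
    have hNl : (N : ℝ) ≤ l := by exact_mod_cast not_lt.1 hlN
    have hll₀ : l₀ ≤ l := (le_max_left _ _).trans (hN.trans hNl)
    have hlR : W.stepBound ≤ l := (le_max_right _ _).trans (hN.trans hNl)
    obtain ⟨heq₁, had₁⟩ := hlaw K₁ (hsub l K₁ hK₁) hexit₁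
    obtain ⟨heq₂, had₂⟩ := hlaw K₂ (hsub l K₂ hK₂) hexit₂
    have h1 := (hcomp l hll₀ K₁ hK₁ η y (had₁ l le_rfl hlR)).2
    have h2 := (hcomp l hll₀ K₂ hK₂ η y (had₂ l le_rfl hlR)).1
    rw [inv_mul_le_iff₀ hC] at h2
    have h3 := h1.trans (mul_le_mul_of_nonneg_left h2 hC.le)
    rw [heq₁]
    calc P * loopErasedWeight W.kernel K₁ η y ≤
          P * (C * (C * loopErasedWeight W.kernel K₂ η y)) := mul_le_mul_of_nonneg_left h3 hP.le
      _ = C * C * W.lerwLaw l K₂ ω := by rw [heq₂]; ring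
      _ ≤ _ := mul_le_mul_of_nonneg_right (le_max_left _ _) (W.lerwLaw_nonneg l K₂ ω)

/-- The laws in two domains containing `B_{nl}` are close, since both are close to the law in the
ball `B_{nl}` itself. -/
theorem exists_lerwLaw_le (hd : 2 ≤ d) :
    ∃ C : ℝ, 0 < C ∧ ∀ (n : ℝ) (l : ℕ) (K₁ K₂ : Set W.lattice), 4 ≤ n → W.ball (n * l) ⊆ K₁ →
      W.ball (n * l) ⊆ K₂ → W.ExitsAlmostSurely K₁ → W.ExitsAlmostSurely K₂ →
      ∀ ω ∈ W.pathsToBoundary l, W.lerwLaw l K₁ ω ≤ (1 + C * errorRate d n) * W.lerwLaw l K₂ ω := by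
  obtain ⟨C, l₀, n₀, hC, hl₀, hn₀, hclose⟩ := W.exists_weight_close hd
  obtain ⟨C', hC', hcomp⟩ := W.exists_lerwLaw_comparable hd
  have hR := W.one_le_stepBound
  -- the scale `l` is replaced by `r l`, which is large for all `l ≥ 1`
  set r := max l₀ W.stepBound with hr
  have hr1 : 1 ≤ r := hl₀.trans (le_max_left _ _)
  obtain ⟨A, n₁, hA, hn₁⟩ := exists_errorRate_div_le hd hr1
  obtain ⟨n₂, hn₂, hn₂'⟩ := exists_errorRate_le hd (c := (2 * (C * A))⁻¹) (by positivity)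
  set m := max (max (n₀ * r) n₁) n₂ with hm
  have hm4 : 4 ≤ m := hn₂.trans (le_max_right _ _)
  have hem : 0 < errorRate d m := errorRate_pos d (by linarith)
  refine ⟨max (4 * (C * A)) (C' / errorRate d m), lt_max_of_lt_left (by positivity),
    fun n l K₁ K₂ hn hK₁ hK₂ hexit₁ hexit₂ ω hω => ?_⟩
  have he : 0 < errorRate d n := errorRate_pos d (by linarith)
  have hnonneg := W.lerwLaw_nonneg l K₂ ω
  have hl0 : (0 : ℝ) ≤ l := Nat.cast_nonneg l
  by_cases hnm : n < m
  · have hsub : W.ball (4 * l) ⊆ W.ball (n * l) := W.ball_subset_ball (by gcongr)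
    refine (hcomp l K₁ K₂ (hsub.trans hK₁) (hsub.trans hK₂) hexit₁ hexit₂ ω hω).trans
      (mul_le_mul_of_nonneg_right ?_ hnonneg)
    have h1 := errorRate_anti hd (by linarith) hnm.le
    have h2 : C' ≤ C' / errorRate d m * errorRate d n := by
      rw [div_mul_eq_mul_div, le_div_iff₀ hem]
      exact mul_le_mul_of_nonneg_left h1 hC'.le
    have h3 : C' / errorRate d m * errorRate d n ≤
        max (4 * (C * A)) (C' / errorRate d m) * errorRate d n :=
      mul_le_mul_of_nonneg_right (le_max_right _ _) he.le
    linarith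
  · push Not at hnm
    by_cases hnd : ω.Nodup
    swap
    · rw [W.lerwLaw_eq_zero_of_not_nodup l K₁ hnd, W.lerwLaw_eq_zero_of_not_nodup l K₂ hnd, mul_zero]
    obtain ⟨hl, P, η, y, hP, hy, -, hlaw⟩ := W.exists_lerwLaw_eq hω hnd
    have hl1 : (1 : ℝ) ≤ l := by exact_mod_cast hl
    have hlr : (l : ℝ) ≤ r * l := le_mul_of_one_le_left hl0 hr1
    have hrl : r ≤ r * l := le_mul_of_one_le_right (by linarith) hl1
    have hball : n / r * (r * l) = n * l := by field_simp
    have hsub : W.ball l ⊆ W.ball (n * l) := W.ball_subset_ball (by nlinarith)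
    have hn₀n : n₀ ≤ n / r := by
      rw [le_div_iff₀ (by linarith)]
      exact (le_max_left _ _).trans ((le_max_left _ _).trans hnm)
    obtain ⟨heq₁, had₁⟩ := hlaw K₁ (hsub.trans hK₁) hexit₁
    obtain ⟨heq₂, had₂⟩ := hlaw K₂ (hsub.trans hK₂) hexit₂
    have h1 := (hclose (r * l) (n / r) ((le_max_left _ _).trans hrl) hn₀n K₁ (by rwa [hball]) η y
      (had₁ _ hlr ((le_max_right _ _).trans hrl))).2
    have h2 := (hclose (r * l) (n / r) ((le_max_left _ _).trans hrl) hn₀n K₂ (by rwa [hball]) η y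
      (had₂ _ hlr ((le_max_right _ _).trans hrl))).1
    rw [hball] at h1 h2
    set w := loopErasedWeight W.kernel (W.ball (n * l)) η y
    set w₁ := loopErasedWeight W.kernel K₁ η y
    set w₂ := loopErasedWeight W.kernel K₂ η y
    have hw : 0 ≤ w := mul_nonneg ENNReal.toReal_nonneg ENNReal.toReal_nonneg
    set ε := C * A * errorRate d n with hε
    have hε0 : 0 ≤ ε := by positivity
    have hε2 : ε ≤ 1 / 2 := by
      have h3 := mul_le_mul_of_nonneg_left (hn₂' n ((le_max_right _ _).trans hnm))
        (show 0 ≤ C * A by positivity)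
      have h4 : C * A * (2 * (C * A))⁻¹ = 1 / 2 := by field_simp
      rwa [h4] at h3
    have hεr : C * errorRate d (n / r) ≤ ε := by
      have h3 := mul_le_mul_of_nonneg_left (hn₁ n ((le_max_right _ _).trans
        ((le_max_left _ _).trans hnm))) hC.le
      rwa [← mul_assoc] at h3
    have h3 : w₁ ≤ (1 + ε) * w := h1.trans (mul_le_mul_of_nonneg_right (by linarith) hw)
    have h4 : (1 - ε) * w ≤ w₂ := (mul_le_mul_of_nonneg_right (by linarith) hw).trans h2
    have h5 : w₁ ≤ (1 + 4 * ε) * w₂ := by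
      have h6 := mul_le_mul_of_nonneg_left h4 (show 0 ≤ 1 + 4 * ε by linarith)
      have h7 : (1 + ε) * w ≤ (1 + 4 * ε) * ((1 - ε) * w) := by
        rw [← mul_assoc]
        exact mul_le_mul_of_nonneg_right (by nlinarith) hw
      linarith
    have h6 : 1 + 4 * ε ≤ 1 + max (4 * (C * A)) (C' / errorRate d m) * errorRate d n := by
      have := mul_le_mul_of_nonneg_right (le_max_left (4 * (C * A)) (C' / errorRate d m)) he.le
      rw [hε]
      linarith
    rw [heq₁]
    calc P * w₁ ≤ P * ((1 + 4 * ε) * w₂) := mul_le_mul_of_nonneg_left h5 hP.le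
      _ = (1 + 4 * ε) * W.lerwLaw l K₂ ω := by rw [heq₂]; ring
      _ ≤ _ := mul_le_mul_of_nonneg_right h6 hnonneg

end LatticeWalk

lemma sub_mul_le_of_le_add_mul {ε a b : ℝ} (ha : 0 ≤ a) (hb : 0 ≤ b) (h : b ≤ (1 + ε) * a) :
    (1 - ε) * b ≤ a := by
  rcases le_total ε 1 with h1 | h1
  · have := mul_le_mul_of_nonneg_left h (sub_nonneg.2 h1)
    nlinarith [mul_nonneg (sq_nonneg ε) ha]
  · have := mul_nonneg (sub_nonneg.2 h1) hb
    linarith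

end Law

theorem mainTheorem8 (d : ℕ) (hd : 2 ≤ d) (W : LatticeWalk d) :
    (d = 2 → ∃ C : ℝ, 0 < C ∧ ∀ (n : ℝ) (l : ℕ) (K₁ K₂ : Set W.lattice),
      4 ≤ n → W.ball (n * l) ⊆ K₁ → W.ball (n * l) ⊆ K₂ →
      W.ExitsAlmostSurely K₁ → W.ExitsAlmostSurely K₂ →
      ∀ ω ∈ W.pathsToBoundary l,
        (1 - C * (1 / Real.log n)) * W.lerwLaw l K₂ ω ≤ W.lerwLaw l K₁ ω ∧
        W.lerwLaw l K₁ ω ≤ (1 + C * (1 / Real.log n)) * W.lerwLaw l K₂ ω) ∧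
    (3 ≤ d → ∃ C : ℝ, 0 < C ∧ ∀ (n : ℝ) (l : ℕ) (K₁ K₂ : Set W.lattice),
      4 ≤ n → W.ball (n * l) ⊆ K₁ → W.ball (n * l) ⊆ K₂ →
      W.ExitsAlmostSurely K₁ → W.ExitsAlmostSurely K₂ →
      ∀ ω ∈ W.pathsToBoundary l,
        (1 - C * n ^ (2 - (d : ℤ))) * W.lerwLaw l K₂ ω ≤ W.lerwLaw l K₁ ω ∧
        W.lerwLaw l K₁ ω ≤ (1 + C * n ^ (2 - (d : ℤ))) * W.lerwLaw l K₂ ω) ∧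
    (∃ C : ℝ, 0 < C ∧ ∀ (l : ℕ) (K₁ K₂ : Set W.lattice),
      W.ball (4 * l) ⊆ K₁ → W.ball (4 * l) ⊆ K₂ →
      W.ExitsAlmostSurely K₁ → W.ExitsAlmostSurely K₂ →
      ∀ ω ∈ W.pathsToBoundary l,
        C⁻¹ * W.lerwLaw l K₂ ω ≤ W.lerwLaw l K₁ ω ∧
        W.lerwLaw l K₁ ω ≤ C * W.lerwLaw l K₂ ω) := by
  obtain ⟨C, hC, hclose⟩ := W.exists_lerwLaw_le hd
  obtain ⟨C', hC', hcomp⟩ := W.exists_lerwLaw_comparable hd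
  refine ⟨fun h2 => ⟨C, hC, fun n l K₁ K₂ hn hK₁ hK₂ he₁ he₂ ω hω => ?_⟩,
    fun h3 => ⟨C, hC, fun n l K₁ K₂ hn hK₁ hK₂ he₁ he₂ ω hω => ?_⟩,
    C', hC', fun l K₁ K₂ hK₁ hK₂ he₁ he₂ ω hω => ?_⟩
  · have h : errorRate d n = 1 / Real.log n := if_pos h2
    rw [← h]
    exact ⟨sub_mul_le_of_le_add_mul (W.lerwLaw_nonneg l K₁ ω) (W.lerwLaw_nonneg l K₂ ω)
      (hclose n l K₂ K₁ hn hK₂ hK₁ he₂ he₁ ω hω), hclose n l K₁ K₂ hn hK₁ hK₂ he₁ he₂ ω hω⟩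
  · have h : errorRate d n = n ^ (2 - (d : ℤ)) := if_neg (by omega)
    rw [← h]
    exact ⟨sub_mul_le_of_le_add_mul (W.lerwLaw_nonneg l K₁ ω) (W.lerwLaw_nonneg l K₂ ω)
      (hclose n l K₂ K₁ hn hK₂ hK₁ he₂ he₁ ω hω), hclose n l K₁ K₂ hn hK₁ hK₂ he₁ he₂ ω hω⟩
  · refine ⟨?_, hcomp l K₁ K₂ hK₁ hK₂ he₁ he₂ ω hω⟩
    rw [inv_mul_le_iff₀ hC']
    exact hcomp l K₂ K₁ hK₂ hK₁ he₂ he₁ ω hω
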